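/- Let $(M^{2m},\omega)$ be a compact symplectic manifold (without boundary) and let $n\ge 1$. For $c>0$ let $B^{2m}(c)\subset(\mathbb R^{2m},\omega_0)$ be the closed ball of radius $r$ centred at the origin, where $c=\pi r^2$. For an $n$-tuple of capacities $\mathbf c=(c_1,\dots,c_n)$, $c_i>0$, let $\mathrm{Emb}_n(\mathbf c,M)$ be the space, with the $C^\infty$-topology, of symplectic embeddings $B^{2m}(c_1)\sqcup\dots\sqcup B^{2m}(c_n)\hookrightarrow(M,\omega)$ (embeddings of closed balls that extend smoothly to a neighbourhood). Let $\mathrm{SpFr}(n,M)$ be the space of symplectic frames at $n$ distinct ordered points of $M$, i.e. of $n$-tuples of linear symplectic isomorphisms $(\mathbb R^{2m},\omega_0)\to(T_{x_i}M,\omega_{x_i})$ with $x_1,\dots,x_n$ pairwise distinct. Let $j_{\mathbf c}:\mathrm{Emb}_n(\mathbf c,M)\to\mathrm{SpFr}(n,M)$ be the map that evaluates the derivatives at the centres of the balls. Write $\mathbf c\le\mathbf c'$ if $c_i\le c'_i$ for all $i$; for $\mathbf c\le\mathbf c'$, restriction gives a map $\mathrm{Emb}_n(\mathbf c',M)\to\mathrm{Emb}_n(\mathbf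 c,M)$. The maps $j_{\mathbf c}$ are compatible with these restrictions and induce a map $j_\infty:\varinjlim_{\mathbf c}\mathrm{Emb}_n(\mathbf c,M)\to\mathrm{SpFr}(n,M)$ on the direct limit (in topological spaces) as the capacities decrease. Then: 1. There exist capacities $\mathbf c_0=(c_1,\dots,c_n)$ such that for all $\mathbf c\le\mathbf c_0$ the map $j_{\mathbf c}$ is surjective on homotopy groups, in the following sense: $\pi_0(j_{\mathbf c})$ is surjective, and over every base point $\mathbf f\in\mathrm{SpFr}(n,M)$ there is a base point $\iota\in\mathrm{Emb}_n(\mathbf c,M)$ with $j_{\mathbf c}(\iota)=\mathbf f$ such that $\pi_k(j_{\mathbf c}):\pi_k(\mathrm{Emb}_n(\mathbf c,M),\iota)\to\pi_k(\mathrm{SpFr}(n,M),\mathbf f)$ is surjective for all $k\ge1$. 2. The map $j_\infty:\varinjlim_{\mathbf c}\mathrm{Emb}_n(\mathbf c,M)\to\mathrm{SpFr}(n,M)$ is a weak homotopy equivalence. -/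

import Mathlib

open scoped Manifold ContDiff Topology
open Set Bundle

set_option linter.unusedSectionVars false

noncomputable section

namespace SymplecticBalls

/-! ### Induced maps on homotopy groups and weak homotopy equivalences -/

section Homotopy

variable {X Y : Type*} [TopologicalSpace X] [TopologicalSpace Y]

/-- The map `π₀(f) : π₀(X) → π₀(Y)` on sets of path components. -/
def pi0Map (f : C(X, Y)) : ZerothHomotopy X → ZerothHomotopy Y :=
  ZerothHomotopy.lift (fun x => ZerothHomotopy.mk (f x))
    (fun _ _ p => ZerothHomotopy.sound (p.map f.continuous))

/-- Composition of a based `k`-dimensional cube in `X` with `f : X → Y`. -/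
def genLoopMap (k : ℕ) (f : C(X, Y)) (x : X) (γ : GenLoop (Fin k) X x) :
    GenLoop (Fin k) Y (f x) :=
  ⟨f.comp γ.1, fun y hy => congrArg f (γ.2 y hy)⟩

/-- The map `π_k(f) : π_k(X, x) → π_k(Y, f x)`. -/
def piMap (k : ℕ) (f : C(X, Y)) (x : X) : HomotopyGroup.Pi k X x → HomotopyGroup.Pi k Y (f x) :=
  Quotient.map (genLoopMap k f x) (fun _ _ h => h.comp_continuousMap f)

/-- A weak homotopy equivalence: a bijection on path components and on all homotopy groups
`π_k`, `k ≥ 1`, at all base points. -/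
def IsWeakHomotopyEquiv (f : C(X, Y)) : Prop :=
  Function.Bijective (pi0Map f) ∧
    ∀ (x : X) (k : ℕ), 1 ≤ k → Function.Bijective (piMap k f x)

end Homotopy

/-! ### Symplectic manifolds -/

/-- Euclidean space `ℝ²ᵐ`, with coordinates `x₁, …, xₘ` (left) and `y₁, …, yₘ` (right). -/
abbrev E (m : ℕ) := EuclideanSpace ℝ (Fin m ⊕ Fin m)

/-- The standard symplectic form `∑ dxᵢ ∧ dyᵢ` on `ℝ²ᵐ`. -/
def stdForm {m : ℕ} (u v : E m) : ℝ :=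
  ∑ i : Fin m, (u (Sum.inl i) * v (Sum.inr i) - u (Sum.inr i) * v (Sum.inl i))

section Form

variable (m : ℕ) (M : Type*) [TopologicalSpace M] [ChartedSpace (E m) M]

/-- A (not necessarily smooth) differential 2-form on `M`. -/
abbrev TwoForm := ∀ x : M, TangentSpace 𝓘(ℝ, E m) x [⋀^Fin 2]→L[ℝ] ℝ

variable {m M}

/-- The expression `(ψ⁻¹)^* ω` of a 2-form `ω` (here `σ`) in a chart `ψ`. -/
def inChart (σ : TwoForm m M) (ψ : OpenPartialHomeomorph M (E m)) :
    E m → E m [⋀^Fin 2]→L[ℝ] ℝ :=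
  fun y => (σ (ψ.symm y)).compContinuousLinearMap (mfderiv 𝓘(ℝ, E m) 𝓘(ℝ, E m) ψ.symm y)

variable (m M)

/-- A symplectic form: a smooth closed nondegenerate 2-form. -/
structure SymplecticForm where
  /-- the underlying 2-form -/
  form : TwoForm m M
  smooth : ∀ ψ ∈ atlas (E m) M, ContDiffOn ℝ ∞ (inChart form ψ) ψ.target
  closed : ∀ ψ ∈ atlas (E m) M, ∀ y ∈ ψ.target, extDeriv (inChart form ψ) y = 0
  nondegenerate : ∀ (x : M) (u : TangentSpace 𝓘(ℝ, E m) x),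
    (∀ v : TangentSpace 𝓘(ℝ, E m) x, form x ![u, v] = 0) → u = 0

end Form

/-! ### Spaces of symplectic embeddings of balls -/

/-- The closed ball `B²ᵐ(c)` of capacity `c`, that is, of radius `r` with `c = π r²`. -/
def ball (m : ℕ) (c : ℝ) : Set (E m) := Metric.closedBall 0 (√(c / Real.pi))

theorem zero_mem_ball (m : ℕ) (c : ℝ) : (0 : E m) ∈ ball m c :=
  Metric.mem_closedBall_self (Real.sqrt_nonneg _)

theorem ball_mono (m : ℕ) {c c' : ℝ} (h : c ≤ c') : ball m c ⊆ ball m c' :=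
  Metric.closedBall_subset_closedBall
    (Real.sqrt_le_sqrt (div_le_div_of_nonneg_right h Real.pi_pos.le))

theorem ball_mem_nhds (m : ℕ) {c : ℝ} (h : 0 < c) : ball m c ∈ 𝓝 (0 : E m) :=
  Metric.closedBall_mem_nhds 0 (Real.sqrt_pos.2 (div_pos h Real.pi_pos))

/-- `n`-tuples of (positive) capacities, ordered componentwise. -/
abbrev Cap (n : ℕ) := {c : Fin n → ℝ // ∀ i, 0 < c i}

/-- The componentwise minimum of two tuples of capacities. -/
def Cap.min {n : ℕ} (c c' : Cap n) : Cap n :=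
  ⟨fun i => Min.min (c.1 i) (c'.1 i), fun i => lt_min (c.2 i) (c'.2 i)⟩

theorem Cap.min_le_left {n : ℕ} (c c' : Cap n) : c.min c' ≤ c := fun _ => _root_.min_le_left _ _

theorem Cap.min_le_right {n : ℕ} (c c' : Cap n) : c.min c' ≤ c' := fun _ => _root_.min_le_right _ _

variable {m n : ℕ} {M : Type*} [TopologicalSpace M] [ChartedSpace (E m) M]

/-- A map on a ball, regarded as a map on `ℝ²ᵐ` (its values outside of the ball play no role). -/
def extend {c : ℝ} (f : ball m c → M) (z : E m) : M :=
  open Classical in if h : z ∈ ball m c then f ⟨z, h⟩ else f ⟨0, zero_mem_ball m c⟩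

/-- A map `f` from a closed ball to `M` is smooth with `f^* ω = ω₀`: it is the restriction of a
smooth map `F` defined on an open neighbourhood of the ball, and `F^* ω = ω₀` on the ball. -/
def IsSymplecticMap (σ : SymplecticForm m M) {c : ℝ} (f : ball m c → M) : Prop :=
  ∃ (U : Set (E m)) (F : E m → M), IsOpen U ∧ ball m c ⊆ U ∧
    ContMDiffOn 𝓘(ℝ, E m) 𝓘(ℝ, E m) ∞ F U ∧ (∀ z : ball m c, F z = f z) ∧
    ∀ z ∈ ball m c, ∀ u v : E m,
      σ.form (F z) ![mfderiv 𝓘(ℝ, E m) 𝓘(ℝ, E m) F z u, mfderiv 𝓘(ℝ, E m) 𝓘(ℝ, E m) F z v]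
        = stdForm u v

/-- The set `Emb_n(c, M)` of symplectic embeddings of the disjoint union of the closed balls
`B²ᵐ(c₁), …, B²ᵐ(cₙ)` into `(M, ω)`. -/
def Emb (σ : SymplecticForm m M) (c : Cap n) : Type _ :=
  {f : ∀ i, ball m (c.1 i) → M //
    (∀ i, IsSymplecticMap σ (f i)) ∧
    Function.Injective (fun z : Σ i, ball m (c.1 i) => f z.1 z.2)}

/-- The basic neighbourhood of `f` of the `C^∞`-topology attached to the `i`-th ball, a compact
subset `K` of it, a chart `ψ` of `M`, an order `k` and `ε`: all `g` that map `K` into the domain of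
`ψ` and whose derivatives of order `≤ k`, read in `ψ`, are `ε`-close to those of `f` on `K`. -/
def Emb.basicNhd {σ : SymplecticForm m M} {c : Cap n} (f : Emb σ c) (i : Fin n) (K : Set (E m))
    (ψ : OpenPartialHomeomorph M (E m)) (k : ℕ) (ε : ℝ) : Set (Emb σ c) :=
  {g | ∀ z ∈ K, extend (g.1 i) z ∈ ψ.source ∧ ∀ j ≤ k,
    ‖iteratedFDerivWithin ℝ j (ψ ∘ extend (g.1 i)) (ball m (c.1 i)) z -
      iteratedFDerivWithin ℝ j (ψ ∘ extend (f.1 i)) (ball m (c.1 i)) z‖ < ε}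

/-- The `C^∞`-topology on `Emb_n(c, M)`. -/
instance (σ : SymplecticForm m M) (c : Cap n) : TopologicalSpace (Emb σ c) :=
  TopologicalSpace.generateFrom
    {N | ∃ (f : Emb σ c) (i : Fin n) (K : Set (E m)) (ψ : OpenPartialHomeomorph M (E m)) (k : ℕ)
        (ε : ℝ), IsCompact K ∧ K ⊆ ball m (c.1 i) ∧ ψ ∈ atlas (E m) M ∧
        (∀ z ∈ K, extend (f.1 i) z ∈ ψ.source) ∧ 0 < ε ∧ N = f.basicNhd i K ψ k ε}

/-- The restriction map `Emb_n(c', M) → Emb_n(c, M)` for `c ≤ c'`. -/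
def Emb.restrict {σ : SymplecticForm m M} {c c' : Cap n} (h : c ≤ c') (f : Emb σ c') :
    Emb σ c :=
  ⟨fun i z => f.1 i ⟨z.1, ball_mono m (h i) z.2⟩, by
    refine ⟨fun i => ?_, fun z w hzw => ?_⟩
    · obtain ⟨U, F, hU, hsub, hF, hFf, hσ⟩ := f.2.1 i
      exact ⟨U, F, hU, (ball_mono m (h i)).trans hsub, hF,
        fun z => hFf ⟨z.1, ball_mono m (h i) z.2⟩, fun z hz => hσ z (ball_mono m (h i) hz)⟩
    · obtain ⟨i, z⟩ := z
      obtain ⟨j, w⟩ := w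
      have := f.2.2 (a₁ := ⟨i, ⟨z.1, ball_mono m (h i) z.2⟩⟩)
        (a₂ := ⟨j, ⟨w.1, ball_mono m (h j) w.2⟩⟩) hzw
      obtain ⟨rfl, h2⟩ := Sigma.mk.inj this
      have h3 := congrArg Subtype.val (eq_of_heq h2)
      simp only at h3
      rw [Subtype.ext h3]⟩

/-- Two embeddings (of balls of possibly different capacities) are identified in the direct limit
if they have the same restriction to smaller balls. -/
instance embSetoid (σ : SymplecticForm m M) (n : ℕ) : Setoid (Σ c : Cap n, Emb σ c) where
  r f g := ∃ (c : Cap n) (hf : c ≤ f.1) (hg : c ≤ g.1), f.2.restrict hf = g.2.restrict hg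
  iseqv :=
    ⟨fun f => ⟨f.1, le_rfl, le_rfl, rfl⟩,
      fun ⟨c, hf, hg, h⟩ => ⟨c, hg, hf, h.symm⟩,
      fun ⟨c, hf, _, h⟩ ⟨c', _, hg', h'⟩ =>
        ⟨c.min c', (c.min_le_left c').trans hf, (c.min_le_right c').trans hg',
          (congrArg (Emb.restrict (c.min_le_left c')) h).trans
            (congrArg (Emb.restrict (c.min_le_right c')) h')⟩⟩

/-- The direct limit of the spaces `Emb_n(c, M)` along the restriction maps as the capacities
decrease, with the direct limit (final) topology. -/
def EmbLim (σ : SymplecticForm m M) (n : ℕ) : Type _ := Quotient (embSetoid σ n)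

instance (σ : SymplecticForm m M) (n : ℕ) : TopologicalSpace (EmbLim σ n) :=
  inferInstanceAs (TopologicalSpace (Quotient (embSetoid σ n)))

theorem extend_eventuallyEq {c : ℝ} (hc : 0 < c) {f : ball m c → M} {F : E m → M}
    (h : ∀ z : ball m c, F z = f z) : extend f =ᶠ[𝓝 0] F := by
  filter_upwards [ball_mem_nhds m hc] with z hz
  rw [extend, dif_pos hz, ← h ⟨z, hz⟩]

theorem form_congr (σ : SymplecticForm m M) {p q : M} (h : p = q) (a b : E m) :
    σ.form p ![a, b] = σ.form q ![a, b] := by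
  subst h; rfl

theorem norm_fderiv_sub_le {m : ℕ} {s : Set (E m)} (hs : s ∈ 𝓝 0) (f g : E m → E m) :
    ‖fderiv ℝ g 0 - fderiv ℝ f 0‖ ≤
      ‖iteratedFDerivWithin ℝ 1 g s 0 - iteratedFDerivWithin ℝ 1 f s 0‖ := by
  have hs' : s =ᶠ[𝓝 0] (Set.univ : Set (E m)) := Filter.eventuallyEq_univ.2 hs
  rw [iteratedFDerivWithin_congr_set hs', iteratedFDerivWithin_congr_set hs',
    iteratedFDerivWithin_univ, iteratedFDerivWithin_univ]
  refine ContinuousLinearMap.opNorm_le_bound _ (norm_nonneg _) fun v => ?_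
  have := (iteratedFDeriv ℝ 1 g 0 - iteratedFDeriv ℝ 1 f 0).le_opNorm (fun _ => v)
  simpa [iteratedFDeriv_one_apply] using this

/-- In the `C^∞`-topology, the value and the derivative at a centre depend continuously on the
embedding. -/
theorem Emb.eventually_near {σ : SymplecticForm m M} {c : Cap n} (f : Emb σ c) (i : Fin n)
    {ε : ℝ} (hε : 0 < ε) :
    ∀ᶠ g : Emb σ c in 𝓝 f, extend (g.1 i) 0 ∈ (chartAt (E m) (extend (f.1 i) 0)).source ∧
      ‖chartAt (E m) (extend (f.1 i) 0) (extend (g.1 i) 0) -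
        chartAt (E m) (extend (f.1 i) 0) (extend (f.1 i) 0)‖ < ε ∧
      ‖fderiv ℝ (chartAt (E m) (extend (f.1 i) 0) ∘ extend (g.1 i)) 0 -
        fderiv ℝ (chartAt (E m) (extend (f.1 i) 0) ∘ extend (f.1 i)) 0‖ < ε := by
  set ψ := chartAt (E m) (extend (f.1 i) 0) with hψ
  have hopen : IsOpen (f.basicNhd i {0} ψ 1 ε) :=
    TopologicalSpace.isOpen_generateFrom_of_mem
      ⟨f, i, {0}, ψ, 1, ε, isCompact_singleton, by simpa using zero_mem_ball m _,
        chart_mem_atlas _ _, by simp [hψ], hε, rfl⟩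
  have hmem : f ∈ f.basicNhd i {0} ψ 1 ε := by
    intro z hz
    obtain rfl : z = 0 := hz
    exact ⟨mem_chart_source _ _, fun j _ => by simpa using hε⟩
  filter_upwards [hopen.mem_nhds hmem] with g hg
  obtain ⟨h1, h2⟩ := hg 0 rfl
  refine ⟨h1, ?_, ?_⟩
  · have := h2 0 (by norm_num)
    rw [iteratedFDerivWithin_zero_eq_comp, iteratedFDerivWithin_zero_eq_comp] at this
    simp only [Function.comp_apply] at this
    rwa [← map_sub, LinearIsometryEquiv.norm_map] at this
  · exact (norm_fderiv_sub_le (ball_mem_nhds m (c.2 i)) _ _).trans_lt (h2 1 le_rfl)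

/-! ### Symplectic frames -/

variable (m M) in
/-- The bundle over `M` with fibre `Hom(ℝ²ᵐ, T_x M)` at `x`. -/
abbrev HomTM := TotalSpace (E m →L[ℝ] E m)
  (fun x : M => Trivial M (E m) x →L[ℝ] TangentSpace 𝓘(ℝ, E m) x)

theorem homTM_ext {p q : M} (h : p = q) {a b : E m →L[ℝ] E m} (hab : a = b) :
    (⟨p, a⟩ : HomTM m M) = ⟨q, b⟩ := by
  subst h hab; rfl

variable [IsManifold 𝓘(ℝ, E m) ∞ M]

/-- The space `SpFr(n, M)` of symplectic frames at `n` distinct ordered points of `M`: a symplectic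
frame at `x` is a linear map `(ℝ²ᵐ, ω₀) → (T_x M, ω_x)` preserving the symplectic forms (hence an
isomorphism). The topology is induced from the `n`-fold product of the bundle `Hom(ℝ²ᵐ, TM)`. -/
def SpFr (σ : SymplecticForm m M) (n : ℕ) : Type _ :=
  {A : Fin n → HomTM m M // Function.Injective (fun i => (A i).proj) ∧
    ∀ i, ∀ u v : E m, σ.form (A i).proj ![(A i).snd u, (A i).snd v] = stdForm u v}

instance (σ : SymplecticForm m M) (n : ℕ) : TopologicalSpace (SpFr σ n) :=
  inferInstanceAs (TopologicalSpace (Subtype _))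

/-! ### Evaluation of the derivatives at the centres -/

/-- The derivative at the centre of the `i`-th ball. -/
def Emb.frame {σ : SymplecticForm m M} {c : Cap n} (f : Emb σ c) (i : Fin n) : HomTM m M :=
  ⟨extend (f.1 i) 0, mfderiv 𝓘(ℝ, E m) 𝓘(ℝ, E m) (extend (f.1 i)) 0⟩

/-- The map `j_c : Emb_n(c, M) → SpFr(n, M)` on underlying sets. -/
def evalFun (σ : SymplecticForm m M) (c : Cap n) (f : Emb σ c) : SpFr σ n :=
  ⟨f.frame, by
    refine ⟨fun i j hij => ?_, fun i u v => ?_⟩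
    · have hij' : extend (f.1 i) 0 = extend (f.1 j) 0 := hij
      rw [extend, dif_pos (zero_mem_ball m _), extend, dif_pos (zero_mem_ball m _)] at hij'
      exact congrArg Sigma.fst (f.2.2 (a₁ := ⟨i, ⟨0, zero_mem_ball m _⟩⟩)
        (a₂ := ⟨j, ⟨0, zero_mem_ball m _⟩⟩) hij')
    · obtain ⟨U, F, hU, hsub, hF, hFf, hσ⟩ := f.2.1 i
      have h1 := extend_eventuallyEq (c.2 i) hFf
      have h2 := h1.mfderiv_eq (I := 𝓘(ℝ, E m)) (I' := 𝓘(ℝ, E m))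
      have h3 := hσ 0 (zero_mem_ball m _) u v
      rw [← h2] at h3
      exact (form_congr σ h1.eq_of_nhds _ _).trans h3⟩

/-- Symplectic embeddings are smooth at the centres. -/
theorem Emb.contMDiffAt {σ : SymplecticForm m M} {c : Cap n} (f : Emb σ c) (i : Fin n) :
    ContMDiffAt 𝓘(ℝ, E m) 𝓘(ℝ, E m) ∞ (extend (f.1 i)) 0 := by
  obtain ⟨U, F, hU, hsub, hF, hFf, hσ⟩ := f.2.1 i
  exact (hF.contMDiffAt (hU.mem_nhds (hsub (zero_mem_ball m _)))).congr_of_eventuallyEq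
    (extend_eventuallyEq (c.2 i) hFf)

theorem Emb.continuous_center (σ : SymplecticForm m M) (c : Cap n) (i : Fin n) :
    Continuous (fun f : Emb σ c => extend (f.1 i) 0) := by
  rw [continuous_iff_continuousAt]
  intro f
  set ψ := chartAt (E m) (extend (f.1 i) 0) with hψ
  have h1 : Filter.Tendsto (fun g : Emb σ c => ψ (extend (g.1 i) 0)) (𝓝 f)
      (𝓝 (ψ (extend (f.1 i) 0))) := by
    rw [Metric.tendsto_nhds]
    intro ε hε
    filter_upwards [f.eventually_near i hε] with g hg
    rw [dist_eq_norm]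
    exact hg.2.1
  have h2 := (ψ.continuousAt_symm (ψ.map_source (mem_chart_source _ _))).tendsto.comp h1
  rw [ψ.left_inv (mem_chart_source _ _)] at h2
  refine Filter.Tendsto.congr' ?_ h2
  filter_upwards [f.eventually_near i one_pos] with g hg
  exact ψ.left_inv hg.1

theorem Emb.inCoordinates_frame {σ : SymplecticForm m M} {c : Cap n} (g : Emb σ c) (i : Fin n)
    {p : M} (hg : extend (g.1 i) 0 ∈ (chartAt (E m) p).source) :
    ContinuousLinearMap.inCoordinates (E m) (Trivial M (E m)) (E m)
      (TangentSpace 𝓘(ℝ, E m) : M → Type _) p (extend (g.1 i) 0) p (extend (g.1 i) 0)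
      (g.frame i).2 = fderiv ℝ (chartAt (E m) p ∘ extend (g.1 i)) 0 := by
  have h1 : MDifferentiableAt 𝓘(ℝ, E m) 𝓘(ℝ, E m) (extChartAt 𝓘(ℝ, E m) p) (extend (g.1 i) 0) :=
    mdifferentiableAt_extChartAt hg
  have h2 : MDifferentiableAt 𝓘(ℝ, E m) 𝓘(ℝ, E m) (extend (g.1 i)) 0 :=
    (g.contMDiffAt i).mdifferentiableAt (by simp)
  have h3 := mfderiv_comp (I := 𝓘(ℝ, E m)) 0 h1 h2
  rw [mfderiv_eq_fderiv] at h3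
  have h4 := TangentBundle.continuousLinearMapAt_trivializationAt (I := 𝓘(ℝ, E m)) hg
  change ((trivializationAt (E m) (TangentSpace 𝓘(ℝ, E m)) p).continuousLinearMapAt ℝ
    (extend (g.1 i) 0)).comp ((g.frame i).2.comp
      ((Bundle.Trivial.trivialization M (E m)).symmL ℝ (extend (g.1 i) 0))) = _
  rw [Bundle.Trivial.symmL_trivialization, h4]
  exact h3.symm

theorem continuous_evalFun (σ : SymplecticForm m M) (c : Cap n) : Continuous (evalFun σ c) := by
  refine Continuous.subtype_mk (continuous_pi fun i => ?_) _
  rw [continuous_iff_continuousAt]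
  intro f
  rw [continuousAt_hom_bundle]
  refine ⟨(Emb.continuous_center σ c i).continuousAt, ?_⟩
  have h : Filter.Tendsto
      (fun g : Emb σ c => fderiv ℝ (chartAt (E m) (extend (f.1 i) 0) ∘ extend (g.1 i)) 0) (𝓝 f)
      (𝓝 (fderiv ℝ (chartAt (E m) (extend (f.1 i) 0) ∘ extend (f.1 i)) 0)) := by
    rw [Metric.tendsto_nhds]
    intro ε hε
    filter_upwards [f.eventually_near i hε] with g hg
    rw [dist_eq_norm]
    exact hg.2.2
  rw [ContinuousAt]
  have h5 := f.inCoordinates_frame i (mem_chart_source (E m) (extend (f.1 i) 0))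
  refine (h5 ▸ h).congr' ?_
  filter_upwards [f.eventually_near i one_pos] with g hg
  exact (g.inCoordinates_frame i hg.1).symm

/-- The map `j_c : Emb_n(c, M) → SpFr(n, M)` evaluating the derivatives at the centres. -/
def jc (σ : SymplecticForm m M) (c : Cap n) : C(Emb σ c, SpFr σ n) :=
  ⟨evalFun σ c, continuous_evalFun σ c⟩

theorem jc_restrict {σ : SymplecticForm m M} {c c' : Cap n} (h : c ≤ c') (f : Emb σ c') :
    jc σ c (f.restrict h) = jc σ c' f := by
  refine Subtype.ext (funext fun i => ?_)
  obtain ⟨U, F, hU, hsub, hF, hFf, hσ⟩ := f.2.1 i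
  have h1 : extend (f.1 i) =ᶠ[𝓝 0] F := extend_eventuallyEq (c'.2 i) hFf
  have h2 : extend ((f.restrict h).1 i) =ᶠ[𝓝 0] F :=
    extend_eventuallyEq (c.2 i) fun z => hFf ⟨z.1, ball_mono m (h i) z.2⟩
  have h3 := h2.trans h1.symm
  have h4 := h3.mfderiv_eq (I := 𝓘(ℝ, E m)) (I' := 𝓘(ℝ, E m))
  exact homTM_ext h3.eq_of_nhds h4

/-- The map `j_∞ : lim Emb_n(c, M) → SpFr(n, M)` induced by the maps `j_c`. -/
def jInf (σ : SymplecticForm m M) (n : ℕ) : C(EmbLim σ n, SpFr σ n) where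
  toFun := Quotient.lift (fun f : Σ c : Cap n, Emb σ c => jc σ f.1 f.2)
    (fun f g ⟨c, hf, hg, h⟩ =>
      (jc_restrict hf f.2).symm.trans ((congrArg (jc σ c) h).trans (jc_restrict hg g.2)))
  continuous_toFun := Continuous.quotient_lift (continuous_sigma fun c => (jc σ c).continuous) _

end SymplecticBalls

end

/-!
The proof compares embeddings and frames through *good families*: families of maps `ℝ²ᵐ → M`, over
an arbitrary space of parameters, that are in Darboux charts continuous families of smooth symplectic
maps, with all derivatives jointly continuous (`FamC`, `GoodAt`). Darboux's theorem
(`exists_isDarboux`, by Moser's argument) provides the charts. A good family with distinct centres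
gives a continuous family of germs of embeddings (`exists_continuous_germ`), of frames
(`exists_continuous_frame`) and, over a compact space of parameters, of embeddings of balls of one
fixed size (`exists_embCond_of_compact`, `continuous_toEmb`). All constructions are therefore carried
out on germs.

For the limit, Alexander's trick `h ↦ τ⁻¹ h (τ z)`, applied in finitely many Darboux balls one after
the other and cut off in terms of the base point, deforms every germ, without changing its frame, to
one that depends on the frame only (`exists_straightening`). The end of this deformation is a
continuous section of `j_∞` (`exists_section`), and the deformation itself is a homotopy from the
identity to the section composed with `j_∞`. It moves base points; but a self-map freely homotopic to
the identity is still bijective on homotopy groups (`piMap_bijective_of_homotopic_id`), so that `j_∞`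
is a weak homotopy equivalence (`isWeakHomotopyEquiv_jInf`).

The section does not lift to embeddings of a fixed size, because `SpFr(n, M)` is not compact: frames
can be large and points can be close to each other. However, `SpFr(n, M)` can be deformed into a
compact subset `K` (`exists_deformation`): the polar decomposition makes the frames bounded, and
points that are close are pushed apart in Darboux balls. Over `K` the section lifts to embeddings of
some capacities `c₀`, and hence to those of all capacities `c ≤ c₀`. This gives a map from
`SpFr(n, M)` to the embeddings whose composition with `j_c` is the deformation `h`, homotopic to the
identity. It is a lift over `h A` and not over `A`; but symplectic diffeomorphisms of `M` act
transitively along paths of tuples of frames (`Moves.of_homotopic`, by means of generating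
functions), and conjugation with one that carries `h A` to `A` yields surjectivity on homotopy groups
over the base point `A` (`exists_capacities`).
-/

noncomputable section
namespace SymplecticBalls

/-! ### Free homotopies and homotopy groups -/

section FreeHomotopy

open scoped unitInterval
open ContinuousMap

variable {X : Type*} [TopologicalSpace X] {k : ℕ}

/-- The sup-distance of a point of the cube from its centre, normalised to be `1` on the boundary. -/
def cubeDepth (y : Fin k → I) : ℝ := ‖fun i => 2 * (y i : ℝ) - 1‖

/-- The map of the cube to itself that expands the inner half-size cube to the whole cube and sends
the collar around it to the boundary. -/
def cubeExpand (y : Fin k → I) : Fin k → I :=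
  fun i => Set.projIcc (0 : ℝ) 1 zero_le_one (2 * (y i : ℝ) - 1 / 2)

/-- The height of a point in the collar of the cube: `0` on the inner half-size cube and `1` on the
boundary. -/
def collarHeight (y : Fin k → I) : I :=
  Set.projIcc (0 : ℝ) 1 zero_le_one (2 * cubeDepth y - 1)

theorem continuous_cubeDepth : Continuous (cubeDepth (k := k)) := by
  unfold cubeDepth; fun_prop

theorem continuous_cubeExpand : Continuous (cubeExpand (k := k)) := by
  unfold cubeExpand
  exact continuous_pi fun i => continuous_projIcc.comp (by fun_prop)

theorem continuous_collarHeight : Continuous (collarHeight (k := k)) := by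
  unfold collarHeight
  exact continuous_projIcc.comp (by have := continuous_cubeDepth (k := k); fun_prop)

theorem cubeExpand_mem_boundary {y : Fin k → I} (h : 1 / 2 ≤ cubeDepth y) :
    cubeExpand y ∈ Cube.boundary (Fin k) := by
  by_contra hc
  have hlt : cubeDepth y < 1 / 2 := by
    refine (pi_norm_lt_iff (by norm_num)).2 fun i => ?_
    by_contra hi
    push Not at hi
    refine hc ⟨i, ?_⟩
    rw [Real.norm_eq_abs] at hi
    rcases le_abs'.1 hi with h1 | h1
    · left; exact Set.projIcc_of_le_left _ (by linarith)
    · right; exact Set.projIcc_of_right_le _ (by linarith)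
  linarith

theorem collarHeight_eq_zero {y : Fin k → I} (h : cubeDepth y ≤ 1 / 2) : collarHeight y = 0 :=
  Set.projIcc_of_le_left _ (by linarith)

theorem cubeDepth_boundary {y : Fin k → I} (h : y ∈ Cube.boundary (Fin k)) : 1 ≤ cubeDepth y := by
  obtain ⟨i, hi⟩ := h
  refine le_trans ?_ (norm_le_pi_norm (fun i => 2 * (y i : ℝ) - 1) i)
  rcases hi with hi | hi <;> (simp [hi]; try norm_num)

theorem collarHeight_boundary {y : Fin k → I} (h : y ∈ Cube.boundary (Fin k)) :
    collarHeight y = 1 :=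
  Set.projIcc_of_right_le _ (by have := cubeDepth_boundary h; linarith)

/-- Transport of a cube `γ` along a path `a`: the cube `γ` on the inner half-size cube, and the
path `a` on each ray of the collar. -/
def transport (γ : (Fin k → I) → X) (a : I → X) (y : Fin k → I) : X :=
  if cubeDepth y ≤ 1 / 2 then γ (cubeExpand y) else a (collarHeight y)

theorem continuous_transport {P : Type*} [TopologicalSpace P] {G : P → (Fin k → I) → X}
    {a : P → I → X} (hG : Continuous fun q : P × (Fin k → I) => G q.1 q.2)
    (ha : Continuous fun q : P × I => a q.1 q.2)
    (h : ∀ p, ∀ y ∈ Cube.boundary (Fin k), G p y = a p 0) :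
    Continuous fun q : P × (Fin k → I) => transport (G q.1) (a q.1) q.2 := by
  unfold transport
  have h1 := continuous_cubeDepth (k := k)
  have h2 := continuous_cubeExpand (k := k)
  have h3 := continuous_collarHeight (k := k)
  refine Continuous.if_le (by fun_prop) (by fun_prop) (by fun_prop) (by fun_prop) ?_
  rintro ⟨p, y⟩ hy
  simp only at hy ⊢
  rw [h p _ (cubeExpand_mem_boundary hy.ge), collarHeight_eq_zero hy.le]

theorem transport_boundary (γ : (Fin k → I) → X) (a : I → X) {y : Fin k → I}
    (hy : y ∈ Cube.boundary (Fin k)) : transport γ a y = a 1 := by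
  have := cubeDepth_boundary hy
  rw [transport, if_neg (by linarith), collarHeight_boundary hy]

/-- Transport of based loops. -/
def transportLoop {x : X} (γ : GenLoop (Fin k) X x) (a : C(I, X)) (ha : a 0 = x) :
    GenLoop (Fin k) X (a 1) :=
  ⟨⟨transport γ a, (continuous_transport (P := Unit) (G := fun _ => γ) (a := fun _ => a)
    (by fun_prop) (by fun_prop) (fun _ y hy => by rw [ha]; exact γ.2 y hy)).comp
      (Continuous.prodMk_right ())⟩,
    fun _ hy => transport_boundary _ _ hy⟩

theorem transportLoop_congr {x : X} {γ γ' : GenLoop (Fin k) X x} (h : GenLoop.Homotopic γ γ')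
    (a : C(I, X)) (ha : a 0 = x) :
    GenLoop.Homotopic (transportLoop γ a ha) (transportLoop γ' a ha) := by
  obtain ⟨F⟩ := h
  refine ⟨⟨⟨⟨fun q => transport (fun y => F (q.1, y)) a q.2,
    continuous_transport (P := I) (G := fun t y => F (t, y)) (a := fun _ => a)
      (F.continuous.comp (by fun_prop : Continuous fun q : I × (Fin k → I) => (q.1, q.2)))
      (by fun_prop) (fun t y hy => ?_)⟩, ?_, ?_⟩, ?_⟩⟩
  · rw [ha, F.eq_fst t hy]; exact γ.2 y hy
  · intro y; simp only [ContinuousMap.HomotopyWith.apply_zero]; rfl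
  · intro y; simp only [ContinuousMap.HomotopyWith.apply_one]; rfl
  · intro t y hy
    change transport (fun y => F (t, y)) a y = transport γ a y
    rw [transport_boundary _ _ hy, transport_boundary _ _ hy]

/-- A free homotopy of cubes that is constant on the boundary at each time connects the transport of
its start along the path traced by the boundary to its end. -/
theorem transportLoop_homotopic {x x' : X} (γ : GenLoop (Fin k) X x) (γ' : GenLoop (Fin k) X x')
    (a : C(I, X)) (ha : a 0 = x) (ha' : x' = a 1) (H : C(I × (Fin k → I), X))
    (h0 : ∀ y, H (0, y) = γ y) (h1 : ∀ y, H (1, y) = γ' y)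
    (hb : ∀ t, ∀ y ∈ Cube.boundary (Fin k), H (t, y) = a t) :
    GenLoop.Homotopic (transportLoop γ a ha) (ha' ▸ γ') := by
  subst ha'
  -- the straight-line homotopy from `cubeExpand` to the identity preserves the boundary
  let e : I → (Fin k → I) → (Fin k → I) := fun s y i =>
    Set.projIcc (0 : ℝ) 1 zero_le_one ((1 - s) * (cubeExpand y i : ℝ) + s * (y i : ℝ))
  have hcube := continuous_cubeExpand (k := k)
  have he : Continuous fun q : I × (Fin k → I) => e q.1 q.2 := by
    refine continuous_pi fun i => continuous_projIcc.comp ?_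
    have : Continuous fun q : I × (Fin k → I) => cubeExpand q.2 i :=
      (continuous_apply i).comp (hcube.comp continuous_snd)
    fun_prop
  have hcol := continuous_collarHeight (k := k)
  refine ⟨⟨⟨⟨fun q => H (max (collarHeight q.2) q.1, e q.1 q.2), by fun_prop⟩, ?_, ?_⟩, ?_⟩⟩
  · intro y
    have : e 0 y = cubeExpand y := by
      funext i; simp [e]
    change H (max (collarHeight y) 0, e 0 y) = transport γ a y
    rw [this, transport, max_eq_left unitInterval.nonneg']
    split_ifs with h
    · rw [collarHeight_eq_zero h, h0]
    · exact hb _ _ (cubeExpand_mem_boundary (by linarith))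
  · intro y
    have : e 1 y = y := by
      funext i; simp [e]
    change H (max (collarHeight y) 1, e 1 y) = _
    rw [this, max_eq_right unitInterval.le_one']; exact h1 y
  · intro s y hy
    change H (max (collarHeight y) s, e s y) = transport γ a y
    have hm : e s y ∈ Cube.boundary (Fin k) := by
      obtain ⟨i, hi⟩ := hy
      refine ⟨i, ?_⟩
      rcases hi with hi | hi
      · left
        have : cubeExpand y i = 0 := Set.projIcc_of_le_left _ (by simp [hi])
        simp [e, hi, this]
      · right
        have : cubeExpand y i = 1 := Set.projIcc_of_right_le _ (by simp [hi]; norm_num)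
        simp [e, hi, this]
    rw [hb _ _ hm, transport_boundary _ _ hy, collarHeight_boundary hy, max_eq_left unitInterval.le_one']

theorem genLoop_homotopic_cast {x₁ x₂ : X} (e : x₁ = x₂) (γ γ' : GenLoop (Fin k) X x₁) :
    GenLoop.Homotopic (e ▸ γ) (e ▸ γ') ↔ GenLoop.Homotopic γ γ' := by
  subst e; rfl

/-- Transport along a path and back is the identity up to homotopy. -/
theorem transportLoop_symm {x : X} (γ : GenLoop (Fin k) X x) (a : C(I, X)) (ha : a 0 = x)
    (b : C(I, X)) (hb : ∀ t, b t = a (unitInterval.symm t)) (hb0 : b 0 = a 1) (hx : x = b 1) :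
    GenLoop.Homotopic (transportLoop (transportLoop γ a ha) b hb0) (hx ▸ γ) := by
  subst ha
  -- `γ ∘ cubeExpand` is the transport of `γ` along a constant path
  have hγ : GenLoop.Homotopic (transportLoop γ (.const I (a 0)) rfl) γ :=
    transportLoop_homotopic γ γ (.const I (a 0)) rfl rfl ⟨fun q => γ q.2, by fun_prop⟩
      (fun _ => rfl) (fun _ => rfl) (fun _ y hy => γ.2 y hy)
  have key := transportLoop_homotopic (transportLoop γ a rfl)
    (transportLoop γ (.const I (a 0)) rfl) b hb0 hx
    ⟨fun q => transport γ (fun s => a (s * unitInterval.symm q.1)) q.2,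
      continuous_transport (P := I) (G := fun _ => γ) (a := fun t s => a (s * unitInterval.symm t))
        (by fun_prop) (by fun_prop) (fun t y hy => by simpa using γ.2 y hy)⟩
    (fun y => by simp [transportLoop]; rfl) (fun y => by simp [transportLoop]; rfl)
    (fun t y hy => by
      change transport γ (fun s => a (s * unitInterval.symm t)) y = _
      rw [transport_boundary _ _ hy, hb]; simp)
  exact key.trans ((genLoop_homotopic_cast hx _ _).2 hγ)

/-- A self-map freely homotopic to the identity induces bijections on homotopy groups. -/
theorem piMap_bijective_of_homotopic_id {h : C(X, X)} (H : (ContinuousMap.id X).Homotopic h)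
    (k : ℕ) (x : X) : Function.Bijective (piMap k h x) := by
  obtain ⟨F⟩ := H
  let a : C(I, X) := ⟨fun t => F (t, x), by fun_prop⟩
  have ha0 : a 0 = x := F.apply_zero x
  have ha1 : a 1 = h x := F.apply_one x
  let b : C(I, X) := ⟨fun t => a (unitInterval.symm t), by fun_prop⟩
  have key : ∀ γ : GenLoop (Fin k) X x,
      GenLoop.Homotopic (transportLoop γ a ha0) (ha1.symm ▸ genLoopMap k h x γ) := fun γ =>
    transportLoop_homotopic γ (genLoopMap k h x γ) a ha0 ha1.symm
      ⟨fun q => F (q.1, γ q.2), by fun_prop⟩ (fun y => F.apply_zero _) (fun y => F.apply_one _)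
      (fun t y hy => by
        have : γ y = x := γ.2 y hy
        change F (t, γ y) = F (t, x)
        rw [this])
  have hb0 : b 0 = a 1 := by simp [b]
  have hb1 : x = b 1 := by simp [b, ha0]
  constructor
  · rintro ⟨γ⟩ ⟨γ'⟩ hγ
    have h1 : GenLoop.Homotopic (genLoopMap k h x γ) (genLoopMap k h x γ') := Quotient.exact hγ
    have h2 : GenLoop.Homotopic (transportLoop γ a ha0) (transportLoop γ' a ha0) :=
      (key γ).trans (((genLoop_homotopic_cast ha1.symm _ _).2 h1).trans (key γ').symm)
    have h3 := transportLoop_congr h2 b hb0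
    have h4 := (transportLoop_symm γ a ha0 b (fun _ => rfl) hb0 hb1).symm.trans
      (h3.trans (transportLoop_symm γ' a ha0 b (fun _ => rfl) hb0 hb1))
    exact Quotient.sound ((genLoop_homotopic_cast hb1 _ _).1 h4)
  · rintro ⟨β⟩
    let β' : GenLoop (Fin k) X (a 1) := ha1.symm ▸ β
    let γ : GenLoop (Fin k) X x := hb1.symm ▸ transportLoop β' b hb0
    refine ⟨⟦γ⟧, Quotient.sound ?_⟩
    have h1 := key γ
    have h2 : GenLoop.Homotopic (transportLoop γ a ha0) β' := by
      have h3 := transportLoop_symm β' b hb0 a (fun t => by simp [b])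
        (by rw [← hb1, ha0]) rfl
      have h4 : ∀ {z : X} (e : z = x) (e0 : a 0 = z) (δ : GenLoop (Fin k) X z),
          transportLoop (e ▸ δ) a ha0 = transportLoop δ a e0 := by
        rintro _ rfl _ _; rfl
      change GenLoop.Homotopic (transportLoop (hb1.symm ▸ transportLoop β' b hb0) a ha0) β'
      rw [h4 hb1.symm (by rw [← hb1, ha0])]
      exact h3
    exact (genLoop_homotopic_cast ha1.symm _ _).1 (h1.symm.trans h2)

theorem piMap_comp {Y Z : Type*} [TopologicalSpace Y] [TopologicalSpace Z] (g : C(Y, Z))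
    (f : C(X, Y)) (k : ℕ) (x : X) (p : HomotopyGroup.Pi k X x) :
    piMap k (g.comp f) x p = piMap k g (f x) (piMap k f x p) := by
  obtain ⟨γ⟩ := p; rfl

/-- A map with a section `s` such that `s ∘ f` is freely homotopic to the identity is a weak
homotopy equivalence. -/
theorem isWeakHomotopyEquiv_of_section {Y : Type*} [TopologicalSpace Y] (f : C(X, Y)) (s : C(Y, X))
    (hfs : ∀ y, f (s y) = y) (H : (ContinuousMap.id X).Homotopic (s.comp f)) :
    IsWeakHomotopyEquiv f := by
  refine ⟨⟨?_, ?_⟩, fun x k _ => ?_⟩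
  · have hx : ∀ x, Joined x (s (f x)) := by
      obtain ⟨F⟩ := H
      exact fun x => ⟨⟨⟨fun t => F (t, x), by fun_prop⟩, F.apply_zero x, F.apply_one x⟩⟩
    rintro ⟨x⟩ ⟨x'⟩ h
    have h1 : Joined (f x) (f x') := Quotient.exact h
    exact Quotient.sound ((hx x).trans ((h1.map s.continuous).trans (hx x').symm))
  · rintro ⟨y⟩
    exact ⟨ZerothHomotopy.mk (s y), congrArg ZerothHomotopy.mk (hfs y)⟩
  · have hb := piMap_bijective_of_homotopic_id H k x
    have hfun : piMap k (s.comp f) x = piMap k s (f x) ∘ piMap k f x :=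
      funext fun p => piMap_comp s f k x p
    rw [hfun] at hb
    have hs : Function.Bijective (piMap k s (f x)) := by
      refine ⟨?_, hb.2.of_comp⟩
      rintro ⟨γ⟩ ⟨γ'⟩ h
      have h1 : GenLoop.Homotopic (genLoopMap k s (f x) γ) (genLoopMap k s (f x) γ') :=
        Quotient.exact h
      refine Quotient.sound ?_
      have h2 := h1.comp_continuousMap f
      have h3 : ∀ δ : GenLoop (Fin k) Y (f x), f.comp (genLoopMap k s (f x) δ).1 = δ.1 := fun δ =>
        ContinuousMap.ext fun y => hfs _
      rw [h3, h3] at h2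
      exact h2
    exact (Function.Bijective.of_comp_iff' hs _).1 hb

end FreeHomotopy

end SymplecticBalls
end
noncomputable section
namespace SymplecticBalls

/-! ### Continuous families of smooth maps -/

section Families

variable {P Q : Type*} [TopologicalSpace P] [TopologicalSpace Q]
variable {E G G' G'' : Type} [NormedAddCommGroup E] [NormedSpace ℝ E]
  [NormedAddCommGroup G] [NormedSpace ℝ G] [NormedAddCommGroup G'] [NormedSpace ℝ G']
  [NormedAddCommGroup G''] [NormedSpace ℝ G'']

/-- A continuous family of `C^k` maps: on `Ω ⊆ P × E`, each `F p` is `C^k` and the derivatives of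
order at most `k` in the direction of `E` are jointly continuous. No structure other than a topology
is required of the space of parameters `P`. -/
def FamC (k : ℕ) (F : P → E → G) (Ω : Set (P × E)) : Prop :=
  (∀ q ∈ Ω, ContDiffAt ℝ k (F q.1) q.2) ∧
    ∀ j ≤ k, ContinuousOn (fun q : P × E => iteratedFDeriv ℝ j (F q.1) q.2) Ω

theorem FamC.continuousOn {k : ℕ} {F : P → E → G} {Ω : Set (P × E)} (h : FamC k F Ω) :
    ContinuousOn (fun q : P × E => F q.1 q.2) Ω := by
  have := h.2 0 (Nat.zero_le _)
  simp only [iteratedFDeriv_zero_eq_comp, Function.comp_def] at this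
  have h2 := (continuousMultilinearCurryFin0 ℝ E G).continuous.comp_continuousOn this
  simpa [Function.comp_def] using h2

theorem famC_zero_iff {F : P → E → G} {Ω : Set (P × E)} :
    FamC 0 F Ω ↔ (∀ q ∈ Ω, ContDiffAt ℝ 0 (F q.1) q.2) ∧
      ContinuousOn (fun q : P × E => F q.1 q.2) Ω := by
  refine ⟨fun h => ⟨h.1, h.continuousOn⟩, fun h => ⟨h.1, fun j hj => ?_⟩⟩
  obtain rfl : j = 0 := by omega
  simp only [iteratedFDeriv_zero_eq_comp, Function.comp_def]
  exact (continuousMultilinearCurryFin0 ℝ E G).symm.continuous.comp_continuousOn h.2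

theorem famC_succ_iff {k : ℕ} {F : P → E → G} {Ω : Set (P × E)} :
    FamC (k + 1) F Ω ↔ (∀ q ∈ Ω, ContDiffAt ℝ (k + 1) (F q.1) q.2) ∧
      ContinuousOn (fun q : P × E => F q.1 q.2) Ω ∧ FamC k (fun p => fderiv ℝ (F p)) Ω := by
  constructor
  · intro h
    refine ⟨fun q hq => by simpa using h.1 q hq, h.continuousOn, fun q hq => ?_, fun j hj => ?_⟩
    · exact (h.1 q hq).fderiv_right (by norm_cast)
    · have h1 := h.2 (j + 1) (by omega)
      simp only [iteratedFDeriv_succ_eq_comp_right, Function.comp_def] at h1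
      have h2 := (continuousMultilinearCurryRightEquiv' ℝ j E G).continuous.comp_continuousOn h1
      simpa [Function.comp_def] using h2
  · rintro ⟨h1, h2, h3⟩
    refine ⟨fun q hq => by simpa using h1 q hq, fun j hj => ?_⟩
    rcases j with _ | j
    · simp only [iteratedFDeriv_zero_eq_comp, Function.comp_def]
      exact (continuousMultilinearCurryFin0 ℝ E G).symm.continuous.comp_continuousOn h2
    · simp only [iteratedFDeriv_succ_eq_comp_right, Function.comp_def]
      exact (continuousMultilinearCurryRightEquiv' ℝ j E G).symm.continuous.comp_continuousOn
        (h3.2 j (by omega))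

theorem FamC.fderiv {k : ℕ} {F : P → E → G} {Ω : Set (P × E)} (h : FamC (k + 1) F Ω) :
    FamC k (fun p => fderiv ℝ (F p)) Ω := (famC_succ_iff.1 h).2.2

theorem FamC.mono {k : ℕ} {F : P → E → G} {Ω Ω' : Set (P × E)} (h : FamC k F Ω) (hs : Ω' ⊆ Ω) :
    FamC k F Ω' := ⟨fun q hq => h.1 q (hs hq), fun j hj => (h.2 j hj).mono hs⟩

theorem FamC.of_le {k l : ℕ} {F : P → E → G} {Ω : Set (P × E)} (h : FamC k F Ω) (hl : l ≤ k) :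
    FamC l F Ω :=
  ⟨fun q hq => (h.1 q hq).of_le (by exact_mod_cast hl), fun j hj => h.2 j (hj.trans hl)⟩

theorem slice_mem_nhds {Ω : Set (P × E)} (hΩ : IsOpen Ω) {q : P × E} (hq : q ∈ Ω) :
    ∀ᶠ z in 𝓝 q.2, (q.1, z) ∈ Ω :=
  (Continuous.prodMk_right q.1).continuousAt.eventually (hΩ.mem_nhds hq)

theorem FamC.congr {k : ℕ} {F F' : P → E → G} {Ω : Set (P × E)} (h : FamC k F Ω) (hΩ : IsOpen Ω)
    (he : ∀ q ∈ Ω, F' q.1 q.2 = F q.1 q.2) : FamC k F' Ω := by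
  have he' : ∀ q ∈ Ω, F' q.1 =ᶠ[𝓝 q.2] F q.1 := fun q hq => by
    filter_upwards [slice_mem_nhds hΩ hq] with z hz using he _ hz
  refine ⟨fun q hq => (h.1 q hq).congr_of_eventuallyEq (he' q hq), fun j hj => ?_⟩
  exact (h.2 j hj).congr fun q hq => ((he' q hq).iteratedFDeriv ℝ j).eq_of_nhds

/-- Reparametrisation of a family. -/
theorem FamC.comap {k : ℕ} {F : P → E → G} {Ω : Set (P × E)} (h : FamC k F Ω) {a : Q → P}
    {Ω' : Set (Q × E)} (ha : ContinuousOn (fun q : Q × E => a q.1) Ω')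
    (hs : ∀ q ∈ Ω', (a q.1, q.2) ∈ Ω) : FamC k (fun x => F (a x)) Ω' :=
  ⟨fun q hq => h.1 _ (hs q hq), fun j hj =>
    (h.2 j hj).comp (f := fun q : Q × E => (a q.1, q.2)) (ha.prodMk continuousOn_snd) hs⟩

/-- A family whose members depend smoothly on a continuous parameter in a normed space. -/
theorem FamC.of_contDiffAt {V : Type} [NormedAddCommGroup V] [NormedSpace ℝ V] {k : ℕ}
    {f : V → E → G} {a : P → V} {Ω : Set (P × E)} (hΩ : IsOpen Ω)
    (ha : ContinuousOn (fun q : P × E => a q.1) Ω)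
    (hf : ∀ q ∈ Ω, ContDiffAt ℝ k (fun w : V × E => f w.1 w.2) (a q.1, q.2)) :
    FamC k (fun p => f (a p)) Ω := by
  have hslice : ∀ {G : Type} [NormedAddCommGroup G] [NormedSpace ℝ G] {f : V → E → G} {n : ℕ}
      {v : V} {z : E}, ContDiffAt ℝ n (fun w : V × E => f w.1 w.2) (v, z) →
      ContDiffAt ℝ n (f v) z := fun {G} _ _ {f n v z} h =>
    h.comp (f := fun z : E => (v, z)) z (contDiffAt_const.prodMk contDiffAt_id)
  have hcont : ∀ {G : Type} [NormedAddCommGroup G] [NormedSpace ℝ G] {f : V → E → G},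
      (∀ q ∈ Ω, ContinuousAt (fun w : V × E => f w.1 w.2) (a q.1, q.2)) →
      ContinuousOn (fun q : P × E => f (a q.1) q.2) Ω := fun {G} _ _ {f} h q hq =>
    (h q hq).comp_continuousWithinAt (f := fun q : P × E => (a q.1, q.2))
      ((ha q hq).prodMk continuousWithinAt_snd)
  induction k generalizing G with
  | zero =>
    exact famC_zero_iff.2 ⟨fun q hq => hslice (hf q hq),
      hcont fun q hq => (hf q hq).continuousAt⟩
  | succ k ih =>
    refine famC_succ_iff.2 ⟨fun q hq => by simpa using hslice (hf q hq),
      hcont fun q hq => (hf q hq).continuousAt, ?_⟩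
    have h1 := ih (f := fun v z =>
      (_root_.fderiv ℝ (fun w : V × E => f w.1 w.2) (v, z)).comp (ContinuousLinearMap.inr ℝ V E))
      (fun q hq => by
        have h2 : ContDiffAt ℝ k (_root_.fderiv ℝ (fun w : V × E => f w.1 w.2)) (a q.1, q.2) :=
          (hf q hq).fderiv_right (by norm_cast)
        exact h2.clm_comp contDiffAt_const)
    refine h1.congr hΩ fun q hq => ?_
    have h2 : HasFDerivAt (fun w : V × E => f w.1 w.2) _ (a q.1, q.2) :=
      ((hf q hq).differentiableAt (by simp)).hasFDerivAt
    have h3 := h2.comp (f := fun z : E => (a q.1, z)) q.2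
      ((hasFDerivAt_const _ _).prodMk (hasFDerivAt_id _))
    exact h3.fderiv

theorem FamC.of_const {k : ℕ} {f : E → G} {Ω : Set (P × E)}
    (hf : ∀ q ∈ Ω, ContDiffAt ℝ k f q.2) : FamC k (fun _ : P => f) Ω :=
  ⟨hf, fun j hj q hq => ((((hf q hq).continuousAt_iteratedFDeriv (by exact_mod_cast hj)).comp
    (f := fun q : P × E => q.2) continuousAt_snd)).continuousWithinAt⟩

theorem FamC.clm_comp {k : ℕ} {F : P → E → G} {Ω : Set (P × E)} (L : G →L[ℝ] G')
    (h : FamC k F Ω) : FamC k (fun p z => L (F p z)) Ω := by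
  refine ⟨fun q hq => L.contDiff.contDiffAt.comp q.2 (h.1 q hq), fun j hj => ?_⟩
  have h1 : ContinuousOn (fun q : P × E =>
      L.compContinuousMultilinearMap (iteratedFDeriv ℝ j (F q.1) q.2)) Ω :=
    (ContinuousLinearMap.compContinuousMultilinearMapL ℝ (fun _ : Fin j => E) G G'
      L).continuous.comp_continuousOn (h.2 j hj)
  exact h1.congr fun q hq => L.iteratedFDeriv_comp_left (h.1 q hq) (by exact_mod_cast hj)

theorem FamC.add {k : ℕ} {F F' : P → E → G} {Ω : Set (P × E)} (h : FamC k F Ω)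
    (h' : FamC k F' Ω) : FamC k (fun p z => F p z + F' p z) Ω := by
  refine ⟨fun q hq => (h.1 q hq).add (h'.1 q hq), fun j hj => ?_⟩
  exact ((h.2 j hj).add (h'.2 j hj)).congr fun q hq =>
    iteratedFDeriv_add_apply ((h.1 q hq).of_le (by exact_mod_cast hj))
      ((h'.1 q hq).of_le (by exact_mod_cast hj))

theorem FamC.prodMk {k : ℕ} {F : P → E → G} {F' : P → E → G'} {Ω : Set (P × E)} (h : FamC k F Ω)
    (h' : FamC k F' Ω) : FamC k (fun p z => (F p z, F' p z)) Ω := by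
  simpa using (h.clm_comp (ContinuousLinearMap.inl ℝ G G')).add
    (h'.clm_comp (ContinuousLinearMap.inr ℝ G G'))

/-- Composition of families over the same parameters. -/
theorem FamC.comp {k : ℕ} {H : P → G → G'} {F : P → E → G} {Ω : Set (P × E)} {Ω' : Set (P × G)}
    (hΩ : IsOpen Ω) (hH : FamC k H Ω') (hF : FamC k F Ω)
    (hs : ∀ q ∈ Ω, (q.1, F q.1 q.2) ∈ Ω') : FamC k (fun p z => H p (F p z)) Ω := by
  have hcont : ∀ {G' : Type} [NormedAddCommGroup G'] [NormedSpace ℝ G'] {H : P → G → G'} {n l : ℕ},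
      FamC n H Ω' → FamC l F Ω → ContinuousOn (fun q : P × E => H q.1 (F q.1 q.2)) Ω :=
    fun {G'} _ _ {H n l} h h' => h.continuousOn.comp (f := fun q : P × E => (q.1, F q.1 q.2))
      (continuousOn_fst.prodMk h'.continuousOn) hs
  induction k generalizing G G' Ω' with
  | zero =>
    exact famC_zero_iff.2 ⟨fun q hq => (hH.1 _ (hs q hq)).comp q.2 (hF.1 q hq), hcont hH hF⟩
  | succ k ih =>
    refine famC_succ_iff.2 ⟨fun q hq => ?_, hcont hH hF, ?_⟩
    · have := (hH.1 _ (hs q hq)).comp q.2 (hF.1 q hq)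
      push_cast at this
      exact this
    have h1 : FamC k (fun p z => (_root_.fderiv ℝ (H p) (F p z), _root_.fderiv ℝ (F p) z)) Ω :=
      (ih hH.fderiv (hF.of_le (Nat.le_succ k)) hs hcont).prodMk hF.fderiv
    have h2 : FamC k (fun p z =>
        (_root_.fderiv ℝ (H p) (F p z)).comp (_root_.fderiv ℝ (F p) z)) Ω :=
      ih (F := fun p z => (_root_.fderiv ℝ (H p) (F p z), _root_.fderiv ℝ (F p) z))
        (H := fun _ w => w.1.comp w.2) (Ω' := Set.univ)
        (FamC.of_const fun q _ => contDiffAt_fst.clm_comp contDiffAt_snd) h1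
        (fun _ _ => mem_univ _)
        (fun {G'} _ _ {_ n l} h h' => h.continuousOn.comp
          (f := fun q : P × E =>
            (q.1, (_root_.fderiv ℝ (H q.1) (F q.1 q.2), _root_.fderiv ℝ (F q.1) q.2)))
          (continuousOn_fst.prodMk h'.continuousOn) (fun _ _ => mem_univ _))
    refine h2.congr hΩ fun q hq => ?_
    exact fderiv_comp q.2 ((hH.1 _ (hs q hq)).differentiableAt (by simp))
      ((hF.1 q hq).differentiableAt (by simp))

/-- Postcomposition of a family with a fixed map. -/
theorem FamC.comp_left {k : ℕ} {f : G → G'} {F : P → E → G} {Ω : Set (P × E)} (hΩ : IsOpen Ω)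
    (hF : FamC k F Ω) (hf : ∀ q ∈ Ω, ContDiffAt ℝ k f (F q.1 q.2)) :
    FamC k (fun p z => f (F p z)) Ω :=
  FamC.comp (H := fun _ => f) (Ω' := {q | ContDiffAt ℝ k f q.2}) hΩ (FamC.of_const fun _ hq => hq)
    hF hf

end Families

end SymplecticBalls
end
noncomputable section
namespace SymplecticBalls

/-! ### The Alexander trick -/

section Alexander

variable {P : Type*} [TopologicalSpace P]
variable {E G : Type} [NormedAddCommGroup E] [NormedSpace ℝ E]
  [NormedAddCommGroup G] [NormedSpace ℝ G]

/-- The rescaling `z ↦ h 0 + τ⁻¹ (h (τ z) - h 0)` of a map `h` about the origin, whose value at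
`τ = 0` is by definition its limit, the affine approximation of `h`. -/
def alexander (τ : ℝ) (h : E → G) (z : E) : G :=
  if τ = 0 then h 0 + fderiv ℝ h 0 z else h 0 + τ⁻¹ • (h (τ • z) - h 0)

@[simp] theorem alexander_apply_zero (τ : ℝ) (h : E → G) : alexander τ h 0 = h 0 := by
  unfold alexander; split_ifs <;> simp

@[simp] theorem alexander_one (h : E → G) (z : E) : alexander 1 h z = h z := by
  simp [alexander]

theorem alexander_zero (h : E → G) (z : E) : alexander 0 h z = h 0 + fderiv ℝ h 0 z := by
  simp [alexander]

theorem hasFDerivAt_alexander {τ : ℝ} {h : E → G} {z : E} (hd : DifferentiableAt ℝ h (τ • z)) :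
    HasFDerivAt (alexander τ h) (fderiv ℝ h (τ • z)) z := by
  by_cases hτ : τ = 0
  · subst hτ
    rw [funext (alexander_zero h), zero_smul]
    exact (fderiv ℝ h 0).hasFDerivAt.const_add _
  · have h1 : alexander τ h = fun z => h 0 + τ⁻¹ • (h (τ • z) - h 0) :=
      funext fun z => if_neg hτ
    rw [h1]
    have h2 : HasFDerivAt (fun z : E => τ • z) (τ • ContinuousLinearMap.id ℝ E) z :=
      (hasFDerivAt_id z).const_smul τ
    have h3 := (((hd.hasFDerivAt.comp z h2).sub_const (h 0)).const_smul τ⁻¹).const_add (h 0)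
    refine h3.congr_fderiv ?_
    ext v
    simp [smul_smul, inv_mul_cancel₀ hτ]

theorem contDiffAt_alexander {k : ℕ} {τ : ℝ} {h : E → G} {z : E}
    (hd : ContDiffAt ℝ k h (τ • z)) : ContDiffAt ℝ k (alexander τ h) z := by
  by_cases hτ : τ = 0
  · subst hτ
    rw [funext (alexander_zero h)]
    exact contDiffAt_const.add (fderiv ℝ h 0).contDiff.contDiffAt
  · have h1 : alexander τ h = fun z => h 0 + τ⁻¹ • (h (τ • z) - h 0) :=
      funext fun z => if_neg hτ
    rw [h1]
    exact contDiffAt_const.add (((hd.comp z (contDiffAt_id.const_smul τ)).sub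
      contDiffAt_const).const_smul τ⁻¹)

theorem norm_alexander_sub_le {τ C : ℝ} {h : E → G} {z : E}
    (hd : ∀ w : E, ‖w‖ ≤ |τ| * ‖z‖ → DifferentiableAt ℝ h w)
    (hC : ∀ w : E, ‖w‖ ≤ |τ| * ‖z‖ → ‖fderiv ℝ h w - fderiv ℝ h 0‖ ≤ C) :
    ‖alexander τ h z - (h 0 + fderiv ℝ h 0 z)‖ ≤ C * ‖z‖ := by
  have hC0 : 0 ≤ C := (norm_nonneg _).trans (hC 0 (by simp; positivity))
  by_cases hτ : τ = 0
  · subst hτ; rw [alexander_zero]; simp; positivity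
  · have hball : Convex ℝ (Metric.closedBall (0 : E) (|τ| * ‖z‖)) := convex_closedBall _ _
    have h1 := hball.norm_image_sub_le_of_norm_hasFDerivWithin_le' (f := h) (f' := fderiv ℝ h)
      (φ := fderiv ℝ h 0) (C := C) (x := 0) (y := τ • z)
      (fun w hw => ((hd w (by simpa using hw)).hasFDerivAt.hasFDerivWithinAt))
      (fun w hw => hC w (by simpa using hw)) (by simp; positivity) (by simp [norm_smul])
    have h2 : alexander τ h z - (h 0 + fderiv ℝ h 0 z) =
        τ⁻¹ • (h (τ • z) - h 0 - fderiv ℝ h 0 (τ • z - 0)) := by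
      rw [alexander, if_neg hτ, sub_zero, map_smul, smul_sub _ _ (τ • _), smul_smul,
        inv_mul_cancel₀ hτ, one_smul]
      abel
    rw [h2, norm_smul, norm_inv, Real.norm_eq_abs]
    calc |τ|⁻¹ * ‖_‖ ≤ |τ|⁻¹ * (C * ‖τ • z - 0‖) := by gcongr
      _ = C * ‖z‖ := by
        rw [sub_zero, norm_smul, Real.norm_eq_abs]
        have : |τ| ≠ 0 := by simpa using hτ
        field_simp

theorem smul_mem_ball_zero {τ r : ℝ} (hτ : |τ| ≤ 1) {z : E} (hz : z ∈ Metric.ball (0 : E) r) :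
    τ • z ∈ Metric.ball (0 : E) r := by
  rw [mem_ball_zero_iff] at hz ⊢
  rw [norm_smul, Real.norm_eq_abs]
  nlinarith [norm_nonneg z, abs_nonneg τ]

theorem FamC.alexander {h : P → E → G} {N : Set P} {r : ℝ} (hN : IsOpen N)
    (hh : ∀ k, FamC k h (N ×ˢ Metric.ball 0 r)) {τ : P → ℝ} (hτ : ContinuousOn τ N)
    (hτ1 : ∀ p ∈ N, |τ p| ≤ 1) (k : ℕ) :
    FamC k (fun p => alexander (τ p) (h p)) (N ×ˢ Metric.ball 0 r) := by
  have hopen : IsOpen (N ×ˢ Metric.ball (0 : E) r) := hN.prod Metric.isOpen_ball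
  have hmem : ∀ q ∈ N ×ˢ Metric.ball (0 : E) r,
      (q.1, τ q.1 • q.2) ∈ N ×ˢ Metric.ball (0 : E) r :=
    fun q hq => ⟨hq.1, smul_mem_ball_zero (hτ1 _ hq.1) hq.2⟩
  have hτ' : ContinuousOn (fun q : P × E => τ q.1) (N ×ˢ Metric.ball 0 r) :=
    hτ.comp continuousOn_fst fun q hq => hq.1
  have hcd : ∀ k : ℕ, ∀ q ∈ N ×ˢ Metric.ball (0 : E) r,
      ContDiffAt ℝ k (SymplecticBalls.alexander (τ q.1) (h q.1)) q.2 := fun k q hq =>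
    contDiffAt_alexander ((hh k).1 _ (hmem q hq))
  have hscale : ∀ k : ℕ, FamC k (fun (p : P) (z : E) => τ p • z) (N ×ˢ Metric.ball 0 r) :=
    fun k => FamC.of_contDiffAt (f := fun (t : ℝ) (z : E) => t • z) hopen hτ'
      fun q _ => contDiffAt_fst.smul contDiffAt_snd
  have hcont : ContinuousOn
      (fun q : P × E => SymplecticBalls.alexander (τ q.1) (h q.1) q.2)
      (N ×ˢ Metric.ball 0 r) := by
    rintro ⟨p₀, z₀⟩ hq
    obtain ⟨hp₀, hz₀⟩ := id hq
    have hr : 0 < r := Metric.pos_of_mem_ball hz₀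
    have hdom : ∀ p ∈ N, (p, (0 : E)) ∈ N ×ˢ Metric.ball (0 : E) r :=
      fun p hp => ⟨hp, Metric.mem_ball_self hr⟩
    have hτat : Filter.Tendsto (fun q : P × E => τ q.1) (𝓝 (p₀, z₀)) (𝓝 (τ p₀)) :=
      (hτ'.continuousAt (hopen.mem_nhds hq))
    have hcat : ∀ q ∈ N ×ˢ Metric.ball (0 : E) r,
        ContinuousAt (fun q : P × E => h q.1 q.2) q := fun q hq =>
      (hh 0).continuousOn.continuousAt (hopen.mem_nhds hq)
    have hd0 : ContinuousAt (fun q : P × E => _root_.fderiv ℝ (h q.1) q.2) (p₀, 0) :=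
      (hh 1).fderiv.continuousOn.continuousAt (hopen.mem_nhds (hdom p₀ hp₀))
    have hzero : Filter.Tendsto (fun q : P × E => (q.1, (0 : E))) (𝓝 (p₀, z₀)) (𝓝 (p₀, 0)) :=
      (Continuous.prodMk continuous_fst continuous_const).tendsto' _ _ rfl
    have h0 : Filter.Tendsto (fun q : P × E => h q.1 0) (𝓝 (p₀, z₀)) (𝓝 (h p₀ 0)) :=
      (hcat _ (hdom p₀ hp₀)).tendsto.comp hzero
    refine ContinuousAt.continuousWithinAt ?_
    by_cases hτ0 : τ p₀ = 0
    · have hd1 : Filter.Tendsto (fun q : P × E => _root_.fderiv ℝ (h q.1) 0)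
          (𝓝 (p₀, z₀)) (𝓝 (_root_.fderiv ℝ (h p₀) 0)) := hd0.tendsto.comp hzero
      have hlin : Filter.Tendsto (fun q : P × E => h q.1 0 + _root_.fderiv ℝ (h q.1) 0 q.2)
          (𝓝 (p₀, z₀)) (𝓝 (h p₀ 0 + _root_.fderiv ℝ (h p₀) 0 z₀)) :=
        h0.add ((isBoundedBilinearMap_apply.continuous.tendsto
          (_root_.fderiv ℝ (h p₀) 0, z₀)).comp (hd1.prodMk_nhds continuousAt_snd))
      have hsmall : Filter.Tendsto (fun q : P × E => SymplecticBalls.alexander (τ q.1) (h q.1) q.2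
          - (h q.1 0 + _root_.fderiv ℝ (h q.1) 0 q.2)) (𝓝 (p₀, z₀)) (𝓝 0) := by
        rw [Metric.tendsto_nhds]
        intro ε hε
        -- the derivatives near `0` vary by less than `ε / (r + 1)` for parameters near `p₀`
        have hε' : 0 < ε / (r + 1) := by positivity
        have h1 : ∀ᶠ q : P × E in 𝓝 (p₀, 0),
            ‖_root_.fderiv ℝ (h q.1) q.2 - _root_.fderiv ℝ (h q.1) 0‖ < ε / (r + 1) := by
          have h2 : Filter.Tendsto (fun q : P × E => (q.1, (0 : E))) (𝓝 (p₀, 0)) (𝓝 (p₀, 0)) :=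
            (Continuous.prodMk continuous_fst continuous_const).tendsto' _ _ rfl
          have h3 := hd0.tendsto.sub (hd0.tendsto.comp h2)
          rw [sub_self] at h3
          simpa using (Metric.tendsto_nhds.1 h3) _ hε'
        rw [nhds_prod_eq] at h1
        obtain ⟨N', hN', B, hB, hNB⟩ := Filter.eventually_prod_iff.1 h1
        obtain ⟨δ, hδ, hδB⟩ := Metric.eventually_nhds_iff.1 hB
        have h4 : ∀ᶠ q : P × E in 𝓝 (p₀, z₀), |τ q.1| * r < δ := by
          have := (hτat.abs.mul_const r)
          rw [hτ0, abs_zero, zero_mul] at this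
          exact this.eventually (gt_mem_nhds hδ)
        filter_upwards [h4, hopen.mem_nhds hq, continuousAt_fst.eventually hN'] with q hq1 hq2 hq3
        have hzr : ‖q.2‖ < r := by simpa using hq2.2
        have hw : ∀ w : E, ‖w‖ ≤ |τ q.1| * ‖q.2‖ → ‖w‖ < r ∧ ‖w‖ < δ := fun w hw =>
          ⟨(hw.trans (mul_le_of_le_one_left (norm_nonneg _) (hτ1 _ hq2.1))).trans_lt hzr,
            (hw.trans (mul_le_mul_of_nonneg_left hzr.le (abs_nonneg _))).trans_lt hq1⟩
        rw [dist_zero_right]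
        refine (norm_alexander_sub_le (C := ε / (r + 1)) (fun w hw' => ?_)
          fun w hw' => ?_).trans_lt ?_
        · exact ((hh 1).1 (q.1, w) ⟨hq2.1, by simpa using (hw w hw').1⟩).differentiableAt (by simp)
        · have hBw : B w := hδB (by rw [dist_zero_right]; exact (hw w hw').2)
          have h6 := @hNB q.1 hq3 w hBw
          exact le_of_lt h6
        · calc ε / (r + 1) * ‖q.2‖ ≤ ε / (r + 1) * r := by gcongr
            _ < ε := by
              rw [div_mul_eq_mul_div, div_lt_iff₀ (by positivity)]
              exact mul_lt_mul_of_pos_left (lt_add_one r) hε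
      have h5 := hsmall.add hlin
      rw [zero_add] at h5
      rw [ContinuousAt, hτ0, alexander_zero]
      simpa using h5
    · have h1 : ContinuousAt (fun q : P × E => h q.1 0 + (τ q.1)⁻¹ • (h q.1 (τ q.1 • q.2) - h q.1 0))
          (p₀, z₀) := by
        have h2 : Filter.Tendsto (fun q : P × E => (q.1, τ q.1 • q.2)) (𝓝 (p₀, z₀))
            (𝓝 (p₀, τ p₀ • z₀)) := continuousAt_fst.prodMk_nhds (hτat.smul continuousAt_snd)
        exact h0.add ((hτat.inv₀ hτ0).smul (((hcat _ (hmem _ hq)).tendsto.comp h2).sub h0))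
      refine h1.congr ?_
      filter_upwards [hτat.eventually_ne hτ0] with q hq'
      rw [SymplecticBalls.alexander, if_neg hq']
  induction k with
  | zero => exact famC_zero_iff.2 ⟨hcd 0, hcont⟩
  | succ k _ =>
    refine famC_succ_iff.2 ⟨fun q hq => by simpa using hcd (k + 1) q hq, hcont, ?_⟩
    refine ((FamC.comp hopen (hh (k + 1)).fderiv (hscale k) hmem)).congr hopen fun q hq => ?_
    exact (hasFDerivAt_alexander
      (((hh 1).1 _ (hmem q hq)).differentiableAt (by simp))).fderiv

end Alexander

end SymplecticBalls
end
noncomputable section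
namespace SymplecticBalls

/-! ### The standard symplectic form -/

section StdForm

variable {m : ℕ}

theorem stdForm_add_left (u u' v : E m) : stdForm (u + u') v = stdForm u v + stdForm u' v := by
  simp only [stdForm, PiLp.add_apply, ← Finset.sum_add_distrib]
  exact Finset.sum_congr rfl fun i _ => by ring

theorem stdForm_smul_left (a : ℝ) (u v : E m) : stdForm (a • u) v = a * stdForm u v := by
  simp only [stdForm, PiLp.smul_apply, smul_eq_mul, Finset.mul_sum]
  exact Finset.sum_congr rfl fun i _ => by ring

theorem stdForm_swap (u v : E m) : stdForm u v = -stdForm v u := by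
  simp only [stdForm, ← Finset.sum_neg_distrib]
  exact Finset.sum_congr rfl fun i _ => by ring

theorem stdForm_add_right (u v v' : E m) : stdForm u (v + v') = stdForm u v + stdForm u v' := by
  rw [stdForm_swap, stdForm_add_left, stdForm_swap v, stdForm_swap v']; ring

theorem stdForm_smul_right (a : ℝ) (u v : E m) : stdForm u (a • v) = a * stdForm u v := by
  rw [stdForm_swap, stdForm_smul_left, stdForm_swap v]; ring

variable (m) in
/-- The standard symplectic form as a continuous bilinear map. -/
def stdFormL : E m →L[ℝ] E m →L[ℝ] ℝ :=
  LinearMap.toContinuousBilinearMap (LinearMap.mk₂ ℝ stdForm stdForm_add_left stdForm_smul_left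
    stdForm_add_right stdForm_smul_right)

@[simp] theorem stdFormL_apply (u v : E m) : stdFormL m u v = stdForm u v := rfl

theorem stdForm_sub_left (u u' v : E m) : stdForm (u - u') v = stdForm u v - stdForm u' v := by
  simp only [← stdFormL_apply, map_sub, _root_.sub_apply]

theorem stdForm_sub_right (u v v' : E m) : stdForm u (v - v') = stdForm u v - stdForm u v' := by
  simp only [← stdFormL_apply, map_sub]

theorem stdForm_nondegenerate {u : E m} (h : ∀ v, stdForm u v = 0) : u = 0 := by
  ext i
  rcases i with i | i
  · have := h (EuclideanSpace.single (Sum.inr i) 1)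
    simpa [stdForm, PiLp.single_apply] using this
  · have := h (EuclideanSpace.single (Sum.inl i) 1)
    simpa [stdForm, PiLp.single_apply] using this

/-- The linear maps preserving the standard symplectic form. -/
def IsSymplectic (L : E m →L[ℝ] E m) : Prop := ∀ u v, stdForm (L u) (L v) = stdForm u v

theorem IsSymplectic.id : IsSymplectic (ContinuousLinearMap.id ℝ (E m)) := fun _ _ => rfl

theorem IsSymplectic.comp {L L' : E m →L[ℝ] E m} (h : IsSymplectic L) (h' : IsSymplectic L') :
    IsSymplectic (L.comp L') := fun u v => (h _ _).trans (h' u v)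

theorem IsSymplectic.injective {L : E m →L[ℝ] E m} (h : IsSymplectic L) :
    Function.Injective L := by
  refine (injective_iff_map_eq_zero L).2 fun u hu => stdForm_nondegenerate fun v => ?_
  rw [← h, hu, ← stdFormL_apply, map_zero]; rfl

/-- A symplectic linear map as a linear automorphism. -/
def IsSymplectic.equiv {L : E m →L[ℝ] E m} (h : IsSymplectic L) : E m ≃L[ℝ] E m :=
  (LinearEquiv.ofInjectiveEndo L.toLinearMap h.injective).toContinuousLinearEquiv

theorem IsSymplectic.equiv_symm {L : E m →L[ℝ] E m} (h : IsSymplectic L) :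
    IsSymplectic (h.equiv.symm : E m →L[ℝ] E m) := fun u v => by
  rw [← h]
  change stdForm (h.equiv (h.equiv.symm u)) (h.equiv (h.equiv.symm v)) = _
  simp

end StdForm

/-! ### Darboux charts and families of local symplectic maps -/

variable {m n : ℕ} {M : Type*} [TopologicalSpace M] [ChartedSpace (E m) M]
  [IsManifold 𝓘(ℝ, E m) ∞ M] {P Q : Type*} [TopologicalSpace P] [TopologicalSpace Q]

section Darboux

/-- A Darboux chart: a chart of the maximal atlas in which `ω` is the standard form. -/
def IsDarboux (σ : SymplecticForm m M) (φ : OpenPartialHomeomorph M (E m)) : Prop :=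
  φ ∈ IsManifold.maximalAtlas 𝓘(ℝ, E m) ∞ M ∧ ∀ y ∈ φ.target, ∀ u v : E m,
    σ.form (φ.symm y) ![mfderiv 𝓘(ℝ, E m) 𝓘(ℝ, E m) φ.symm y u,
      mfderiv 𝓘(ℝ, E m) 𝓘(ℝ, E m) φ.symm y v] = stdForm u v

theorem contMDiffAt_chart {φ : OpenPartialHomeomorph M (E m)}
    (hφ : φ ∈ IsManifold.maximalAtlas 𝓘(ℝ, E m) ∞ M) {x : M} (hx : x ∈ φ.source) :
    ContMDiffAt 𝓘(ℝ, E m) 𝓘(ℝ, E m) ∞ φ x :=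
  (contMDiffOn_of_mem_maximalAtlas hφ).contMDiffAt (φ.open_source.mem_nhds hx)

theorem contMDiffAt_chart_symm {φ : OpenPartialHomeomorph M (E m)}
    (hφ : φ ∈ IsManifold.maximalAtlas 𝓘(ℝ, E m) ∞ M) {y : E m} (hy : y ∈ φ.target) :
    ContMDiffAt 𝓘(ℝ, E m) 𝓘(ℝ, E m) ∞ φ.symm y :=
  (contMDiffOn_symm_of_mem_maximalAtlas hφ).contMDiffAt (φ.open_target.mem_nhds hy)

theorem contDiffAt_chart_comp {φ : OpenPartialHomeomorph M (E m)}
    (hφ : φ ∈ IsManifold.maximalAtlas 𝓘(ℝ, E m) ∞ M) {Y : E m → M} {z : E m}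
    (hY : ContMDiffAt 𝓘(ℝ, E m) 𝓘(ℝ, E m) ∞ Y z) (hz : Y z ∈ φ.source) :
    ContDiffAt ℝ ∞ (fun z => φ (Y z)) z :=
  ((contMDiffAt_chart hφ hz).comp z hY).contDiffAt

theorem contMDiffAt_of_chart_comp {φ : OpenPartialHomeomorph M (E m)}
    (hφ : φ ∈ IsManifold.maximalAtlas 𝓘(ℝ, E m) ∞ M) {Y : E m → M} {z : E m}
    (hz : ∀ᶠ w in 𝓝 z, Y w ∈ φ.source) (h : ContDiffAt ℝ ∞ (fun z => φ (Y z)) z) :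
    ContMDiffAt 𝓘(ℝ, E m) 𝓘(ℝ, E m) ∞ Y z := by
  have h1 := (contMDiffAt_chart_symm hφ (φ.map_source hz.self_of_nhds)).comp
    (f := fun z => φ (Y z)) z h.contMDiffAt
  refine h1.congr_of_eventuallyEq ?_
  filter_upwards [hz] with w hw using (φ.left_inv hw).symm

theorem contDiffAt_transition {φ ψ : OpenPartialHomeomorph M (E m)}
    (hφ : φ ∈ IsManifold.maximalAtlas 𝓘(ℝ, E m) ∞ M)
    (hψ : ψ ∈ IsManifold.maximalAtlas 𝓘(ℝ, E m) ∞ M) {y : E m} (hy : y ∈ φ.target)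
    (hy' : φ.symm y ∈ ψ.source) : ContDiffAt ℝ ∞ (fun y => ψ (φ.symm y)) y :=
  contDiffAt_chart_comp hψ (contMDiffAt_chart_symm hφ hy) hy'

/-- The pullback of `ω` under a map to `M`, computed in a Darboux chart. -/
theorem IsDarboux.form_mfderiv {σ : SymplecticForm m M} {φ : OpenPartialHomeomorph M (E m)}
    (hφ : IsDarboux σ φ) {Y : E m → M} {z : E m} (hz : Y z ∈ φ.source)
    (hY : MDifferentiableAt 𝓘(ℝ, E m) 𝓘(ℝ, E m) Y z) (u v : E m) :
    σ.form (Y z) ![mfderiv 𝓘(ℝ, E m) 𝓘(ℝ, E m) Y z u, mfderiv 𝓘(ℝ, E m) 𝓘(ℝ, E m) Y z v] =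
      stdForm (fderiv ℝ (fun z => φ (Y z)) z u) (fderiv ℝ (fun z => φ (Y z)) z v) := by
  have h1 : MDifferentiableAt 𝓘(ℝ, E m) 𝓘(ℝ, E m) (fun z => φ (Y z)) z :=
    ((contMDiffAt_chart hφ.1 hz).mdifferentiableAt (by simp)).comp z hY
  have h2 : MDifferentiableAt 𝓘(ℝ, E m) 𝓘(ℝ, E m) φ.symm (φ (Y z)) :=
    (contMDiffAt_chart_symm hφ.1 (φ.map_source hz)).mdifferentiableAt (by simp)
  have h3 : Y =ᶠ[𝓝 z] φ.symm ∘ (fun z => φ (Y z)) := by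
    filter_upwards [hY.continuousAt.eventually (φ.open_source.mem_nhds hz)] with w hw
    exact (φ.left_inv hw).symm
  have h4 := mfderiv_comp (I := 𝓘(ℝ, E m)) (I' := 𝓘(ℝ, E m)) (I'' := 𝓘(ℝ, E m)) z h2 h1
  rw [mfderiv_eq_fderiv] at h4
  have h5 := h3.mfderiv_eq (I := 𝓘(ℝ, E m)) (I' := 𝓘(ℝ, E m))
  have h6 := hφ.2 (φ (Y z)) (φ.map_source hz) (fderiv ℝ (fun z => φ (Y z)) z u)
    (fderiv ℝ (fun z => φ (Y z)) z v)
  rw [← h6, h5, h4]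
  exact form_congr σ (φ.left_inv hz).symm _ _

theorem IsDarboux.isSymplectic_transition {σ : SymplecticForm m M}
    {φ ψ : OpenPartialHomeomorph M (E m)} (hφ : IsDarboux σ φ) (hψ : IsDarboux σ ψ) {y : E m}
    (hy : y ∈ φ.target) (hy' : φ.symm y ∈ ψ.source) :
    IsSymplectic (fderiv ℝ (fun y => ψ (φ.symm y)) y) := fun u v => by
  rw [← hψ.form_mfderiv hy' ((contMDiffAt_chart_symm hφ.1 hy).mdifferentiableAt (by simp)), hφ.2 y hy]

end Darboux

section Good

/-- A family of maps `E m → M` is good on `Ω` with respect to a chart `φ` if it takes values in the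
domain of `φ` and is, in this chart, a continuous family of smooth symplectic maps. -/
def GoodOn (φ : OpenPartialHomeomorph M (E m)) (Y : P → E m → M) (Ω : Set (P × E m)) : Prop :=
  (∀ q ∈ Ω, Y q.1 q.2 ∈ φ.source) ∧ (∀ k, FamC k (fun p z => φ (Y p z)) Ω) ∧
    ∀ q ∈ Ω, IsSymplectic (fderiv ℝ (fun z => φ (Y q.1 z)) q.2)

/-- A family of maps `E m → M` is good at `(p₀, z₀)` if it is, near this point, a continuous family
of smooth symplectic maps. -/
def GoodAt (σ : SymplecticForm m M) (Y : P → E m → M) (p₀ : P) (z₀ : E m) : Prop :=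
  ∃ φ, IsDarboux σ φ ∧ ∃ Ω, IsOpen Ω ∧ (p₀, z₀) ∈ Ω ∧ GoodOn φ Y Ω

variable {σ : SymplecticForm m M} {φ ψ : OpenPartialHomeomorph M (E m)} {Y Y' : P → E m → M}
  {Ω : Set (P × E m)}

theorem GoodOn.mono {Ω' : Set (P × E m)} (h : GoodOn φ Y Ω) (hs : Ω' ⊆ Ω) : GoodOn φ Y Ω' :=
  ⟨fun q hq => h.1 q (hs hq), fun k => (h.2.1 k).mono hs, fun q hq => h.2.2 q (hs hq)⟩

theorem GoodOn.congr (h : GoodOn φ Y Ω) (hΩ : IsOpen Ω) (he : ∀ q ∈ Ω, Y' q.1 q.2 = Y q.1 q.2) :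
    GoodOn φ Y' Ω := by
  refine ⟨fun q hq => by rw [he q hq]; exact h.1 q hq,
    fun k => (h.2.1 k).congr hΩ fun q hq => by rw [he q hq], fun q hq => ?_⟩
  have : (fun z => φ (Y' q.1 z)) =ᶠ[𝓝 q.2] fun z => φ (Y q.1 z) := by
    filter_upwards [slice_mem_nhds hΩ hq] with z hz
    rw [he (q.1, z) hz]
  rw [this.fderiv_eq]
  exact h.2.2 q hq

theorem GoodOn.comap (h : GoodOn φ Y Ω) {a : Q → P} {Ω' : Set (Q × E m)}
    (ha : ContinuousOn (fun q : Q × E m => a q.1) Ω') (hs : ∀ q ∈ Ω', (a q.1, q.2) ∈ Ω) :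
    GoodOn φ (fun x => Y (a x)) Ω' :=
  ⟨fun q hq => h.1 _ (hs q hq), fun k => (h.2.1 k).comap ha hs, fun q hq => h.2.2 _ (hs q hq)⟩

theorem GoodOn.continuousOn (h : GoodOn φ Y Ω) : ContinuousOn (fun q : P × E m => Y q.1 q.2) Ω := by
  have h1 : ContinuousOn (fun q : P × E m => φ.symm (φ (Y q.1 q.2))) Ω :=
    φ.continuousOn_symm.comp (h.2.1 0).continuousOn fun q hq => φ.map_source (h.1 q hq)
  exact h1.congr fun q hq => (φ.left_inv (h.1 q hq)).symm

theorem GoodOn.isOpen_inter (h : GoodOn φ Y Ω) (hΩ : IsOpen Ω) {S : Set M} (hS : IsOpen S) :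
    IsOpen {q | q ∈ Ω ∧ Y q.1 q.2 ∈ S} :=
  h.continuousOn.isOpen_inter_preimage hΩ hS

theorem famC_transition (hφ : φ ∈ IsManifold.maximalAtlas 𝓘(ℝ, E m) ∞ M)
    (hψ : ψ ∈ IsManifold.maximalAtlas 𝓘(ℝ, E m) ∞ M) (hΩ : IsOpen Ω)
    (h1 : ∀ q ∈ Ω, Y q.1 q.2 ∈ φ.source) (h2 : ∀ q ∈ Ω, Y q.1 q.2 ∈ ψ.source)
    {k : ℕ} (h : FamC k (fun p z => φ (Y p z)) Ω) : FamC k (fun p z => ψ (Y p z)) Ω := by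
  refine (h.comp_left (f := fun y => ψ (φ.symm y)) hΩ fun q hq => ?_).congr hΩ fun q hq => ?_
  · exact (contDiffAt_transition hφ hψ (φ.map_source (h1 q hq))
      (by rw [φ.left_inv (h1 q hq)]; exact h2 q hq)).of_le (by exact_mod_cast le_top)
  · rw [φ.left_inv (h1 q hq)]

theorem GoodOn.transition (h : GoodOn φ Y Ω) (hφ : IsDarboux σ φ) (hψ : IsDarboux σ ψ)
    (hΩ : IsOpen Ω) (h2 : ∀ q ∈ Ω, Y q.1 q.2 ∈ ψ.source) : GoodOn ψ Y Ω := by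
  refine ⟨h2, fun k => famC_transition hφ.1 hψ.1 hΩ h.1 h2 (h.2.1 k), fun q hq => ?_⟩
  have hsrc := h.1 q hq
  have h3 : (fun z => ψ (Y q.1 z)) =ᶠ[𝓝 q.2] fun z => ψ (φ.symm (φ (Y q.1 z))) := by
    filter_upwards [slice_mem_nhds hΩ hq] with z hz
    rw [φ.left_inv (h.1 _ hz)]
  have h4 : φ.symm (φ (Y q.1 q.2)) ∈ ψ.source := by rw [φ.left_inv hsrc]; exact h2 q hq
  have h5 := fderiv_comp (g := fun y => ψ (φ.symm y)) (f := fun z => φ (Y q.1 z)) q.2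
    ((contDiffAt_transition hφ.1 hψ.1 (φ.map_source hsrc) h4).differentiableAt (by simp))
    (((h.2.1 1).1 q hq).differentiableAt (by simp))
  rw [h3.fderiv_eq]
  refine (congrArg IsSymplectic h5).mpr ?_
  exact (hφ.isSymplectic_transition hψ (φ.map_source hsrc) h4).comp (h.2.2 q hq)

/-- Goodness can be tested in any Darboux chart. -/
theorem GoodAt.exists_goodOn {p₀ : P} {z₀ : E m} (h : GoodAt σ Y p₀ z₀) (hψ : IsDarboux σ ψ)
    (hs : Y p₀ z₀ ∈ ψ.source) : ∃ Ω, IsOpen Ω ∧ (p₀, z₀) ∈ Ω ∧ GoodOn ψ Y Ω := by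
  obtain ⟨φ, hφ, Ω, hΩ, hmem, hg⟩ := h
  have hopen := hg.isOpen_inter hΩ ψ.open_source
  exact ⟨_, hopen, ⟨hmem, hs⟩,
    (hg.mono fun q hq => hq.1).transition hφ hψ hopen fun q hq => hq.2⟩

theorem GoodAt.eventually {p₀ : P} {z₀ : E m} (h : GoodAt σ Y p₀ z₀) :
    ∀ᶠ q : P × E m in 𝓝 (p₀, z₀), GoodAt σ Y q.1 q.2 := by
  obtain ⟨φ, hφ, Ω, hΩ, hmem, hg⟩ := h
  filter_upwards [hΩ.mem_nhds hmem] with q hq using ⟨φ, hφ, Ω, hΩ, hq, hg⟩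

theorem GoodAt.continuousAt {p₀ : P} {z₀ : E m} (h : GoodAt σ Y p₀ z₀) :
    ContinuousAt (fun q : P × E m => Y q.1 q.2) (p₀, z₀) := by
  obtain ⟨φ, hφ, Ω, hΩ, hmem, hg⟩ := h
  exact hg.continuousOn.continuousAt (hΩ.mem_nhds hmem)

theorem GoodAt.contMDiffAt {p₀ : P} {z₀ : E m} (h : GoodAt σ Y p₀ z₀) :
    ContMDiffAt 𝓘(ℝ, E m) 𝓘(ℝ, E m) ∞ (Y p₀) z₀ := by
  obtain ⟨φ, hφ, Ω, hΩ, hmem, hg⟩ := h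
  refine contMDiffAt_of_chart_comp hφ.1 ?_ (contDiffAt_infty.2 fun k => (hg.2.1 k).1 _ hmem)
  filter_upwards [slice_mem_nhds hΩ hmem] with z hz using hg.1 _ hz

theorem GoodAt.form_eq {p₀ : P} {z₀ : E m} (h : GoodAt σ Y p₀ z₀) (u v : E m) :
    σ.form (Y p₀ z₀) ![mfderiv 𝓘(ℝ, E m) 𝓘(ℝ, E m) (Y p₀) z₀ u,
      mfderiv 𝓘(ℝ, E m) 𝓘(ℝ, E m) (Y p₀) z₀ v] = stdForm u v := by
  have hd := h.contMDiffAt.mdifferentiableAt (by simp)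
  obtain ⟨φ, hφ, Ω, hΩ, hmem, hg⟩ := h
  rw [hφ.form_mfderiv (hg.1 _ hmem) hd]
  exact hg.2.2 _ hmem u v

theorem GoodAt.congr {p₀ : P} {z₀ : E m} (h : GoodAt σ Y p₀ z₀)
    (he : ∀ᶠ q : P × E m in 𝓝 (p₀, z₀), Y' q.1 q.2 = Y q.1 q.2) : GoodAt σ Y' p₀ z₀ := by
  obtain ⟨φ, hφ, Ω, hΩ, hmem, hg⟩ := h
  obtain ⟨S, hS, hSo, hSm⟩ := eventually_nhds_iff.1 he
  exact ⟨φ, hφ, Ω ∩ S, hΩ.inter hSo, ⟨hmem, hSm⟩,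
    (hg.mono inter_subset_left).congr (hΩ.inter hSo) fun q hq => hS q hq.2⟩

theorem GoodAt.comap {a : Q → P} {x₀ : Q} {z₀ : E m} (h : GoodAt σ Y (a x₀) z₀)
    (ha : Continuous a) : GoodAt σ (fun x => Y (a x)) x₀ z₀ := by
  obtain ⟨φ, hφ, Ω, hΩ, hmem, hg⟩ := h
  have hc : Continuous fun q : Q × E m => (a q.1, q.2) := by fun_prop
  exact ⟨φ, hφ, _, hΩ.preimage hc, hmem,
    hg.comap (a := a) (by fun_prop : Continuous fun q : Q × E m => a q.1).continuousOn
      fun q hq => hq⟩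

/-- Goodness is local in the parameter. -/
theorem GoodAt.of_subtype {U : Set P} (hU : IsOpen U) {p₀ : U} {z₀ : E m}
    (h : GoodAt σ (fun p : U => Y p) p₀ z₀) : GoodAt σ Y (p₀ : P) z₀ := by
  obtain ⟨φ, hφ, Ω, hΩ, hmem, hg⟩ := h
  have hemb : Topology.IsOpenEmbedding (Prod.map (Subtype.val : U → P) (id : E m → E m)) :=
    hU.isOpenEmbedding_subtypeVal.prodMap Topology.IsOpenEmbedding.id
  refine ⟨φ, hφ, _, hemb.isOpenMap _ hΩ, ⟨_, hmem, rfl⟩, ?_, fun k => ⟨?_, fun j hj => ?_⟩, ?_⟩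
  · rintro _ ⟨q, hq, rfl⟩; exact hg.1 q hq
  · rintro _ ⟨q, hq, rfl⟩; exact (hg.2.1 k).1 q hq
  · rintro _ ⟨q, hq, rfl⟩
    have h1 : ContinuousAt ((fun q : P × E m => iteratedFDeriv ℝ j (fun z => φ (Y q.1 z)) q.2) ∘
        Prod.map (Subtype.val : U → P) (id : E m → E m)) q :=
      ((hg.2.1 k).2 j hj).continuousAt (hΩ.mem_nhds hq)
    exact (hemb.continuousAt_iff.1 h1).continuousWithinAt
  · rintro _ ⟨q, hq, rfl⟩; exact hg.2.2 q hq

end Good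

end SymplecticBalls
end
noncomputable section
namespace SymplecticBalls

variable {m n : ℕ} {M : Type*} [TopologicalSpace M] [ChartedSpace (E m) M]
  [IsManifold 𝓘(ℝ, E m) ∞ M] {P Q : Type*} [TopologicalSpace P] [TopologicalSpace Q]
  {σ : SymplecticForm m M}

/-! ### The topology of spaces of embeddings in terms of good families -/

theorem extend_of_mem {c : ℝ} (f : ball m c → M) {z : E m} (hz : z ∈ ball m c) :
    extend f z = f ⟨z, hz⟩ := dif_pos hz

theorem uniqueDiffOn_ball {c : ℝ} (hc : 0 < c) : UniqueDiffOn ℝ (ball m c) :=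
  uniqueDiffOn_convex (convex_closedBall _ _) ⟨0, mem_interior_iff_mem_nhds.2 (ball_mem_nhds m hc)⟩

theorem iteratedFDerivWithin_extend {c : ℝ} (hc : 0 < c) {f : ball m c → M} {F : E m → M}
    (hF : ∀ z ∈ ball m c, extend f z = F z) (ψ : M → E m) {z : E m} (hz : z ∈ ball m c) {j : ℕ}
    (hd : ContDiffAt ℝ j (fun z => ψ (F z)) z) :
    iteratedFDerivWithin ℝ j (ψ ∘ extend f) (ball m c) z =
      iteratedFDeriv ℝ j (fun z => ψ (F z)) z := by
  rw [iteratedFDerivWithin_congr (f₁ := ψ ∘ extend f) (f := fun z => ψ (F z))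
    (fun w hw => by simp only [Function.comp_apply, hF w hw]) hz,
    iteratedFDerivWithin_eq_iteratedFDeriv (uniqueDiffOn_ball hc) hd hz]

theorem mem_maximalAtlas_of_mem_atlas {ψ : OpenPartialHomeomorph M (E m)}
    (h : ψ ∈ atlas (E m) M) : ψ ∈ IsManifold.maximalAtlas 𝓘(ℝ, E m) ∞ M :=
  IsManifold.subset_maximalAtlas h

/-- A good family of maps that are embeddings on the balls is a continuous family of
embeddings. -/
theorem continuous_emb_of_goodAt {c : Cap n} {g : P → Emb σ c} {Y : Fin n → P → E m → M}
    (hgY : ∀ p i, ∀ z ∈ ball m (c.1 i), extend ((g p).1 i) z = Y i p z)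
    (hY : ∀ p i, ∀ z ∈ ball m (c.1 i), GoodAt σ (Y i) p z) : Continuous g := by
  refine continuous_generateFrom_iff.2 ?_
  rintro N ⟨f, i, K, ψ, k, ε, hK, hKb, hψ, hfK, hε, rfl⟩
  have hψ' := mem_maximalAtlas_of_mem_atlas hψ
  obtain ⟨U, F, hU, hsub, hF, hFf, -⟩ := f.2.1 i
  have hFext : ∀ z ∈ ball m (c.1 i), extend (f.1 i) z = F z := fun z hz =>
    (extend_of_mem _ hz).trans (hFf ⟨z, hz⟩).symm
  have hFd : ∀ z ∈ K, ContDiffAt ℝ ∞ (fun z => ψ (F z)) z := fun z hz =>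
    contDiffAt_chart_comp hψ' (hF.contMDiffAt (hU.mem_nhds (hsub (hKb hz))))
      (by rw [← hFext z (hKb hz)]; exact hfK z hz)
  refine isOpen_iff_mem_nhds.2 fun p₀ hp₀ => ?_
  suffices h : ∀ᶠ p in 𝓝 p₀, ∀ z ∈ K, z ∈ K → extend ((g p).1 i) z ∈ ψ.source ∧ ∀ j ≤ k,
      ‖iteratedFDerivWithin ℝ j (ψ ∘ extend ((g p).1 i)) (ball m (c.1 i)) z -
        iteratedFDerivWithin ℝ j (ψ ∘ extend (f.1 i)) (ball m (c.1 i)) z‖ < ε by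
    filter_upwards [h] with p hp z hz using hp z hz hz
  refine hK.eventually_forall_of_forall_eventually fun z₀ hz₀ => ?_
  obtain ⟨hs₀, hd₀⟩ := hp₀ z₀ hz₀
  obtain ⟨φ, hφ, Ω, hΩ, hmem, hg⟩ := hY p₀ i z₀ (hKb hz₀)
  have hΩ' := hg.isOpen_inter hΩ ψ.open_source
  have hmem' : (p₀, z₀) ∈ {q | q ∈ Ω ∧ Y i q.1 q.2 ∈ ψ.source} :=
    ⟨hmem, by rw [← hgY p₀ i z₀ (hKb hz₀)]; exact hs₀⟩
  have hfam : ∀ k, FamC k (fun p z => ψ (Y i p z)) {q | q ∈ Ω ∧ Y i q.1 q.2 ∈ ψ.source} :=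
    fun k => famC_transition hφ.1 hψ' hΩ' (fun q hq => hg.1 q hq.1) (fun q hq => hq.2)
      ((hg.2.1 k).mono fun q hq => hq.1)
  have hev : ∀ᶠ q : P × E m in 𝓝 (p₀, z₀), ∀ j ∈ Finset.range (k + 1), ‖iteratedFDeriv ℝ j
      (fun z => ψ (Y i q.1 z)) q.2 - iteratedFDeriv ℝ j (fun z => ψ (F z)) q.2‖ < ε := by
    rw [Filter.eventually_all_finset]
    intro j hj
    have hj' : j ≤ k := by simpa [Nat.lt_succ_iff] using hj
    have h1 : ContinuousAt (fun q : P × E m => iteratedFDeriv ℝ j (fun z => ψ (Y i q.1 z)) q.2)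
        (p₀, z₀) := ((hfam j).2 j le_rfl).continuousAt (hΩ'.mem_nhds hmem')
    have h2 : ContinuousAt (fun q : P × E m => iteratedFDeriv ℝ j (fun z => ψ (F z)) q.2)
        (p₀, z₀) := ContinuousAt.comp (f := fun q : P × E m => q.2)
      ((hFd z₀ hz₀).continuousAt_iteratedFDeriv (by exact_mod_cast le_top)) continuousAt_snd
    refine (h1.sub h2).norm.eventually_lt continuousAt_const ?_
    have h3 := hd₀ j hj'
    rw [iteratedFDerivWithin_extend (c.2 i) (hgY p₀ i) ψ (hKb hz₀) ((hfam j).1 _ hmem'),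
      iteratedFDerivWithin_extend (c.2 i) hFext ψ (hKb hz₀)
        ((hFd z₀ hz₀).of_le (by exact_mod_cast le_top))] at h3
    exact h3
  filter_upwards [hev, hΩ'.mem_nhds hmem'] with q hq1 hq2 hqK
  refine ⟨by rw [hgY _ i _ (hKb hqK)]; exact hq2.2, fun j hj => ?_⟩
  rw [iteratedFDerivWithin_extend (c.2 i) (hgY q.1 i) ψ (hKb hqK) ((hfam j).1 _ hq2),
      iteratedFDerivWithin_extend (c.2 i) hFext ψ (hKb hqK)
        ((hFd _ hqK).of_le (by exact_mod_cast le_top))]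
  exact hq1 j (by simpa [Nat.lt_succ_iff] using hj)

/-- In the interior of the balls, the embeddings themselves form a good family. -/
theorem goodAt_emb (hD : ∀ x : M, ∃ φ, IsDarboux σ φ ∧ x ∈ φ.source) {c : Cap n} (i : Fin n)
    (f₀ : Emb σ c) {z₀ : E m} (hz₀ : z₀ ∈ Metric.ball (0 : E m) (√(c.1 i / Real.pi))) :
    GoodAt σ (fun (f : Emb σ c) z => extend (f.1 i) z) f₀ z₀ := by
  have hsmooth : ∀ (f : Emb σ c), ∀ z ∈ Metric.ball (0 : E m) (√(c.1 i / Real.pi)),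
      ContMDiffAt 𝓘(ℝ, E m) 𝓘(ℝ, E m) ∞ (extend (f.1 i)) z ∧ ∀ u v,
      σ.form (extend (f.1 i) z) ![mfderiv 𝓘(ℝ, E m) 𝓘(ℝ, E m) (extend (f.1 i)) z u,
        mfderiv 𝓘(ℝ, E m) 𝓘(ℝ, E m) (extend (f.1 i)) z v] = stdForm u v := by
    intro f z hz
    obtain ⟨U, F, hU, hsub, hF, hFf, hσ⟩ := f.2.1 i
    have hzb : z ∈ ball m (c.1 i) := Metric.ball_subset_closedBall hz
    have h1 : extend (f.1 i) =ᶠ[𝓝 z] F := by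
      filter_upwards [Metric.isOpen_ball.mem_nhds hz] with w hw
      exact (extend_of_mem _ (Metric.ball_subset_closedBall hw)).trans (hFf ⟨w, _⟩).symm
    refine ⟨(hF.contMDiffAt (hU.mem_nhds (hsub hzb))).congr_of_eventuallyEq h1, fun u v => ?_⟩
    have h2 := h1.mfderiv_eq (I := 𝓘(ℝ, E m)) (I' := 𝓘(ℝ, E m))
    rw [← hσ z hzb u v, h2]
    exact form_congr σ h1.eq_of_nhds _ _
  set ψ := chartAt (E m) (extend (f₀.1 i) z₀) with hψdef
  have hψ : ψ ∈ atlas (E m) M := chart_mem_atlas _ _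
  have hψ' := mem_maximalAtlas_of_mem_atlas hψ
  -- a closed ball around `z₀`, inside of the ball, that `f₀` maps to the domain of `ψ`
  obtain ⟨δ, hδ, hδ'⟩ : ∃ δ > 0, Metric.closedBall z₀ δ ⊆
      Metric.ball (0 : E m) (√(c.1 i / Real.pi)) ∩ extend (f₀.1 i) ⁻¹' ψ.source :=
    Metric.nhds_basis_closedBall.mem_iff.1 (Filter.inter_mem (Metric.isOpen_ball.mem_nhds hz₀)
      ((hsmooth f₀ z₀ hz₀).1.continuousAt (ψ.open_source.mem_nhds (mem_chart_source _ _))))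
  set K := Metric.closedBall z₀ δ with hKdef
  have hK : IsCompact K := isCompact_closedBall _ _
  have hKb : K ⊆ ball m (c.1 i) := fun z hz => Metric.ball_subset_closedBall (hδ' hz).1
  have hKi : ∀ z ∈ K, z ∈ Metric.ball (0 : E m) (√(c.1 i / Real.pi)) := fun z hz => (hδ' hz).1
  have hopen : ∀ (f : Emb σ c), (∀ z ∈ K, extend (f.1 i) z ∈ ψ.source) → ∀ k, ∀ ε > 0,
      IsOpen (f.basicNhd i K ψ k ε) := fun f hf k ε hε =>
    TopologicalSpace.isOpen_generateFrom_of_mem ⟨f, i, K, ψ, k, ε, hK, hKb, hψ, hf, hε, rfl⟩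
  have hself : ∀ (f : Emb σ c), (∀ z ∈ K, extend (f.1 i) z ∈ ψ.source) → ∀ k, ∀ ε > 0,
      f ∈ f.basicNhd i K ψ k ε := fun f hf k ε hε z hz =>
    ⟨hf z hz, fun j _ => by simpa using hε⟩
  have hf₀ : ∀ z ∈ K, extend (f₀.1 i) z ∈ ψ.source := fun z hz => (hδ' hz).2
  set N := f₀.basicNhd i K ψ 0 1 with hN
  have hNs : ∀ f ∈ N, ∀ z ∈ K, extend (f.1 i) z ∈ ψ.source := fun f hf z hz => (hf z hz).1
  set Ω : Set (Emb σ c × E m) := N ×ˢ Metric.ball z₀ δ with hΩdef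
  have hΩ : IsOpen Ω := (hopen f₀ hf₀ 0 1 one_pos).prod Metric.isOpen_ball
  have hmem : (f₀, z₀) ∈ Ω := ⟨hself f₀ hf₀ 0 1 one_pos, Metric.mem_ball_self hδ⟩
  have hcd : ∀ f ∈ N, ∀ z ∈ K, ContDiffAt ℝ ∞ (fun z => ψ (extend (f.1 i) z)) z :=
    fun f hf z hz => contDiffAt_chart_comp hψ' (hsmooth f z (hKi z hz)).1 (hNs f hf z hz)
  have hfam : ∀ k, FamC k (fun (f : Emb σ c) z => ψ (extend (f.1 i) z)) Ω := by
    refine fun k => ⟨fun q hq => (hcd q.1 hq.1 q.2 (Metric.ball_subset_closedBall hq.2)).of_le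
      (by exact_mod_cast le_top), fun j hj => ?_⟩
    rintro ⟨f₁, z₁⟩ ⟨hf₁, hz₁⟩
    have hz₁K : z₁ ∈ K := Metric.ball_subset_closedBall hz₁
    refine ContinuousAt.continuousWithinAt ?_
    have h2 : ContinuousAt (fun q : Emb σ c × E m =>
        iteratedFDeriv ℝ j (fun z => ψ (extend (f₁.1 i) z)) q.2) (f₁, z₁) :=
      ContinuousAt.comp (f := fun q : Emb σ c × E m => q.2)
        ((hcd f₁ hf₁ z₁ hz₁K).continuousAt_iteratedFDeriv (by exact_mod_cast le_top))
        continuousAt_snd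
    have h3 : Filter.Tendsto (fun q : Emb σ c × E m =>
        iteratedFDeriv ℝ j (fun z => ψ (extend (q.1.1 i) z)) q.2 -
          iteratedFDeriv ℝ j (fun z => ψ (extend (f₁.1 i) z)) q.2) (𝓝 (f₁, z₁)) (𝓝 0) := by
      rw [Metric.tendsto_nhds]
      intro ε hε
      have h4 : f₁.basicNhd i K ψ j ε ×ˢ Metric.ball z₀ δ ∈ 𝓝 (f₁, z₁) :=
        ((hopen f₁ (hNs f₁ hf₁) j ε hε).prod Metric.isOpen_ball).mem_nhds
          ⟨hself f₁ (hNs f₁ hf₁) j ε hε, hz₁⟩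
      filter_upwards [h4, hΩ.mem_nhds (⟨hf₁, hz₁⟩ : (f₁, z₁) ∈ Ω)] with q hq hqΩ
      have hqK : q.2 ∈ K := Metric.ball_subset_closedBall hq.2
      have h5 := (hq.1 q.2 hqK).2 j le_rfl
      rw [iteratedFDerivWithin_extend (c.2 i) (fun z _ => rfl) ψ (hKb hqK)
          ((hcd q.1 hqΩ.1 q.2 hqK).of_le (by exact_mod_cast le_top)),
        iteratedFDerivWithin_extend (c.2 i) (fun z _ => rfl) ψ (hKb hqK)
          ((hcd f₁ hf₁ q.2 hqK).of_le (by exact_mod_cast le_top))] at h5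
      rwa [dist_zero_right]
    have h6 := h3.add h2.tendsto
    rw [zero_add] at h6
    exact Filter.Tendsto.congr (fun q => sub_add_cancel _ _) h6
  -- pass from `ψ` to a Darboux chart
  obtain ⟨φ, hφ, hφx⟩ := hD (extend (f₀.1 i) z₀)
  have hYc : ContinuousOn (fun q : Emb σ c × E m => extend (q.1.1 i) q.2) Ω := by
    have h1 : ContinuousOn (fun q : Emb σ c × E m => ψ.symm (ψ (extend (q.1.1 i) q.2))) Ω :=
      ψ.continuousOn_symm.comp (hfam 0).continuousOn fun q hq =>
        ψ.map_source (hNs _ hq.1 _ (Metric.ball_subset_closedBall hq.2))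
    exact h1.congr fun q hq =>
      (ψ.left_inv (hNs _ hq.1 _ (Metric.ball_subset_closedBall hq.2))).symm
  have hΩ' : IsOpen {q : Emb σ c × E m | q ∈ Ω ∧ extend (q.1.1 i) q.2 ∈ φ.source} :=
    hYc.isOpen_inter_preimage hΩ φ.open_source
  refine ⟨φ, hφ, _, hΩ', ⟨hmem, hφx⟩, fun q hq => hq.2, fun k => ?_, fun q hq u v => ?_⟩
  · exact famC_transition hψ' hφ.1 hΩ'
      (fun q hq => hNs _ hq.1.1 _ (Metric.ball_subset_closedBall hq.1.2)) (fun q hq => hq.2)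
      ((hfam k).mono fun q hq => hq.1)
  · have h1 := hsmooth q.1 q.2 (hKi _ (Metric.ball_subset_closedBall hq.1.2))
    rw [← hφ.form_mfderiv hq.2 (h1.1.mdifferentiableAt (by simp))]
    exact h1.2 u v

end SymplecticBalls
end
noncomputable section
namespace SymplecticBalls

variable {m n : ℕ} {M : Type*} [TopologicalSpace M] [ChartedSpace (E m) M]
  [IsManifold 𝓘(ℝ, E m) ∞ M] {P Q : Type*} [TopologicalSpace P] [TopologicalSpace Q]
  {σ : SymplecticForm m M}

/-! ### From good families to continuous families of embeddings -/

/-- The maps `Y i p`, `i : Fin n`, restrict to a symplectic embedding of the balls of capacities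
`c`. -/
def EmbCond (σ : SymplecticForm m M) (c : Cap n) (Y : Fin n → P → E m → M) (p : P) : Prop :=
  (∀ i, ∀ z ∈ ball m (c.1 i), GoodAt σ (Y i) p z) ∧
    ∀ i j, ∀ z ∈ ball m (c.1 i), ∀ w ∈ ball m (c.1 j), Y i p z = Y j p w → i = j ∧ z = w

theorem EmbCond.anti {c c' : Cap n} {Y : Fin n → P → E m → M} {p : P} (h : EmbCond σ c' Y p)
    (hc : c ≤ c') : EmbCond σ c Y p :=
  ⟨fun i z hz => h.1 i z (ball_mono m (hc i) hz),
    fun i j z hz w hw => h.2 i j z (ball_mono m (hc i) hz) w (ball_mono m (hc j) hw)⟩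

/-- The embedding given by a family satisfying `EmbCond`. -/
def EmbCond.toEmb {c : Cap n} {Y : Fin n → P → E m → M} {p : P} (h : EmbCond σ c Y p) : Emb σ c :=
  ⟨fun i z => Y i p z, fun i => ⟨{z | GoodAt σ (Y i) p z}, Y i p, by
      refine isOpen_iff_mem_nhds.2 fun z hz => ?_
      exact (Continuous.prodMk_right p).continuousAt.eventually (GoodAt.eventually hz),
    fun z hz => h.1 i z hz, fun z hz => (GoodAt.contMDiffAt hz).contMDiffWithinAt, fun _ => rfl,
    fun z hz => (h.1 i z hz).form_eq⟩, by
    rintro ⟨i, z⟩ ⟨j, w⟩ hzw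
    obtain ⟨rfl, h2⟩ := h.2 i j z z.2 w w.2 hzw
    rw [Subtype.ext h2]⟩

theorem EmbCond.extend_toEmb {c : Cap n} {Y : Fin n → P → E m → M} {p : P} (h : EmbCond σ c Y p)
    (i : Fin n) {z : E m} (hz : z ∈ ball m (c.1 i)) : extend (h.toEmb.1 i) z = Y i p z :=
  extend_of_mem _ hz

theorem EmbCond.extend_eventuallyEq {c : Cap n} {Y : Fin n → P → E m → M} {p : P}
    (h : EmbCond σ c Y p) (i : Fin n) : extend (h.toEmb.1 i) =ᶠ[𝓝 0] Y i p := by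
  filter_upwards [ball_mem_nhds m (c.2 i)] with z hz using h.extend_toEmb i hz

theorem continuous_toEmb {c : Cap n} {Y : Fin n → P → E m → M} (h : ∀ p, EmbCond σ c Y p) :
    Continuous fun p => (h p).toEmb :=
  continuous_emb_of_goodAt (Y := Y) (fun p i _ hz => (h p).extend_toEmb i hz) fun p => (h p).1

theorem GoodOn.exists_injOn {φ : OpenPartialHomeomorph M (E m)} {Y : P → E m → M}
    {Ω : Set (P × E m)} (hg : GoodOn φ Y Ω) (hΩ : IsOpen Ω) {p₀ : P} (hmem : (p₀, 0) ∈ Ω) :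
    ∃ r > 0, ∀ᶠ p in 𝓝 p₀, ∀ z ∈ Metric.ball (0 : E m) r, (p, z) ∈ Ω ∧
      ∀ w ∈ Metric.ball (0 : E m) r, Y p z = Y p w → z = w := by
  set D := fderiv ℝ (fun z => φ (Y p₀ z)) 0 with hD
  have hDs : IsSymplectic D := hg.2.2 _ hmem
  obtain ⟨C, hC, hanti⟩ : ∃ C > 0, ∀ v, C * ‖v‖ ≤ ‖D v‖ := by
    obtain ⟨K, hK, hK'⟩ := (LinearMap.injective_iff_antilipschitz D.toLinearMap).1 hDs.injective
    refine ⟨(K : ℝ)⁻¹, by positivity, fun v => ?_⟩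
    have h1 := hK'.le_mul_dist v 0
    simp only [dist_zero_right, map_zero] at h1
    rw [inv_mul_le_iff₀ (by exact_mod_cast hK)]
    exact h1
  have hc : ContinuousAt (fun q : P × E m => fderiv ℝ (fun z => φ (Y q.1 z)) q.2) (p₀, 0) :=
    (hg.2.1 1).fderiv.continuousOn.continuousAt (hΩ.mem_nhds hmem)
  have h1 : ∀ᶠ q : P × E m in 𝓝 (p₀, 0), q ∈ Ω ∧
      ‖fderiv ℝ (fun z => φ (Y q.1 z)) q.2 - D‖ < C / 2 := by
    have h2 := (hc.sub (continuousAt_const (y := D))).norm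
    have h3 := h2.eventually_lt (continuousAt_const (y := C / 2)) (by simpa [hD] using hC)
    exact Filter.Eventually.and (hΩ.mem_nhds hmem) h3
  rw [nhds_prod_eq] at h1
  obtain ⟨N, hN, B, hB, hNB⟩ := Filter.eventually_prod_iff.1 h1
  obtain ⟨r, hr, hrB⟩ := Metric.eventually_nhds_iff.1 hB
  refine ⟨r, hr, ?_⟩
  filter_upwards [hN] with p hp z hz
  refine ⟨(@hNB p hp z (hrB hz)).1, fun w hw he => ?_⟩
  have hconv : Convex ℝ (Metric.ball (0 : E m) r) := convex_ball _ _
  have h4 := hconv.norm_image_sub_le_of_norm_hasFDerivWithin_le' (f := fun z => φ (Y p z))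
    (f' := fderiv ℝ (fun z => φ (Y p z))) (φ := D) (C := C / 2) (x := w) (y := z)
    (fun x hx => (((hg.2.1 1).1 (p, x) (@hNB p hp x (hrB hx)).1).differentiableAt
      (by simp)).hasFDerivAt.hasFDerivWithinAt)
    (fun x hx => (@hNB p hp x (hrB hx)).2.le) hw hz
  rw [he, sub_self, zero_sub, norm_neg] at h4
  have h5 := hanti (z - w)
  have h6 : ‖z - w‖ ≤ 0 := by nlinarith
  exact sub_eq_zero.1 (norm_le_zero_iff.1 h6)

theorem exists_ball_subset {r : ℝ} (hr : 0 < r) : ∃ c > 0, ball m c ⊆ Metric.ball (0 : E m) r := by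
  refine ⟨Real.pi * (r / 2) ^ 2, by positivity, Metric.closedBall_subset_ball ?_⟩
  rw [mul_div_cancel_left₀ _ Real.pi_pos.ne', Real.sqrt_sq (by positivity)]
  linarith

/-- A good family with distinct centres consists of embeddings on balls of some fixed size, locally
in the parameter. -/
theorem exists_embCond [T2Space M] {Y : Fin n → P → E m → M} {p₀ : P}
    (hY : ∀ i, GoodAt σ (Y i) p₀ 0) (hdist : Function.Injective fun i => Y i p₀ 0) :
    ∃ c : Cap n, ∀ᶠ p in 𝓝 p₀, EmbCond σ c Y p := by
  obtain ⟨V, hV, hVd⟩ : ∃ V : Fin n → Set M, (∀ i, Y i p₀ 0 ∈ V i ∧ IsOpen (V i)) ∧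
      ∀ i j, i ≠ j → Disjoint (V i) (V j) := by
    obtain ⟨U, hU, hUd⟩ := (Set.finite_range fun i => Y i p₀ 0).t2_separation
    exact ⟨fun i => U (Y i p₀ 0), fun i => hU _, fun i j hij =>
      hUd (mem_range_self i) (mem_range_self j) fun h => hij (hdist h)⟩
  choose φ hφ Ω hΩ hmem hg using hY
  have hΩ' : ∀ i, IsOpen {q | q ∈ Ω i ∧ Y i q.1 q.2 ∈ V i} := fun i =>
    (hg i).isOpen_inter (hΩ i) (hV i).2
  have hg' : ∀ i, GoodOn (φ i) (Y i) {q | q ∈ Ω i ∧ Y i q.1 q.2 ∈ V i} := fun i =>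
    (hg i).mono fun q hq => hq.1
  choose r hr hev using fun i => (hg' i).exists_injOn (hΩ' i) ⟨hmem i, (hV i).1⟩
  choose c hc hcr using fun i => exists_ball_subset (m := m) (hr i)
  refine ⟨⟨c, hc⟩, ?_⟩
  filter_upwards [Filter.eventually_all.2 hev] with p hp
  refine ⟨fun i z hz => ⟨φ i, hφ i, Ω i, hΩ i, (hp i z (hcr i hz)).1.1, hg i⟩,
    fun i j z hz w hw he => ?_⟩
  have hzV := (hp i z (hcr i hz)).1.2
  have hwV := (hp j w (hcr j hw)).1.2
  by_cases hij : i = j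
  · subst hij
    exact ⟨rfl, (hp i z (hcr i hz)).2 w (hcr i hw) he⟩
  · exact absurd rfl ((hVd i j hij).ne_of_mem hzV (by rw [show Y i p z = Y j p w from he]; exact hwV))

/-- Over a compact space of parameters a single tuple of capacities suffices. -/
theorem exists_embCond_of_compact [T2Space M] [CompactSpace P] {Y : Fin n → P → E m → M}
    (hY : ∀ p i, GoodAt σ (Y i) p 0) (hdist : ∀ p, Function.Injective fun i => Y i p 0) :
    ∃ c : Cap n, ∀ p, EmbCond σ c Y p := by
  have h := isCompact_univ.induction_on (p := fun S : Set P => ∃ c : Cap n, ∀ p ∈ S, EmbCond σ c Y p)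
    ⟨⟨fun _ => 1, fun _ => one_pos⟩, fun _ h => h.elim⟩
    (fun S T hST ⟨c, hc⟩ => ⟨c, fun p hp => hc p (hST hp)⟩)
    (fun S T ⟨c, hc⟩ ⟨c', hc'⟩ => ⟨c.min c', fun p hp => hp.elim
      (fun h => (hc p h).anti (c.min_le_left c')) (fun h => (hc' p h).anti (c.min_le_right c'))⟩)
    (fun p _ => by
      obtain ⟨c, hc⟩ := exists_embCond (hY p) (hdist p)
      exact ⟨_, mem_nhdsWithin_of_mem_nhds hc, c, fun p hp => hp⟩)
  obtain ⟨c, hc⟩ := h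
  exact ⟨c, fun p => hc p (mem_univ p)⟩

/-! ### Germs of embeddings -/

/-- The maps `y i` represent the germ `e` of embeddings. -/
def Represents (e : EmbLim σ n) (y : Fin n → E m → M) : Prop :=
  ∃ f : Σ c : Cap n, Emb σ c, e = Quotient.mk (embSetoid σ n) f ∧
    ∀ i, extend (f.2.1 i) =ᶠ[𝓝 0] y i

theorem Represents.unique {e e' : EmbLim σ n} {y y' : Fin n → E m → M} (h : Represents e y)
    (h' : Represents e' y') (he : ∀ i, y i =ᶠ[𝓝 0] y' i) : e = e' := by
  obtain ⟨⟨c, f⟩, rfl, hf⟩ := h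
  obtain ⟨⟨c', f'⟩, rfl, hf'⟩ := h'
  have h1 : ∀ i, ∃ r > 0, Metric.ball (0 : E m) r ⊆ {z | extend (f.1 i) z = extend (f'.1 i) z} :=
    fun i => Metric.mem_nhds_iff.1 (((hf i).trans (he i)).trans (hf' i).symm)
  choose r hr hrs using h1
  choose d hd hdr using fun i => exists_ball_subset (m := m) (hr i)
  let c'' : Cap n := (c.min c').min ⟨d, hd⟩
  have hc : c'' ≤ c := (Cap.min_le_left _ _).trans (Cap.min_le_left _ _)
  have hc' : c'' ≤ c' := (Cap.min_le_left _ _).trans (Cap.min_le_right _ _)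
  refine Quotient.sound ⟨c'', hc, hc', Subtype.ext (funext fun i => funext fun z => ?_)⟩
  have h2 := hrs i (hdr i (ball_mono m (Cap.min_le_right (c.min c') ⟨d, hd⟩ i) z.2))
  change extend (f.1 i) z.1 = extend (f'.1 i) z.1 at h2
  rw [extend_of_mem _ (ball_mono m (hc i) z.2), extend_of_mem _ (ball_mono m (hc' i) z.2)] at h2
  exact h2

theorem Represents.congr {e : EmbLim σ n} {y y' : Fin n → E m → M} (h : Represents e y)
    (he : ∀ i, y i =ᶠ[𝓝 0] y' i) : Represents e y' := by
  obtain ⟨f, rfl, hf⟩ := h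
  exact ⟨f, rfl, fun i => (hf i).trans (he i)⟩

/-- A good family with distinct centres defines a continuous family of germs. -/
theorem exists_continuous_germ [T2Space M] {Y : Fin n → P → E m → M}
    (hY : ∀ p i, GoodAt σ (Y i) p 0) (hdist : ∀ p, Function.Injective fun i => Y i p 0) :
    ∃ g : C(P, EmbLim σ n), ∀ p, Represents (g p) fun i => Y i p := by
  choose c hc using fun p => exists_embCond (hY p) (hdist p)
  have hc' : ∀ p, EmbCond σ (c p) Y p := fun p => (hc p).self_of_nhds
  let g : P → EmbLim σ n := fun p => Quotient.mk (embSetoid σ n) ⟨c p, (hc' p).toEmb⟩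
  have hg : ∀ p, Represents (g p) fun i => Y i p := fun p =>
    ⟨_, rfl, fun i => (hc' p).extend_eventuallyEq i⟩
  refine ⟨⟨g, continuous_iff_continuousAt.2 fun p₀ => ?_⟩, hg⟩
  -- near `p₀` the family lifts to the space of embeddings of balls of capacities `c p₀`
  obtain ⟨U, hU, hUo, hpU⟩ := eventually_nhds_iff.1 (hc p₀)
  have hUc : ∀ p : U, EmbCond σ (c p₀) (fun i (p : U) => Y i p) p := fun p =>
    ⟨fun i z hz => GoodAt.comap (a := fun p : U => (p : P)) ((hU p p.2).1 i z hz)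
      continuous_subtype_val, (hU p p.2).2⟩
  have h1 : Continuous fun p : U =>
      (Quotient.mk (embSetoid σ n) ⟨c p₀, (hUc p).toEmb⟩ : EmbLim σ n) :=
    continuous_quotient_mk'.comp (continuous_sigmaMk.comp (continuous_toEmb hUc))
  have h2 : ContinuousOn g U := by
    rw [continuousOn_iff_continuous_domRestrict]
    refine h1.congr fun p => ?_
    exact Represents.unique ⟨_, rfl, fun i => (hUc p).extend_eventuallyEq i⟩ (hg p)
      fun i => Filter.EventuallyEq.rfl
  exact h2.continuousAt (hUo.mem_nhds hpU)

/-! ### Frames of germs -/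

/-- The frame at the centre of a map `E m → M`. -/
def frameOf (y : E m → M) : HomTM m M := ⟨y 0, mfderiv 𝓘(ℝ, E m) 𝓘(ℝ, E m) y 0⟩

theorem frameOf_congr {y y' : E m → M} (h : y =ᶠ[𝓝 0] y') : frameOf y = frameOf y' :=
  homTM_ext h.eq_of_nhds (h.mfderiv_eq (I := 𝓘(ℝ, E m)) (I' := 𝓘(ℝ, E m)))

theorem jInf_apply {e : EmbLim σ n} {y : Fin n → E m → M} (h : Represents e y) (i : Fin n) :
    (jInf σ n e).1 i = frameOf (y i) := by
  obtain ⟨f, rfl, hf⟩ := h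
  exact frameOf_congr (hf i)

theorem jc_toEmb {c : Cap n} {Y : Fin n → P → E m → M} {p : P} (h : EmbCond σ c Y p) (i : Fin n) :
    (jc σ c h.toEmb).1 i = frameOf (Y i p) :=
  frameOf_congr (h.extend_eventuallyEq i)

/-- The tuples of frames of a good family with distinct centres form a continuous family. -/
theorem exists_continuous_frame [T2Space M] {Y : Fin n → P → E m → M}
    (hY : ∀ p i, GoodAt σ (Y i) p 0) (hdist : ∀ p, Function.Injective fun i => Y i p 0) :
    ∃ g : C(P, SpFr σ n), ∀ p i, (g p).1 i = frameOf (Y i p) := by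
  obtain ⟨g, hg⟩ := exists_continuous_germ hY hdist
  exact ⟨(jInf σ n).comp g, fun p i => jInf_apply (hg p) i⟩

end SymplecticBalls
end
noncomputable section
namespace SymplecticBalls

variable {m n : ℕ} {M : Type*} [TopologicalSpace M] [ChartedSpace (E m) M]
  [IsManifold 𝓘(ℝ, E m) ∞ M] {P Q : Type*} [TopologicalSpace P] [TopologicalSpace Q]
  {σ : SymplecticForm m M} {φ ψ : OpenPartialHomeomorph M (E m)}

/-! ### Frames in Darboux charts -/

/-- The matrix of a frame in a chart `φ`. -/
def frameMat (φ : OpenPartialHomeomorph M (E m)) (A : HomTM m M) : E m →L[ℝ] E m :=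
  (mfderiv 𝓘(ℝ, E m) 𝓘(ℝ, E m) φ A.proj : E m →L[ℝ] E m).comp (A.snd : E m →L[ℝ] E m)

theorem frameMat_frameOf (hφ : φ ∈ IsManifold.maximalAtlas 𝓘(ℝ, E m) ∞ M) {y : E m → M}
    (hy : MDifferentiableAt 𝓘(ℝ, E m) 𝓘(ℝ, E m) y 0) (h0 : y 0 ∈ φ.source) :
    frameMat φ (frameOf y) = fderiv ℝ (fun z => φ (y z)) 0 := by
  have h := mfderiv_comp (I := 𝓘(ℝ, E m)) (I' := 𝓘(ℝ, E m)) (I'' := 𝓘(ℝ, E m)) 0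
    ((contMDiffAt_chart hφ h0).mdifferentiableAt (by simp)) hy
  rw [mfderiv_eq_fderiv] at h
  exact h.symm

/-- The derivative of a chart, as an endomorphism of `ℝ²ᵐ`. -/
def chartDeriv (φ : OpenPartialHomeomorph M (E m)) (x : M) : E m →L[ℝ] E m :=
  mfderiv 𝓘(ℝ, E m) 𝓘(ℝ, E m) φ x

/-- The derivative of the inverse of a chart, as an endomorphism of `ℝ²ᵐ`. -/
def chartSymmDeriv (φ : OpenPartialHomeomorph M (E m)) (y : E m) : E m →L[ℝ] E m :=
  mfderiv 𝓘(ℝ, E m) 𝓘(ℝ, E m) φ.symm y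

theorem frameMat_eq (A : HomTM m M) :
    frameMat φ A = (chartDeriv φ A.proj).comp (show E m →L[ℝ] E m from A.snd) := rfl

theorem chartSymmDeriv_chartDeriv (hφ : φ ∈ IsManifold.maximalAtlas 𝓘(ℝ, E m) ∞ M) {x : M}
    (hx : x ∈ φ.source) (u : E m) : chartSymmDeriv φ (φ x) (chartDeriv φ x u) = u := by
  have h1 := mfderiv_comp (I := 𝓘(ℝ, E m)) (I' := 𝓘(ℝ, E m)) (I'' := 𝓘(ℝ, E m)) x
    ((contMDiffAt_chart_symm hφ (φ.map_source hx)).mdifferentiableAt (by simp))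
    ((contMDiffAt_chart hφ hx).mdifferentiableAt (by simp))
  have h2 : φ.symm ∘ φ =ᶠ[𝓝 x] id := by
    filter_upwards [φ.open_source.mem_nhds hx] with w hw using φ.left_inv hw
  rw [h2.mfderiv_eq, mfderiv_id] at h1
  exact (congrArg (fun L : E m →L[ℝ] E m => L u) h1).symm

theorem chartDeriv_transition {ψ : OpenPartialHomeomorph M (E m)}
    (hφ : φ ∈ IsManifold.maximalAtlas 𝓘(ℝ, E m) ∞ M)
    (hψ : ψ ∈ IsManifold.maximalAtlas 𝓘(ℝ, E m) ∞ M) {x : M} (hx : x ∈ φ.source)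
    (hx' : x ∈ ψ.source) :
    chartDeriv φ x = (fderiv ℝ (fun y => φ (ψ.symm y)) (ψ x)).comp (chartDeriv ψ x) := by
  have h3 : (fun y => φ (ψ.symm y)) ∘ ψ =ᶠ[𝓝 x] φ := by
    filter_upwards [ψ.open_source.mem_nhds hx'] with w hw
    change φ (ψ.symm (ψ w)) = φ w
    rw [ψ.left_inv hw]
  have h4 : ContDiffAt ℝ ∞ (fun y => φ (ψ.symm y)) (ψ x) :=
    contDiffAt_transition hψ hφ (ψ.map_source hx') (by rwa [ψ.left_inv hx'])
  have h5 := mfderiv_comp (I := 𝓘(ℝ, E m)) (I' := 𝓘(ℝ, E m)) (I'' := 𝓘(ℝ, E m)) x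
    (h4.contMDiffAt.mdifferentiableAt (by simp))
    ((contMDiffAt_chart hψ hx').mdifferentiableAt (by simp))
  rw [mfderiv_eq_fderiv] at h5
  exact (h3.mfderiv_eq (I := 𝓘(ℝ, E m)) (I' := 𝓘(ℝ, E m))).symm.trans h5

/-- Frames with the same coordinates in a chart are equal. -/
theorem frame_ext (hφ : φ ∈ IsManifold.maximalAtlas 𝓘(ℝ, E m) ∞ M) {A B : HomTM m M}
    (hA : A.proj ∈ φ.source) (hB : B.proj ∈ φ.source) (h1 : φ A.proj = φ B.proj)
    (h2 : frameMat φ A = frameMat φ B) : A = B := by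
  obtain ⟨x, A⟩ := A
  obtain ⟨y, B⟩ := B
  obtain rfl : x = y := φ.injOn hA hB h1
  refine homTM_ext rfl (ContinuousLinearMap.ext fun v => ?_)
  have h3 : chartDeriv φ x (show E m from A v) = chartDeriv φ x (show E m from B v) :=
    congrArg (fun L : E m →L[ℝ] E m => L v) h2
  have h4 := congrArg (chartSymmDeriv φ (φ x)) h3
  rwa [chartSymmDeriv_chartDeriv hφ hA, chartSymmDeriv_chartDeriv hφ hA] at h4

/-- The affine germ `z ↦ φ⁻¹ (a + g z)`. -/
def affineGerm (φ : OpenPartialHomeomorph M (E m)) (a : E m) (g : E m →L[ℝ] E m) (z : E m) : M :=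
  φ.symm (a + g z)

theorem goodAt_affineGerm (hφ : IsDarboux σ φ) {a : P → E m} {g : P → E m →L[ℝ] E m} {p₀ : P}
    {z₀ : E m} (ha : Continuous a) (hg : Continuous g) (hgs : ∀ p, IsSymplectic (g p))
    (hp : a p₀ + g p₀ z₀ ∈ φ.target) : GoodAt σ (fun p => affineGerm φ (a p) (g p)) p₀ z₀ := by
  have hc : Continuous fun q : P × E m => a q.1 + g q.1 q.2 :=
    (ha.comp continuous_fst).add ((hg.comp continuous_fst).clm_apply continuous_snd)
  have hΩ : IsOpen {q : P × E m | a q.1 + g q.1 q.2 ∈ φ.target} := φ.open_target.preimage hc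
  have he : ∀ q ∈ {q : P × E m | a q.1 + g q.1 q.2 ∈ φ.target},
      φ (affineGerm φ (a q.1) (g q.1) q.2) = a q.1 + g q.1 q.2 := fun q hq => φ.right_inv hq
  refine ⟨φ, hφ, _, hΩ, hp, fun q hq => φ.map_target hq, fun k => ?_, fun q hq => ?_⟩
  · refine FamC.congr (F := fun p z => a p + g p z) ?_ hΩ he
    exact FamC.of_contDiffAt (V := E m × (E m →L[ℝ] E m)) (f := fun v z => v.1 + v.2 z)
      (a := fun p => (a p, g p)) hΩ (by fun_prop)
      fun q hq => by
        have : ContDiff ℝ k fun w : (E m × (E m →L[ℝ] E m)) × E m => w.1.1 + w.1.2 w.2 :=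
          (contDiff_fst.comp contDiff_fst).add
            ((contDiff_snd.comp contDiff_fst).clm_apply contDiff_snd)
        exact this.contDiffAt
  · have h1 : (fun z => φ (affineGerm φ (a q.1) (g q.1) z)) =ᶠ[𝓝 q.2]
        fun z => a q.1 + g q.1 z := by
      filter_upwards [slice_mem_nhds hΩ hq] with z hz using he (q.1, z) hz
    rw [h1.fderiv_eq, ((g q.1).hasFDerivAt.const_add (a q.1)).fderiv]
    exact hgs q.1

variable (σ) in
/-- The space of symplectic frames at single points of `M`. -/
def Fr : Type _ := {A : HomTM m M // ∀ u v : E m, σ.form A.proj ![A.snd u, A.snd v] = stdForm u v}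

instance : TopologicalSpace (Fr σ) := inferInstanceAs (TopologicalSpace (Subtype _))

theorem Fr.isSymplectic_frameMat (hφ : IsDarboux σ φ) (A : Fr σ) (hA : A.1.proj ∈ φ.source) :
    IsSymplectic (frameMat φ A.1) := fun u v => by
  have h1 := hφ.2 (φ A.1.proj) (φ.map_source hA) (frameMat φ A.1 u) (frameMat φ A.1 v)
  have h2 : ∀ w, mfderiv 𝓘(ℝ, E m) 𝓘(ℝ, E m) φ.symm (φ A.1.proj) (frameMat φ A.1 w) = A.1.snd w :=
    fun w => chartSymmDeriv_chartDeriv hφ.1 hA (A.1.snd w)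
  rw [h2, h2] at h1
  rw [← h1, ← A.2 u v]
  exact form_congr σ (φ.left_inv hA) (A.1.snd u) (A.1.snd v)

theorem continuousAt_frameMat (hφ : φ ∈ IsManifold.maximalAtlas 𝓘(ℝ, E m) ∞ M) {A : HomTM m M}
    (hA : A.proj ∈ φ.source) : ContinuousAt (frameMat φ) A := by
  have hproj : Continuous (fun B : HomTM m M => B.proj) := FiberBundle.continuous_proj _ _
  set ψ := chartAt (E m) A.proj with hψ
  have hψ' : ψ ∈ IsManifold.maximalAtlas 𝓘(ℝ, E m) ∞ M :=
    mem_maximalAtlas_of_mem_atlas (chart_mem_atlas _ _)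
  have hAψ : A.proj ∈ ψ.source := mem_chart_source _ _
  -- the trivialisation of the bundle is the matrix in the chart `ψ`
  have h1 : ContinuousAt (frameMat ψ) A := by
    have h2 := ((continuousAt_hom_bundle (f := fun B : HomTM m M => B)).1
      (continuousAt_id (x := A))).2
    refine h2.congr ?_
    filter_upwards [hproj.continuousAt.eventually (ψ.open_source.mem_nhds hAψ)] with B hB
    have h4 := TangentBundle.continuousLinearMapAt_trivializationAt (I := 𝓘(ℝ, E m)) hB
    change ((trivializationAt (E m) (TangentSpace 𝓘(ℝ, E m)) A.proj).continuousLinearMapAt ℝ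
      B.proj).comp (B.snd.comp
      ((Bundle.Trivial.trivialization M (E m)).symmL ℝ B.proj)) = _
    rw [Bundle.Trivial.symmL_trivialization, h4]
    rfl
  have h2 : ContinuousAt (fun B : HomTM m M =>
      fderiv ℝ (fun y => φ (ψ.symm y)) (ψ B.proj)) A := by
    have h3 : ContDiffAt ℝ ∞ (fun y => φ (ψ.symm y)) (ψ A.proj) :=
      contDiffAt_transition hψ' hφ (ψ.map_source hAψ) (by rwa [ψ.left_inv hAψ])
    have h4 : ContinuousAt (fderiv ℝ (fun y => φ (ψ.symm y))) (ψ A.proj) :=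
      (h3.fderiv_right (m := 0) (by simp)).continuousAt
    exact ContinuousAt.comp (f := fun B : HomTM m M => ψ B.proj) h4
      ((ψ.continuousAt hAψ).comp (f := fun B : HomTM m M => B.proj) hproj.continuousAt)
  refine (h2.clm_comp h1).congr ?_
  filter_upwards [hproj.continuousAt.eventually (ψ.open_source.mem_nhds hAψ),
    hproj.continuousAt.eventually (φ.open_source.mem_nhds hA)] with B hB hB'
  change (fderiv ℝ (fun y => φ (ψ.symm y)) (ψ B.proj)).comp (frameMat ψ B) = frameMat φ B
  rw [frameMat_eq, frameMat_eq, chartDeriv_transition hφ hψ' hB' hB,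
    ContinuousLinearMap.comp_assoc]

theorem Fr.continuous_proj : Continuous fun A : Fr σ => A.1.proj :=
  (FiberBundle.continuous_proj _ _).comp continuous_subtype_val

theorem frameOf_affineGerm (hφ : IsDarboux σ φ) (A : Fr σ) (hA : A.1.proj ∈ φ.source) :
    frameOf (affineGerm φ (φ A.1.proj) (frameMat φ A.1)) = A.1 := by
  have h0 : affineGerm φ (φ A.1.proj) (frameMat φ A.1) 0 = A.1.proj := by
    simp [affineGerm, φ.left_inv hA]
  have hgood : GoodAt σ (fun _ : Unit => affineGerm φ (φ A.1.proj) (frameMat φ A.1)) () 0 :=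
    goodAt_affineGerm hφ continuous_const continuous_const
      (fun _ => Fr.isSymplectic_frameMat hφ A hA) (by simpa using φ.map_source hA)
  refine frame_ext hφ.1 (by rw [frameOf, h0]; exact hA) hA (by rw [frameOf, h0]) ?_
  rw [frameMat_frameOf hφ.1 (hgood.contMDiffAt.mdifferentiableAt (by simp)) (by rwa [h0])]
  have h1 : (fun z => φ (affineGerm φ (φ A.1.proj) (frameMat φ A.1) z)) =ᶠ[𝓝 0]
      fun z => φ A.1.proj + frameMat φ A.1 z := by
    have hc : Continuous fun z => φ A.1.proj + frameMat φ A.1 z := by fun_prop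
    filter_upwards [hc.continuousAt.eventually (φ.open_target.mem_nhds
      (by simpa using φ.map_source hA))] with z hz using φ.right_inv hz
  rw [h1.fderiv_eq, ((frameMat φ A.1).hasFDerivAt.const_add _).fderiv]

/-- The germs of symplectic maps at the origin. -/
def IsGerm (σ : SymplecticForm m M) (y : E m → M) : Prop := GoodAt σ (fun _ : Unit => y) () 0

theorem GoodAt.isGerm {Y : P → E m → M} {p : P} (h : GoodAt σ Y p 0) : IsGerm σ (Y p) :=
  GoodAt.comap (a := fun _ : Unit => p) h continuous_const

theorem IsGerm.goodAt {y : E m → M} (h : IsGerm σ y) (p : P) : GoodAt σ (fun _ : P => y) p 0 :=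
  GoodAt.comap (a := fun _ : P => ()) h continuous_const

theorem IsGerm.frameMat_eq {y : E m → M} (h : IsGerm σ y)
    (hφ : φ ∈ IsManifold.maximalAtlas 𝓘(ℝ, E m) ∞ M) (h0 : y 0 ∈ φ.source) :
    frameMat φ (frameOf y) = fderiv ℝ (fun z => φ (y z)) 0 :=
  frameMat_frameOf hφ ((GoodAt.contMDiffAt h).mdifferentiableAt (by simp)) h0

end SymplecticBalls
end
noncomputable section
namespace SymplecticBalls


universe u

variable {m n : ℕ} {M : Type u} [TopologicalSpace M] [ChartedSpace (E m) M]
  [IsManifold 𝓘(ℝ, E m) ∞ M] {σ : SymplecticForm m M} {φ : OpenPartialHomeomorph M (E m)}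

/-! ### Darboux balls and their cutoff functions -/

variable (σ) in
/-- A ball of radius `ρ` in a Darboux chart whose image contains the ball of radius `3 ρ`. -/
structure DarbouxBall where
  /-- the Darboux chart -/
  chart : OpenPartialHomeomorph M (E m)
  darboux : IsDarboux σ chart
  /-- the centre of the ball, in the chart -/
  center : E m
  /-- the radius of the ball -/
  radius : ℝ
  radius_pos : 0 < radius
  subset : Metric.closedBall center (3 * radius) ⊆ chart.target

namespace DarbouxBall

variable (b : DarbouxBall σ)

/-- The ball of radius `ρ`, an open subset of `M`. -/
def core : Set M := b.chart.source ∩ b.chart ⁻¹' Metric.ball b.center b.radius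

/-- The closed ball of radius `2 ρ`, a subset of `M`. -/
def supp : Set M := b.chart.source ∩ b.chart ⁻¹' Metric.closedBall b.center (2 * b.radius)

/-- The cutoff function in the chart: `1` on the ball of radius `ρ`, `0` outside of the ball of
radius `2 ρ`, and linear in the radius in between. -/
def bump (y : E m) : ℝ := max 0 (min 1 (2 - ‖y - b.center‖ / b.radius))

open Classical in
/-- The cutoff function of a Darboux ball. -/
def cutoff (x : M) : ℝ := if x ∈ b.chart.source then b.bump (b.chart x) else 0

theorem bump_nonneg (y : E m) : 0 ≤ b.bump y := le_max_left _ _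

theorem bump_le_one (y : E m) : b.bump y ≤ 1 := max_le zero_le_one (min_le_left _ _)

theorem continuous_bump : Continuous b.bump := by unfold bump; fun_prop

theorem bump_eq_one {y : E m} (hy : y ∈ Metric.closedBall b.center b.radius) : b.bump y = 1 := by
  have h1 : ‖y - b.center‖ / b.radius ≤ 1 := by
    rw [div_le_one b.radius_pos, ← dist_eq_norm]; exact hy
  rw [bump, min_eq_left (by linarith), max_eq_right zero_le_one]

theorem bump_eq_zero {y : E m} (hy : y ∉ Metric.ball b.center (2 * b.radius)) : b.bump y = 0 := by
  have h1 : 2 ≤ ‖y - b.center‖ / b.radius := by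
    rw [le_div_iff₀ b.radius_pos, ← dist_eq_norm]; simpa using hy
  exact max_eq_left ((min_le_right _ _).trans (by linarith))

theorem abs_bump_sub_le (y y' : E m) : |b.bump y - b.bump y'| ≤ ‖y - y'‖ / b.radius := by
  have h1 : |‖y - b.center‖ - ‖y' - b.center‖| ≤ ‖y - y'‖ := by
    simpa using abs_norm_sub_norm_le (y - b.center) (y' - b.center)
  refine (abs_max_sub_max_le_max _ _ _ _).trans (max_le (by
    have := b.radius_pos; simp; positivity) ?_)
  refine (abs_min_sub_min_le_max _ _ _ _).trans (max_le (by
    have := b.radius_pos; simp; positivity) ?_)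
  rw [sub_sub_sub_cancel_left, ← sub_div, abs_div, abs_of_pos b.radius_pos, abs_sub_comm]
  have := b.radius_pos
  gcongr

theorem cutoff_of_mem {x : M} (hx : x ∈ b.chart.source) : b.cutoff x = b.bump (b.chart x) :=
  if_pos hx

theorem cutoff_nonneg (x : M) : 0 ≤ b.cutoff x := by
  unfold cutoff; split_ifs
  exacts [b.bump_nonneg _, le_rfl]

theorem cutoff_le_one (x : M) : b.cutoff x ≤ 1 := by
  unfold cutoff; split_ifs
  exacts [b.bump_le_one _, zero_le_one]

theorem cutoff_eq_one {x : M} (hx : x ∈ b.core) : b.cutoff x = 1 := by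
  rw [b.cutoff_of_mem hx.1, b.bump_eq_one (Metric.ball_subset_closedBall hx.2)]

theorem cutoff_eq_zero {x : M} (hx : x ∉ b.supp) : b.cutoff x = 0 := by
  unfold cutoff
  split_ifs with h
  · exact b.bump_eq_zero fun h' => hx ⟨h, Metric.ball_subset_closedBall h'⟩
  · rfl

theorem core_subset_supp : b.core ⊆ b.supp := fun _ hx =>
  ⟨hx.1, Metric.closedBall_subset_closedBall (by have := b.radius_pos; linarith)
    (Metric.ball_subset_closedBall hx.2)⟩

theorem isOpen_core : IsOpen b.core :=
  b.chart.isOpen_inter_preimage Metric.isOpen_ball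

theorem closedBall_two_subset : Metric.closedBall b.center (2 * b.radius) ⊆ b.chart.target :=
  (Metric.closedBall_subset_closedBall (by have := b.radius_pos; linarith)).trans b.subset

theorem supp_eq_image : b.supp = b.chart.symm '' Metric.closedBall b.center (2 * b.radius) := by
  ext x
  constructor
  · rintro ⟨h1, h2⟩
    exact ⟨b.chart x, h2, b.chart.left_inv h1⟩
  · rintro ⟨y, hy, rfl⟩
    have hyt := b.closedBall_two_subset hy
    exact ⟨b.chart.map_target hyt, by rw [mem_preimage, b.chart.right_inv hyt]; exact hy⟩

theorem isCompact_supp : IsCompact b.supp := by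
  rw [supp_eq_image]
  exact (isCompact_closedBall _ _).image_of_continuousOn
    (b.chart.continuousOn_symm.mono b.closedBall_two_subset)

theorem isClosed_supp [T2Space M] : IsClosed b.supp := b.isCompact_supp.isClosed

theorem continuous_cutoff [T2Space M] : Continuous b.cutoff := by
  refine continuous_iff_continuousAt.2 fun x => ?_
  by_cases hx : x ∈ b.chart.source
  · have h1 : ContinuousAt (fun x => b.bump (b.chart x)) x :=
      b.continuous_bump.continuousAt.comp (b.chart.continuousAt hx)
    refine h1.congr ?_
    filter_upwards [b.chart.open_source.mem_nhds hx] with w hw using (b.cutoff_of_mem hw).symm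
  · refine (continuousAt_const (y := (0 : ℝ))).congr ?_
    filter_upwards [b.isClosed_supp.isOpen_compl.mem_nhds fun h : x ∈ b.supp => hx h.1] with w hw
    exact (b.cutoff_eq_zero hw).symm

end DarbouxBall

theorem exists_darbouxBall {x : M} (h : ∃ φ, IsDarboux σ φ ∧ x ∈ φ.source) :
    ∃ b : DarbouxBall σ, x ∈ b.core := by
  obtain ⟨φ, hφ, hx⟩ := h
  obtain ⟨r, hr, hrs⟩ := Metric.nhds_basis_closedBall.mem_iff.1
    (φ.open_target.mem_nhds (φ.map_source hx))
  refine ⟨⟨φ, hφ, φ x, r / 3, by positivity, ?_⟩, hx, Metric.mem_ball_self (by positivity)⟩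
  rwa [mul_div_cancel₀ _ (by norm_num : (3 : ℝ) ≠ 0)]

/-- A compact symplectic manifold is covered by the cores of finitely many Darboux balls. -/
theorem exists_darbouxBall_cover [CompactSpace M] (hD : ∀ x : M, ∃ φ, IsDarboux σ φ ∧ x ∈ φ.source) :
    ∃ l : List (DarbouxBall σ), ∀ x : M, ∃ b ∈ l, x ∈ b.core := by
  choose b hb using fun x => exists_darbouxBall (hD x)
  obtain ⟨t, ht⟩ := isCompact_univ.elim_finite_subcover (fun x => (b x).core)
    (fun x => (b x).isOpen_core) fun x _ => mem_iUnion.2 ⟨x, hb x⟩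
  refine ⟨t.toList.map b, fun x => ?_⟩
  obtain ⟨y, hy, hxy⟩ := mem_iUnion₂.1 (ht (mem_univ x))
  exact ⟨b y, by simpa using ⟨y, hy, rfl⟩, hxy⟩

/-! ### Modifying germs inside of a Darboux chart -/

section Modify

variable {P : Type*} [TopologicalSpace P]

open Classical in
/-- Replace the map `Y p` by `φ⁻¹ ∘ Z p` if its centre lies in `S`. -/
def modify (φ : OpenPartialHomeomorph M (E m)) (S : Set M) (Z : E m → E m) (y : E m → M) (z : E m) :
    M := if y 0 ∈ S then φ.symm (Z z) else y z

theorem modify_of_mem {S : Set M} {y : E m → M} (h : y 0 ∈ S) (Z : E m → E m) :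
    modify φ S Z y = fun z => φ.symm (Z z) := by
  funext z; exact if_pos h

theorem modify_of_notMem {S : Set M} {y : E m → M} (h : y 0 ∉ S) (Z : E m → E m) :
    modify φ S Z y = y := by
  funext z; exact if_neg h

theorem GoodAt.modify {S : Set M} (hS : IsClosed S) (hSφ : S ⊆ φ.source) (hφ : IsDarboux σ φ)
    {Y : P → E m → M} {Z : P → E m → E m} {p₀ : P} (hY : GoodAt σ Y p₀ 0)
    (hZ : Y p₀ 0 ∈ φ.source → ∃ Ω, IsOpen Ω ∧ (p₀, (0 : E m)) ∈ Ω ∧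
      (∀ q ∈ Ω, Z q.1 q.2 ∈ φ.target) ∧ (∀ k, FamC k Z Ω) ∧
      (∀ q ∈ Ω, IsSymplectic (fderiv ℝ (Z q.1) q.2)) ∧
      ∀ q ∈ Ω, Y q.1 0 ∉ S → Z q.1 q.2 = φ (Y q.1 q.2)) :
    GoodAt σ (fun p => modify φ S (Z p) (Y p)) p₀ 0 := by
  have hY0 : ContinuousAt (fun q : P × E m => Y q.1 0) (p₀, 0) :=
    ContinuousAt.comp (g := fun q : P × E m => Y q.1 q.2)
      (f := fun q : P × E m => (q.1, (0 : E m))) (x := (p₀, (0 : E m))) hY.continuousAt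
      (continuousAt_fst.prodMk continuousAt_const)
  by_cases h0 : Y p₀ 0 ∈ S
  · obtain ⟨Ω, hΩ, hmem, ht, hfam, hsym, hoff⟩ := hZ (hSφ h0)
    have hright : ∀ q ∈ Ω, φ (φ.symm (Z q.1 q.2)) = Z q.1 q.2 := fun q hq => φ.right_inv (ht q hq)
    have h1 : GoodAt σ (fun p z => φ.symm (Z p z)) p₀ 0 := by
      refine ⟨φ, hφ, Ω, hΩ, hmem, fun q hq => φ.map_target (ht q hq),
        fun k => (hfam k).congr hΩ hright, fun q hq => ?_⟩
      have h2 : (fun z => φ (φ.symm (Z q.1 z))) =ᶠ[𝓝 q.2] Z q.1 := by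
        filter_upwards [slice_mem_nhds hΩ hq] with z hz using hright (q.1, z) hz
      rw [h2.fderiv_eq]
      exact hsym q hq
    refine h1.congr ?_
    filter_upwards [hΩ.mem_nhds hmem,
      hY.continuousAt.eventually (φ.open_source.mem_nhds (hSφ h0))] with q hq hq'
    by_cases hqS : Y q.1 0 ∈ S
    · rw [modify_of_mem hqS]
    · rw [modify_of_notMem hqS, hoff q hq hqS, φ.left_inv hq']
  · refine hY.congr ?_
    filter_upwards [hY0.eventually (hS.isOpen_compl.mem_nhds h0)] with q hq
    rw [modify_of_notMem hq]

end Modify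

/-! ### Straightening germs -/

/-- The rescaling of germs in a Darboux ball, from the identity at time `0` to the map that, over the
core of the ball, replaces a germ by its affine approximation in the chart at time `1`. -/
def rescale (b : DarbouxBall σ) (t : unitInterval) (y : E m → M) : E m → M :=
  modify b.chart b.supp
    (alexander (1 - t * b.cutoff (y 0)) (fun z => b.chart (y z))) y

/-- A family of operations `Op t`, `t ∈ [0, 1]`, on germs of symplectic maps, starting at the
identity, preserving frames, and such that `Op 1 y` only depends on the frame of `y` if the centre
of `y` lies in `B`. -/
structure IsStraightening (σ : SymplecticForm m M) (B : Set M)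
    (Op : unitInterval → (E m → M) → E m → M) : Prop where
  goodAt : ∀ {P : Type u} [TopologicalSpace P] (Y : P → E m → M) (t : C(P, unitInterval)) (p : P),
    GoodAt σ Y p 0 → GoodAt σ (fun p => Op (t p) (Y p)) p 0
  zero : ∀ y, IsGerm σ y → Op 0 y =ᶠ[𝓝 0] y
  frame : ∀ t y, IsGerm σ y → frameOf (Op t y) = frameOf y
  germ : ∀ t y y', IsGerm σ y → y =ᶠ[𝓝 0] y' → Op t y =ᶠ[𝓝 0] Op t y'
  straight : ∀ y y', IsGerm σ y → IsGerm σ y' → frameOf y = frameOf y' → (y 0 ∈ B ∨ y = y') →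
    Op 1 y = Op 1 y'

theorem abs_one_sub_le {t : unitInterval} {a : ℝ} (h0 : 0 ≤ a) (h1 : a ≤ 1) : |1 - t * a| ≤ 1 := by
  have := t.2.1; have := t.2.2
  rw [abs_le]; constructor <;> nlinarith

/-- The rescaling in a Darboux ball is a straightening over its core: it is cut off in terms of the
base point of the germ, so that it is good also at the boundary of the ball, and the affine
approximation that it leads to is determined by the frame. -/
theorem isStraightening_rescale [T2Space M] (b : DarbouxBall σ) :
    IsStraightening σ b.core (rescale b) := by
  have hsub : b.supp ⊆ b.chart.source := fun x hx => hx.1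
  have hgood : ∀ {P : Type u} [TopologicalSpace P] (Y : P → E m → M) (t : C(P, unitInterval)) (p : P),
      GoodAt σ Y p 0 → GoodAt σ (fun p => rescale b (t p) (Y p)) p 0 := by
    intro P _ Y t p hY
    refine GoodAt.modify b.isClosed_supp hsub b.darboux hY fun hp => ?_
    obtain ⟨Ω, hΩ, hmem, hg⟩ := hY.exists_goodOn b.darboux hp
    obtain ⟨N, V, hN, hV, hpN, h0V, hNV⟩ := isOpen_prod_iff.1 hΩ p 0 hmem
    obtain ⟨r, hr, hrV⟩ := Metric.isOpen_iff.1 hV 0 h0V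
    have hsubΩ : N ×ˢ Metric.ball (0 : E m) r ⊆ Ω := fun q hq => hNV ⟨hq.1, hrV hq.2⟩
    have hY0 : ContinuousOn (fun p => Y p 0) N :=
      hg.continuousOn.comp (f := fun p : P => (p, (0 : E m)))
        (by fun_prop) fun p hp => hNV ⟨hp, h0V⟩
    have hτ : ContinuousOn (fun p => 1 - (t p : ℝ) * b.cutoff (Y p 0)) N :=
      continuousOn_const.sub ((by fun_prop : Continuous fun p => (t p : ℝ)).continuousOn.mul
        (b.continuous_cutoff.comp_continuousOn hY0))
    have hτ1 : ∀ p ∈ N, |1 - (t p : ℝ) * b.cutoff (Y p 0)| ≤ 1 := fun p _ =>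
      abs_one_sub_le (b.cutoff_nonneg _) (b.cutoff_le_one _)
    have hfam := fun k => FamC.alexander hN (fun k => (hg.2.1 k).mono hsubΩ) hτ hτ1 k
    have hopen : IsOpen (N ×ˢ Metric.ball (0 : E m) r) := hN.prod Metric.isOpen_ball
    have hΩ' := (hfam 0).continuousOn.isOpen_inter_preimage hopen b.chart.open_target
    refine ⟨_, hΩ', ⟨⟨hpN, Metric.mem_ball_self hr⟩, ?_⟩, fun q hq => hq.2,
      fun k => (hfam k).mono inter_subset_left, fun q hq => ?_, fun q hq hqS => ?_⟩
    · simp only [mem_preimage, alexander_apply_zero]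
      exact b.chart.map_source hp
    · have hmem' := hsubΩ (⟨hq.1.1, smul_mem_ball_zero (hτ1 _ hq.1.1) hq.1.2⟩ :
        (q.1, (1 - (t q.1 : ℝ) * b.cutoff (Y q.1 0)) • q.2) ∈ N ×ˢ Metric.ball (0 : E m) r)
      rw [(hasFDerivAt_alexander (((hg.2.1 1).1 _ hmem').differentiableAt (by simp))).fderiv]
      exact hg.2.2 _ hmem'
    · rw [b.cutoff_eq_zero hqS, mul_zero, sub_zero, alexander_one]
  have hbase : ∀ t y, IsGerm σ y → rescale b t y 0 = y 0 := by
    intro t y hy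
    by_cases h0 : y 0 ∈ b.supp
    · rw [rescale, modify_of_mem h0]
      change b.chart.symm (alexander _ _ 0) = y 0
      rw [alexander_apply_zero, b.chart.left_inv (hsub h0)]
    · rw [rescale, modify_of_notMem h0]
  refine ⟨hgood, fun y hy => ?_, fun t y hy => ?_, fun t y y' hy he => ?_, fun y y' hy hy' hf h => ?_⟩
  · by_cases h0 : y 0 ∈ b.supp
    · rw [rescale, modify_of_mem h0]
      filter_upwards [(GoodAt.contMDiffAt hy).continuousAt.eventually
        (b.chart.open_source.mem_nhds (hsub h0))] with z hz
      simp [b.chart.left_inv hz]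
    · rw [rescale, modify_of_notMem h0]
  · by_cases h0 : y 0 ∈ b.supp
    · have hg : IsGerm σ (rescale b t y) :=
        (hgood (P := PUnit) (fun _ => y) ⟨fun _ => t, continuous_const⟩ ⟨⟩ (hy.goodAt _)).isGerm
      have hb := hbase t y hy
      refine frame_ext b.darboux.1 (by rw [frameOf, hb]; exact hsub h0) (hsub h0)
        (by rw [frameOf, frameOf, hb]) ?_
      rw [hy.frameMat_eq b.darboux.1 (hsub h0),
        hg.frameMat_eq b.darboux.1 (by rw [hb]; exact hsub h0)]
      have hd : DifferentiableAt ℝ (fun z => b.chart (y z)) 0 :=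
        (contDiffAt_chart_comp b.darboux.1 (GoodAt.contMDiffAt hy)
          (hsub h0)).differentiableAt (by simp)
      have hda := hasFDerivAt_alexander (τ := 1 - t * b.cutoff (y 0))
        (h := fun z => b.chart (y z)) (z := 0) (by rwa [smul_zero])
      rw [smul_zero] at hda
      rw [← hda.fderiv]
      refine Filter.EventuallyEq.fderiv_eq ?_
      have h1 := hda.continuousAt.eventually (b.chart.open_target.mem_nhds (by
        rw [alexander_apply_zero]; exact b.chart.map_source (hsub h0)))
      filter_upwards [h1] with z hz
      rw [rescale, modify_of_mem h0, b.chart.right_inv hz]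
    · rw [rescale, modify_of_notMem h0]
  · have h0 : y 0 = y' 0 := he.eq_of_nhds
    by_cases hS : y 0 ∈ b.supp
    · rw [rescale, rescale, modify_of_mem hS, modify_of_mem (h0 ▸ hS), ← h0]
      have hτ : Filter.Tendsto (fun z : E m => (1 - (t : ℝ) * b.cutoff (y 0)) • z) (𝓝 0) (𝓝 0) :=
        (continuous_const_smul _).tendsto' _ _ (smul_zero _)
      have hd : (fun z => b.chart (y z)) =ᶠ[𝓝 0] fun z => b.chart (y' z) := by
        filter_upwards [he] with z hz; rw [hz]
      filter_upwards [hτ.eventually he] with z hz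
      have hz' : y ((1 - (t : ℝ) * b.cutoff (y 0)) • z) = y' ((1 - (t : ℝ) * b.cutoff (y 0)) • z) :=
        hz
      simp only [alexander, hd.fderiv_eq, h0] at hz' ⊢
      rw [hz']
    · rw [rescale, rescale, modify_of_notMem hS, modify_of_notMem (h0 ▸ hS)]
      exact he
  · rcases h with h | rfl
    · have hsrc := h.1
      have h0 : y 0 = y' 0 := congrArg (fun A : HomTM m M => A.proj) hf
      have hS := b.core_subset_supp h
      have h1 : fderiv ℝ (fun z => b.chart (y z)) 0 = fderiv ℝ (fun z => b.chart (y' z)) 0 := by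
        rw [← hy.frameMat_eq b.darboux.1 hsrc, hf,
          hy'.frameMat_eq b.darboux.1 (by rw [← h0]; exact hsrc)]
      rw [rescale, rescale, modify_of_mem hS, modify_of_mem (h0 ▸ hS), ← h0, b.cutoff_eq_one h]
      funext z
      simp [alexander_zero, h1, h0]
    · rfl

/-- The rescalings in several Darboux balls, performed one after the other, form a straightening over
the union of their cores: they preserve base points and frames, and germs that have become equal stay
equal. -/
theorem exists_straightening [T2Space M] (l : List (DarbouxBall σ)) :
    ∃ Op, IsStraightening σ {x | ∃ b ∈ l, x ∈ b.core} Op := by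
  induction l with
  | nil =>
    exact ⟨fun _ y => y, fun Y _ p h => h, fun _ _ => Filter.EventuallyEq.rfl, fun _ _ _ => rfl,
      fun _ _ _ _ h => h, fun y y' _ _ _ h => by simpa using h⟩
  | cons b l ih =>
    obtain ⟨Op, hOp⟩ := ih
    have hb := isStraightening_rescale b
    have hger : ∀ t y, IsGerm σ y → IsGerm σ (Op t y) := fun t y hy =>
      (hOp.goodAt (P := PUnit) (fun _ => y) ⟨fun _ => t, continuous_const⟩ ⟨⟩ (hy.goodAt _)).isGerm
    refine ⟨fun t y => rescale b t (Op t y), fun Y t p h => hb.goodAt _ t p (hOp.goodAt Y t p h),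
      fun y hy => (hb.zero _ (hger 0 y hy)).trans (hOp.zero y hy),
      fun t y hy => (hb.frame t _ (hger t y hy)).trans (hOp.frame t y hy),
      fun t y y' hy he => hb.germ t _ _ (hger t y hy) (hOp.germ t y y' hy he),
      fun y y' hy hy' hf h => ?_⟩
    have hf' : frameOf (Op 1 y) = frameOf (Op 1 y') := by
      rw [hOp.frame 1 y hy, hOp.frame 1 y' hy', hf]
    refine hb.straight _ _ (hger 1 y hy) (hger 1 y' hy') hf' ?_
    have h0 : Op 1 y 0 = y 0 := congrArg (fun A : HomTM m M => A.proj) (hOp.frame 1 y hy)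
    rcases h with ⟨b', hb', hx⟩ | rfl
    · rcases List.mem_cons.1 hb' with rfl | hb'
      · left; rw [h0]; exact hx
      · right; exact hOp.straight y y' hy hy' hf (Or.inl ⟨b', hb', hx⟩)
    · right; rfl

/-! ### A canonical germ with a given frame -/

theorem Fr.continuous_val : Continuous fun A : Fr σ => A.1 := continuous_subtype_val

/-- There is a straightening over all of `M`, together with a continuous choice of a germ with a
given frame, to which the straightening leads. -/
theorem exists_section [T2Space M] [CompactSpace M]
    (hD : ∀ x : M, ∃ φ, IsDarboux σ φ ∧ x ∈ φ.source) :
    ∃ (Op : unitInterval → (E m → M) → E m → M) (s : Fr σ → E m → M), IsStraightening σ univ Op ∧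
      (∀ A, GoodAt σ s A 0) ∧ (∀ A, frameOf (s A) = A.1) ∧
      ∀ A y, IsGerm σ y → frameOf y = A.1 → Op 1 y = s A := by
  obtain ⟨l, hl⟩ := exists_darbouxBall_cover hD
  obtain ⟨Op, hOp⟩ := exists_straightening l
  rw [show {x : M | ∃ b ∈ l, x ∈ b.core} = univ from eq_univ_of_forall hl] at hOp
  choose φ hφ hx using hD
  have hchart : ∀ (x : M) (A : Fr σ) (hA : A.1.proj ∈ (φ x).source),
      IsGerm σ (affineGerm (φ x) (φ x A.1.proj) (frameMat (φ x) A.1)) := fun x A hA =>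
    goodAt_affineGerm (hφ x) continuous_const continuous_const
      (fun _ => Fr.isSymplectic_frameMat (hφ x) A hA) (by simpa using (φ x).map_source hA)
  let y₀ : Fr σ → E m → M := fun A =>
    affineGerm (φ A.1.proj) (φ A.1.proj A.1.proj) (frameMat (φ A.1.proj) A.1)
  have hy₀ : ∀ A, IsGerm σ (y₀ A) := fun A => hchart _ A (hx _)
  have hfy₀ : ∀ A, frameOf (y₀ A) = A.1 := fun A => frameOf_affineGerm (hφ _) A (hx _)
  refine ⟨Op, fun A => Op 1 (y₀ A), hOp, fun A => ?_, fun A => (hOp.frame 1 _ (hy₀ A)).trans (hfy₀ A),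
    fun A y hy hf => hOp.straight _ _ hy (hy₀ A) (hf.trans (hfy₀ A).symm) (Or.inl (mem_univ _))⟩
  -- near `A`, the germs can be computed in a fixed chart
  set x := A.1.proj with hxA
  let U : Set (Fr σ) := {B | B.1.proj ∈ (φ x).source}
  have hU : IsOpen U := (φ x).open_source.preimage Fr.continuous_proj
  have ha : Continuous fun B : ↥U => φ x B.1.1.proj :=
    (φ x).continuousOn.comp_continuous (Fr.continuous_proj.comp continuous_subtype_val)
      fun B => B.2
  have hg : Continuous fun B : U => frameMat (φ x) B.1.1 := by
    refine continuous_iff_continuousAt.2 fun B => ?_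
    exact (continuousAt_frameMat (hφ x).1 B.2).comp (f := fun B : U => B.1.1)
      (Fr.continuous_val.comp continuous_subtype_val).continuousAt
  let AU : U := ⟨A, hx x⟩
  have h1 : GoodAt σ (fun B : U => affineGerm (φ x) (φ x B.1.1.proj) (frameMat (φ x) B.1.1)) AU 0 :=
    goodAt_affineGerm (hφ x) ha hg (fun B => Fr.isSymplectic_frameMat (hφ x) B.1 B.2)
      (by simpa using (φ x).map_source (hx x))
  have h2 := hOp.goodAt _ ⟨fun _ => 1, continuous_const⟩ AU h1
  refine GoodAt.of_subtype hU (p₀ := AU) (h2.congr (Filter.Eventually.of_forall fun q => ?_))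
  exact congrFun (hOp.straight _ _ (hy₀ _) (hchart x q.1.1 q.1.2)
    ((hfy₀ _).trans (frameOf_affineGerm (hφ x) q.1.1 q.1.2).symm) (Or.inl (mem_univ _))) q.2

end SymplecticBalls
end
noncomputable section
namespace SymplecticBalls

universe u

variable {m n : ℕ} {M : Type u} [TopologicalSpace M] [ChartedSpace (E m) M]
  [IsManifold 𝓘(ℝ, E m) ∞ M] {σ : SymplecticForm m M}

/-! ### The limit of the spaces of embeddings -/

/-- The `i`-th frame of a tuple of frames. -/
def SpFr.fr (A : SpFr σ n) (i : Fin n) : Fr σ := ⟨A.1 i, A.2.2 i⟩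

theorem SpFr.continuous_fr (i : Fin n) : Continuous fun A : SpFr σ n => A.fr i :=
  Continuous.subtype_mk ((continuous_apply i).comp continuous_subtype_val) _

theorem Emb.extend_zero_injective {c : Cap n} (f : Emb σ c) :
    Function.Injective fun i => extend (f.1 i) 0 := (jc σ c f).2.1

theorem goodAt_emb_zero (hD : ∀ x : M, ∃ φ, IsDarboux σ φ ∧ x ∈ φ.source) {c : Cap n} (i : Fin n)
    (f : Emb σ c) : GoodAt σ (fun (f : Emb σ c) z => extend (f.1 i) z) f 0 :=
  goodAt_emb hD i f (Metric.mem_ball_self (Real.sqrt_pos.2 (div_pos (c.2 i) Real.pi_pos)))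

/-- A straightening deforms the direct limit of the spaces of embeddings. -/
theorem IsStraightening.exists_homotopy [T2Space M]
    (hD : ∀ x : M, ∃ φ, IsDarboux σ φ ∧ x ∈ φ.source) {B : Set M}
    {Op : unitInterval → (E m → M) → E m → M} (hOp : IsStraightening σ B Op) :
    ∃ H : C(EmbLim σ n, C(unitInterval, EmbLim σ n)), ∀ e y, Represents e y → ∀ t,
      Represents (H e t) fun i => Op t (y i) := by
  have key : ∀ c : Cap n, ∃ g : C(Emb σ c × unitInterval, EmbLim σ n), ∀ q,
      Represents (g q) fun i => Op q.2 (extend (q.1.1 i)) := by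
    intro c
    refine exists_continuous_germ
      (Y := fun i (q : Emb σ c × unitInterval) => Op q.2 (extend (q.1.1 i))) (fun q i => ?_)
      fun q => ?_
    · exact hOp.goodAt (fun q : Emb σ c × unitInterval => extend (q.1.1 i)) ⟨Prod.snd, continuous_snd⟩
        q ((goodAt_emb_zero hD i q.1).comap (a := Prod.fst) continuous_fst)
    · have h : ∀ i, Op q.2 (extend (q.1.1 i)) 0 = extend (q.1.1 i) 0 := fun i =>
        congrArg (fun A : HomTM m M => A.proj) (hOp.frame q.2 _ (goodAt_emb_zero hD i q.1).isGerm)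
      simp only [h]
      exact q.1.extend_zero_injective
  choose g hg using key
  have hcompat : ∀ (f : Σ c : Cap n, Emb σ c) y, Represents (Quotient.mk (embSetoid σ n) f) y → ∀ t,
      Represents (g f.1 (f.2, t)) fun i => Op t (y i) := by
    rintro ⟨c, f⟩ y ⟨f', he, hf'⟩ t
    refine (hg c (f, t)).congr fun i => hOp.germ t _ _ (goodAt_emb_zero hD i f).isGerm ?_
    obtain ⟨c', h1, h2, h⟩ := Quotient.exact he
    refine Filter.EventuallyEq.trans ?_ (hf' i)
    filter_upwards [ball_mem_nhds m (c'.2 i)] with z hz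
    have h3 := congrFun (congrFun (congrArg Subtype.val h) i) ⟨z, hz⟩
    rw [extend_of_mem _ (ball_mono m (h1 i) hz), extend_of_mem _ (ball_mono m (h2 i) hz)]
    exact h3
  refine ⟨⟨Quotient.lift (fun f : Σ c : Cap n, Emb σ c => (g f.1).curry f.2) fun f f' h => ?_,
    Continuous.quotient_lift (continuous_sigma fun c => (g c).curry.continuous) _⟩, fun e y he t => ?_⟩
  · ext t
    refine (hg f.1 (f.2, t)).unique (hcompat f' (fun i => extend (f.2.1 i)) ⟨f, ?_, fun i =>
      Filter.EventuallyEq.rfl⟩ t) fun i => Filter.EventuallyEq.rfl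
    exact (Quotient.sound h).symm
  · obtain ⟨f, rfl⟩ := Quotient.exists_rep e
    exact hcompat f y he t

/-- The canonical germs with given frames form a section of `j_∞`, and the straightening is a homotopy
from the identity to this section composed with `j_∞`. -/
theorem isWeakHomotopyEquiv_jInf [T2Space M] [CompactSpace M]
    (hD : ∀ x : M, ∃ φ, IsDarboux σ φ ∧ x ∈ φ.source) (n : ℕ) : IsWeakHomotopyEquiv (jInf σ n) := by
  obtain ⟨Op, s, hOp, hs, hfs, hst⟩ := exists_section hD
  have hs0 : ∀ A : Fr σ, s A 0 = A.1.proj := fun A =>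
    congrArg (fun A : HomTM m M => A.proj) (hfs A)
  obtain ⟨S, hS⟩ := exists_continuous_germ (P := SpFr σ n) (Y := fun i A => s (A.fr i))
    (fun A i => GoodAt.comap (hs _) (SpFr.continuous_fr i))
    (fun A => by simp only [hs0]; exact A.2.1)
  obtain ⟨H, hH⟩ := hOp.exists_homotopy (n := n) hD
  refine isWeakHomotopyEquiv_of_section (jInf σ n) S (fun A => ?_) ⟨⟨⟨fun q => H q.2 q.1, ?_⟩, ?_, ?_⟩⟩
  · exact Subtype.ext (funext fun i => (jInf_apply (hS A) i).trans (hfs _))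
  · exact (H.uncurry.continuous).comp continuous_swap
  · intro e
    obtain ⟨f, rfl⟩ := Quotient.exists_rep e
    have hf : Represents (Quotient.mk (embSetoid σ n) f) fun i => extend (f.2.1 i) :=
      ⟨f, rfl, fun _ => Filter.EventuallyEq.rfl⟩
    exact (hH _ _ hf 0).unique hf fun i => hOp.zero _ (goodAt_emb_zero hD i f.2).isGerm
  · intro e
    obtain ⟨f, rfl⟩ := Quotient.exists_rep e
    have hf : Represents (Quotient.mk (embSetoid σ n) f) fun i => extend (f.2.1 i) :=
      ⟨f, rfl, fun _ => Filter.EventuallyEq.rfl⟩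
    refine (hH _ _ hf 1).unique (hS _) fun i => ?_
    rw [hst (((jInf σ n) (Quotient.mk (embSetoid σ n) f)).fr i) _
      (goodAt_emb_zero hD i f.2).isGerm (jInf_apply hf i).symm]

end SymplecticBalls
end
noncomputable section
namespace SymplecticBalls

/-! ### Symplectic polar decomposition -/

section Polar

open scoped MatrixOrder Matrix.Norms.L2Operator Matrix
open Matrix

variable {m : ℕ}

/-- Endomorphisms of `ℝ²ᵐ` as matrices. -/
abbrev matCLM (m : ℕ) : Matrix (Fin m ⊕ Fin m) (Fin m ⊕ Fin m) ℝ ≃⋆ₐ[ℝ] (E m →L[ℝ] E m) :=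
  Matrix.toEuclideanCLM

theorem continuous_matCLM : Continuous (matCLM m) :=
  LinearMap.continuous_of_finiteDimensional (matCLM m).toAlgEquiv.toLinearMap

theorem continuous_matCLM_symm : Continuous (matCLM m).symm :=
  LinearMap.continuous_of_finiteDimensional (matCLM m).symm.toAlgEquiv.toLinearMap

theorem stdForm_eq_J (u v : E m) : stdForm u v = -(u.ofLp ⬝ᵥ J (Fin m) ℝ *ᵥ v.ofLp) := by
  simp only [stdForm, J, dotProduct, mulVec, Fintype.sum_sum_type, fromBlocks_apply₁₁,
    fromBlocks_apply₁₂, fromBlocks_apply₂₁, fromBlocks_apply₂₂, Matrix.zero_apply,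
    Matrix.neg_apply, Matrix.one_apply]
  simp [Finset.sum_sub_distrib]
  ring

theorem isSymplectic_matCLM_iff {A : Matrix (Fin m ⊕ Fin m) (Fin m ⊕ Fin m) ℝ} :
    IsSymplectic (matCLM m A) ↔ A ∈ symplecticGroup (Fin m) ℝ := by
  have h : ∀ u v : E m, stdForm (matCLM m A u) (matCLM m A v) =
      -(u.ofLp ⬝ᵥ (Aᵀ * J (Fin m) ℝ * A) *ᵥ v.ofLp) := fun u v => by
    rw [stdForm_eq_J, ofLp_toEuclideanCLM, ofLp_toEuclideanCLM, ← mulVec_mulVec, ← mulVec_mulVec,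
      dotProduct_mulVec _ Aᵀ, vecMul_transpose]
  rw [SymplecticGroup.mem_iff']
  constructor
  · intro hA
    ext i j
    have h1 := (h (EuclideanSpace.single i 1) (EuclideanSpace.single j 1)).symm.trans (hA _ _)
    rw [stdForm_eq_J] at h1
    simpa using h1
  · intro hA u v
    rw [h, hA, stdForm_eq_J]

/-- The positive square root `q` of `Aᵀ A` is symplectic if `A` is: `Jᵀ q⁻¹ J` is a positive square root
as well, hence equal to `q`. -/
theorem sqrt_mem_symplecticGroup {A : Matrix (Fin m ⊕ Fin m) (Fin m ⊕ Fin m) ℝ}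
    (hA : A ∈ symplecticGroup (Fin m) ℝ) :
    CFC.sqrt (Aᵀ * A) ∈ symplecticGroup (Fin m) ℝ := by
  set p := Aᵀ * A with hp
  have hpS : p ∈ symplecticGroup (Fin m) ℝ :=
    mul_mem (SymplecticGroup.transpose_mem hA) hA
  have hp0 : 0 ≤ p := by
    rw [nonneg_iff_posSemidef]; simpa using posSemidef_conjTranspose_mul_self A
  have hpd : IsUnit p.det := SymplecticGroup.symplectic_det hpS
  set q := CFC.sqrt p with hq
  have hqq : q * q = p := CFC.sqrt_mul_sqrt_self p
  have hq0 : q.PosSemidef := nonneg_iff_posSemidef.1 (CFC.sqrt_nonneg p)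
  have hqT : qᵀ = q := by simpa using hq0.isHermitian.eq
  have hpT : pᵀ = p := by rw [hp, transpose_mul, transpose_transpose]
  have hqd : IsUnit q.det := by
    rw [← hqq, det_mul] at hpd
    exact isUnit_of_mul_isUnit_left hpd
  -- `Jᵀ q⁻¹ J` is another positive square root of `p`
  set K := J (Fin m) ℝ with hK
  have hKT : Kᵀ = -K := J_transpose _ _
  have hKK : K * K = -1 := J_squared _ _
  have hpK : p * K * p = K := by
    have := SymplecticGroup.mem_iff'.1 hpS
    rwa [hpT] at this
  have h1 : Kᵀ * q⁻¹ * K = q := by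
    symm
    refine CFC.sqrt_unique ?_ ?_
    · have h2 : Kᵀ * q⁻¹ * K * (Kᵀ * q⁻¹ * K) = Kᵀ * p⁻¹ * K := by
        rw [← hqq, Matrix.mul_inv_rev, hKT]
        have : -K * q⁻¹ * K * (-K * q⁻¹ * K) = K * q⁻¹ * (K * K) * q⁻¹ * K := by noncomm_ring
        rw [this, hKK]; noncomm_ring
      rw [h2, hKT]
      have h3 : p⁻¹ * K = K * p :=
        calc p⁻¹ * K = p⁻¹ * (p * K * p) := by rw [hpK]
          _ = p⁻¹ * p * K * p := by simp only [mul_assoc]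
          _ = K * p := by rw [nonsing_inv_mul _ hpd, one_mul]
      rw [mul_assoc, h3, ← mul_assoc, neg_mul, hKK, neg_neg, one_mul]
    · rw [nonneg_iff_posSemidef]
      simpa using hq0.inv.conjTranspose_mul_mul_same K
  rw [SymplecticGroup.mem_iff', hqT]
  have h4 : q⁻¹ * K = K * q :=
    calc q⁻¹ * K = -(K * K) * (q⁻¹ * K) := by rw [hKK, neg_neg, one_mul]
      _ = K * (Kᵀ * q⁻¹ * K) := by rw [hKT]; noncomm_ring
      _ = K * q := by rw [h1]
  rw [mul_assoc, ← h4, ← mul_assoc, mul_nonsing_inv _ hqd, one_mul]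

/-- The positive part `√(gᵀ g)` of the polar decomposition of `g`. -/
def polarPart (g : E m →L[ℝ] E m) : E m →L[ℝ] E m :=
  matCLM m (CFC.sqrt (((matCLM m).symm g)ᵀ * (matCLM m).symm g))

theorem continuous_polarPart : Continuous (polarPart (m := m)) := by
  refine continuous_matCLM.comp (CFC.continuousOn_sqrt.comp_continuous ?_ fun g => ?_)
  · exact (continuous_matCLM_symm.matrix_transpose).mul continuous_matCLM_symm
  · rw [mem_ofPred_eq, nonneg_iff_posSemidef]
    simpa using posSemidef_conjTranspose_mul_self ((matCLM m).symm g)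

theorem isSymplectic_polarPart {g : E m →L[ℝ] E m} (hg : IsSymplectic g) :
    IsSymplectic (polarPart g) := by
  rw [polarPart, isSymplectic_matCLM_iff]
  refine sqrt_mem_symplecticGroup (isSymplectic_matCLM_iff.1 ?_)
  simpa using hg

theorem inner_polarPart_nonneg (g : E m →L[ℝ] E m) (u : E m) : 0 ≤ inner ℝ u (polarPart g u) := by
  rw [polarPart, inner_toEuclideanCLM]
  have h := nonneg_iff_posSemidef.1 (CFC.sqrt_nonneg (((matCLM m).symm g)ᵀ * (matCLM m).symm g))
  simpa using h.dotProduct_mulVec_nonneg u.ofLp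

theorem norm_polarPart (g : E m →L[ℝ] E m) (u : E m) : ‖polarPart g u‖ = ‖g u‖ := by
  set A := (matCLM m).symm g with hA
  have hgA : g = matCLM m A := by simp [hA]
  set q := CFC.sqrt (Aᵀ * A) with hq
  have hp0 : 0 ≤ Aᵀ * A := by
    rw [nonneg_iff_posSemidef]; simpa using posSemidef_conjTranspose_mul_self A
  have hqq : q * q = Aᵀ * A := CFC.sqrt_mul_sqrt_self _
  have hq0 : q.PosSemidef := nonneg_iff_posSemidef.1 (CFC.sqrt_nonneg _)
  have hqT : qᵀ = q := by simpa using hq0.isHermitian.eq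
  have key : ∀ B : Matrix (Fin m ⊕ Fin m) (Fin m ⊕ Fin m) ℝ,
      ‖matCLM m B u‖ ^ 2 = u.ofLp ⬝ᵥ (Bᵀ * B) *ᵥ u.ofLp := fun B => by
    rw [← real_inner_self_eq_norm_sq, EuclideanSpace.inner_eq_star_dotProduct, ofLp_toEuclideanCLM,
      star_trivial, ← mulVec_mulVec, dotProduct_mulVec _ Bᵀ, vecMul_transpose]
  have h : ‖polarPart g u‖ ^ 2 = ‖g u‖ ^ 2 := by
    rw [hgA, key, polarPart, ← hgA, ← hA, ← hq, key, hqT, hqq]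
  exact (sq_eq_sq₀ (norm_nonneg _) (norm_nonneg _)).1 h

end Polar

/-! ### Deforming symplectic maps to isometries -/

section Deform

variable {m : ℕ}

/-- The denominator of `polarPath`. -/
def polarDen (t : ℝ) (g : E m →L[ℝ] E m) : E m →L[ℝ] E m :=
  (1 + t) • polarPart g + (1 - t) • ContinuousLinearMap.id ℝ (E m)

/-- The path `((1 - t) q + (1 + t)) ((1 + t) q + (1 - t))⁻¹` from `1` to `q⁻¹`, where
`q = √(gᵀ g)`. It consists of symplectic maps if `g` is symplectic, since it is fixed by
`a ↦ J⁻¹ a⁻¹ J` as `q` is. -/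
def polarPath (t : ℝ) (g : E m →L[ℝ] E m) : E m →L[ℝ] E m :=
  ((1 - t) • polarPart g + (1 + t) • ContinuousLinearMap.id ℝ (E m)) * Ring.inverse (polarDen t g)

theorem isUnit_polarDen {t : ℝ} (h0 : 0 ≤ t) (h1 : t ≤ 1) {g : E m →L[ℝ] E m}
    (hg : IsSymplectic g) : IsUnit (polarDen t g) := by
  have hinj : Function.Injective (polarDen t g) := by
    refine (injective_iff_map_eq_zero _).2 fun u hu => ?_
    have h2 := inner_polarPart_nonneg g u
    have h3 : inner ℝ (polarPart g u) (polarDen t g u) = 0 := by rw [hu, inner_zero_right]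
    simp only [polarDen, _root_.add_apply, _root_.smul_apply, ContinuousLinearMap.id_apply,
      inner_add_right, inner_smul_right, real_inner_self_eq_norm_sq] at h3
    have h4 : ‖polarPart g u‖ ^ 2 ≤ 0 := by
      rw [real_inner_comm] at h2
      nlinarith [mul_nonneg h0 (sq_nonneg ‖polarPart g u‖), mul_nonneg (sub_nonneg.2 h1) h2]
    have h5 : polarPart g u = 0 := by
      rw [← norm_eq_zero]; nlinarith [norm_nonneg (polarPart g u)]
    exact (isSymplectic_polarPart hg).injective (by rw [h5, map_zero])
  exact ContinuousLinearMap.isUnit_iff_bijective.2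
    ⟨hinj, LinearMap.injective_iff_surjective.1 hinj⟩

theorem polarPath_polarDen {t : ℝ} (h0 : 0 ≤ t) (h1 : t ≤ 1) {g : E m →L[ℝ] E m}
    (hg : IsSymplectic g) (u : E m) :
    polarPath t g (polarDen t g u) = (1 - t) • polarPart g u + (1 + t) • u := by
  have h := Ring.inverse_mul_cancel _ (isUnit_polarDen h0 h1 hg)
  have h2 : Ring.inverse (polarDen t g) (polarDen t g u) = u :=
    congrArg (fun L : E m →L[ℝ] E m => L u) h
  simp [polarPath, h2]

theorem exists_polarDen {t : ℝ} (h0 : 0 ≤ t) (h1 : t ≤ 1) {g : E m →L[ℝ] E m}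
    (hg : IsSymplectic g) (u : E m) : ∃ v, polarDen t g v = u :=
  (ContinuousLinearMap.isUnit_iff_bijective.1 (isUnit_polarDen h0 h1 hg)).2 u

theorem isSymplectic_polarPath {t : ℝ} (h0 : 0 ≤ t) (h1 : t ≤ 1) {g : E m →L[ℝ] E m}
    (hg : IsSymplectic g) : IsSymplectic (polarPath t g) := by
  intro u v
  obtain ⟨u, rfl⟩ := exists_polarDen h0 h1 hg u
  obtain ⟨v, rfl⟩ := exists_polarDen h0 h1 hg v
  rw [polarPath_polarDen h0 h1 hg, polarPath_polarDen h0 h1 hg]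
  have := isSymplectic_polarPart hg u v
  simp only [polarDen, _root_.add_apply, _root_.smul_apply, ContinuousLinearMap.id_apply,
    stdForm_add_left, stdForm_add_right, stdForm_smul_left, stdForm_smul_right, this]
  ring

theorem polarPath_zero {g : E m →L[ℝ] E m} (hg : IsSymplectic g) (u : E m) :
    polarPath 0 g u = u := by
  obtain ⟨u, rfl⟩ := exists_polarDen le_rfl zero_le_one hg u
  rw [polarPath_polarDen le_rfl zero_le_one hg]
  simp [polarDen]

/-- At time `1`, the path leads from `g` to its orthogonal part. -/
theorem norm_polarPath_one {g : E m →L[ℝ] E m} (hg : IsSymplectic g) (u : E m) :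
    ‖g (polarPath 1 g u)‖ = ‖u‖ := by
  obtain ⟨u, rfl⟩ := exists_polarDen zero_le_one le_rfl hg u
  rw [polarPath_polarDen zero_le_one le_rfl hg]
  simp [polarDen, norm_smul, norm_polarPart]

theorem continuousAt_polarPath {t : ℝ} (h0 : 0 ≤ t) (h1 : t ≤ 1) {g : E m →L[ℝ] E m}
    (hg : IsSymplectic g) :
    ContinuousAt (fun q : ℝ × (E m →L[ℝ] E m) => polarPath q.1 q.2) (t, g) := by
  have hp := continuous_polarPart (m := m)
  have hd : Continuous fun q : ℝ × (E m →L[ℝ] E m) => polarDen q.1 q.2 := by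
    unfold polarDen; fun_prop
  have hn : Continuous fun q : ℝ × (E m →L[ℝ] E m) =>
      (1 - q.1) • polarPart q.2 + (1 + q.1) • ContinuousLinearMap.id ℝ (E m) := by fun_prop
  obtain ⟨d, hd'⟩ := isUnit_polarDen h0 h1 hg
  have hi : ContinuousAt (Ring.inverse (M₀ := E m →L[ℝ] E m)) (polarDen t g) :=
    hd' ▸ NormedRing.inverse_continuousAt d
  exact hn.continuousAt.mul (ContinuousAt.comp (g := Ring.inverse)
    (f := fun q : ℝ × (E m →L[ℝ] E m) => polarDen q.1 q.2) hi hd.continuousAt)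

end Deform

end SymplecticBalls
end
noncomputable section
namespace SymplecticBalls

universe u

variable {m n : ℕ} {M : Type u} [TopologicalSpace M] [ChartedSpace (E m) M]
  [IsManifold 𝓘(ℝ, E m) ∞ M] {P : Type*} [TopologicalSpace P]
  {σ : SymplecticForm m M} {φ ψ : OpenPartialHomeomorph M (E m)}

/-! ### Frames with given coordinates -/

/-- The frame with base point `y` and matrix `g` in the chart `φ`. -/
def chartFrame (φ : OpenPartialHomeomorph M (E m)) (y : E m) (g : E m →L[ℝ] E m) : HomTM m M :=
  ⟨φ.symm y, (chartSymmDeriv φ y).comp g⟩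

theorem chartFrame_frameMat (hφ : φ ∈ IsManifold.maximalAtlas 𝓘(ℝ, E m) ∞ M) {A : HomTM m M}
    (hA : A.proj ∈ φ.source) : chartFrame φ (φ A.proj) (frameMat φ A) = A := by
  obtain ⟨x, A⟩ := A
  exact homTM_ext (φ.left_inv hA)
    (ContinuousLinearMap.ext fun v => chartSymmDeriv_chartDeriv hφ hA (A v))

theorem chartDeriv_symm (hφ : φ ∈ IsManifold.maximalAtlas 𝓘(ℝ, E m) ∞ M)
    (hψ : ψ ∈ IsManifold.maximalAtlas 𝓘(ℝ, E m) ∞ M) {y : E m} (hy : y ∈ φ.target)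
    (hy' : φ.symm y ∈ ψ.source) :
    (chartDeriv ψ (φ.symm y)).comp (chartSymmDeriv φ y) = fderiv ℝ (fun y => ψ (φ.symm y)) y := by
  have h := mfderiv_comp (I := 𝓘(ℝ, E m)) (I' := 𝓘(ℝ, E m)) (I'' := 𝓘(ℝ, E m)) y
    ((contMDiffAt_chart hψ hy').mdifferentiableAt (by simp))
    ((contMDiffAt_chart_symm hφ hy).mdifferentiableAt (by simp))
  rw [mfderiv_eq_fderiv] at h
  exact h.symm

theorem frameMat_chartFrame' (hφ : φ ∈ IsManifold.maximalAtlas 𝓘(ℝ, E m) ∞ M)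
    (hψ : ψ ∈ IsManifold.maximalAtlas 𝓘(ℝ, E m) ∞ M) {y : E m} (hy : y ∈ φ.target)
    (hy' : φ.symm y ∈ ψ.source) (g : E m →L[ℝ] E m) :
    frameMat ψ (chartFrame φ y g) = (fderiv ℝ (fun y => ψ (φ.symm y)) y).comp g := by
  rw [← chartDeriv_symm hφ hψ hy hy', ContinuousLinearMap.comp_assoc]; rfl

theorem frameMat_chartFrame (hφ : φ ∈ IsManifold.maximalAtlas 𝓘(ℝ, E m) ∞ M) {y : E m}
    (hy : y ∈ φ.target) (g : E m →L[ℝ] E m) : frameMat φ (chartFrame φ y g) = g := by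
  rw [frameMat_chartFrame' hφ hφ hy (φ.map_target hy)]
  have h : (fun y => φ (φ.symm y)) =ᶠ[𝓝 y] id := by
    filter_upwards [φ.open_target.mem_nhds hy] with w hw using φ.right_inv hw
  rw [h.fderiv_eq, fderiv_id, ContinuousLinearMap.id_comp]

theorem chartFrame_symplectic (hφ : IsDarboux σ φ) {y : E m} (hy : y ∈ φ.target)
    {g : E m →L[ℝ] E m} (hg : IsSymplectic g) (u v : E m) :
    σ.form (chartFrame φ y g).proj ![(chartFrame φ y g).snd u, (chartFrame φ y g).snd v] =
      stdForm u v :=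
  (hφ.2 y hy (g u) (g v)).trans (hg u v)

theorem continuousAt_chartFrame (hφ : φ ∈ IsManifold.maximalAtlas 𝓘(ℝ, E m) ∞ M) {y : E m}
    (hy : y ∈ φ.target) (g : E m →L[ℝ] E m) :
    ContinuousAt (fun q : E m × (E m →L[ℝ] E m) => chartFrame φ q.1 q.2) (y, g) := by
  have hproj : ContinuousAt (fun q : E m × (E m →L[ℝ] E m) => φ.symm q.1) (y, g) :=
    ContinuousAt.comp (g := φ.symm) (f := fun q : E m × (E m →L[ℝ] E m) => q.1)
      (φ.continuousAt_symm hy) continuousAt_fst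
  rw [continuousAt_hom_bundle]
  refine ⟨hproj, ?_⟩
  set ψ := chartAt (E m) (φ.symm y) with hψ
  have hψ' : ψ ∈ IsManifold.maximalAtlas 𝓘(ℝ, E m) ∞ M :=
    mem_maximalAtlas_of_mem_atlas (chart_mem_atlas _ _)
  have hyψ : φ.symm y ∈ ψ.source := mem_chart_source _ _
  have h4 : ContinuousAt (fderiv ℝ (fun y => ψ (φ.symm y))) y :=
    ((contDiffAt_transition hφ hψ' hy hyψ).fderiv_right (m := 0) (by simp)).continuousAt
  have h5 : ContinuousAt (fun q : E m × (E m →L[ℝ] E m) =>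
      (fderiv ℝ (fun y => ψ (φ.symm y)) q.1).comp q.2) (y, g) :=
    (ContinuousAt.comp (f := fun q : E m × (E m →L[ℝ] E m) => q.1) h4 continuousAt_fst).clm_comp
      continuousAt_snd
  refine h5.congr ?_
  filter_upwards [hproj.eventually (ψ.open_source.mem_nhds hyψ),
    continuousAt_fst.eventually (φ.open_target.mem_nhds hy)] with q hq hq'
  have h6 := TangentBundle.continuousLinearMapAt_trivializationAt (I := 𝓘(ℝ, E m)) hq
  rw [← frameMat_chartFrame' hφ hψ' hq' hq]
  symm
  change ((trivializationAt (E m) (TangentSpace 𝓘(ℝ, E m)) (φ.symm y)).continuousLinearMapAt ℝ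
    (φ.symm q.1)).comp ((chartFrame φ q.1 q.2).snd.comp
    ((Bundle.Trivial.trivialization M (E m)).symmL ℝ (φ.symm q.1))) = _
  rw [Bundle.Trivial.symmL_trivialization, h6]
  rfl

open Classical in
/-- Replace a frame `A` by the one with base point `y` and matrix `g` in the chart `φ`, if its base
point lies in `S`. -/
def modifyFrame (φ : OpenPartialHomeomorph M (E m)) (S : Set M) (y : E m) (g : E m →L[ℝ] E m)
    (A : HomTM m M) : HomTM m M := if A.proj ∈ S then chartFrame φ y g else A

theorem modifyFrame_of_mem {S : Set M} {A : HomTM m M} (h : A.proj ∈ S) (y : E m)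
    (g : E m →L[ℝ] E m) : modifyFrame φ S y g A = chartFrame φ y g := if_pos h

theorem modifyFrame_of_notMem {S : Set M} {A : HomTM m M} (h : A.proj ∉ S) (y : E m)
    (g : E m →L[ℝ] E m) : modifyFrame φ S y g A = A := if_neg h

theorem continuousAt_modifyFrame {S : Set M} (hS : IsClosed S) (hSφ : S ⊆ φ.source)
    (hφ : φ ∈ IsManifold.maximalAtlas 𝓘(ℝ, E m) ∞ M) {a : P → HomTM m M} {y : P → E m}
    {g : P → E m →L[ℝ] E m} {p₀ : P} (ha : ContinuousAt a p₀)
    (h : (a p₀).proj ∈ φ.source → ContinuousAt y p₀ ∧ ContinuousAt g p₀ ∧ y p₀ ∈ φ.target ∧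
      ∀ᶠ p in 𝓝 p₀, (a p).proj ∉ S → y p = φ (a p).proj ∧ g p = frameMat φ (a p)) :
    ContinuousAt (fun p => modifyFrame φ S (y p) (g p) (a p)) p₀ := by
  have hproj : ContinuousAt (fun p => (a p).proj) p₀ :=
    (FiberBundle.continuous_proj _ _).continuousAt.comp ha
  by_cases h0 : (a p₀).proj ∈ φ.source
  · obtain ⟨hy, hg, ht, hoff⟩ := h h0
    have h1 : ContinuousAt (fun p => chartFrame φ (y p) (g p)) p₀ :=
      ContinuousAt.comp (f := fun p => (y p, g p)) (continuousAt_chartFrame hφ ht (g p₀))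
        (hy.prodMk hg)
    refine h1.congr ?_
    filter_upwards [hoff, hproj.eventually (φ.open_source.mem_nhds h0)] with p hp hp'
    by_cases hpS : (a p).proj ∈ S
    · rw [modifyFrame_of_mem hpS]
    · rw [modifyFrame_of_notMem hpS, (hp hpS).1, (hp hpS).2, chartFrame_frameMat hφ hp']
  · refine ha.congr ?_
    filter_upwards [hproj.eventually (hS.isOpen_compl.mem_nhds fun h => h0 (hSφ h))] with p hp
    rw [modifyFrame_of_notMem hp]

theorem modifyFrame_symplectic (hφ : IsDarboux σ φ) {S : Set M} {y : E m} {g : E m →L[ℝ] E m}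
    (A : Fr σ) (h : A.1.proj ∈ S → y ∈ φ.target ∧ IsSymplectic g) (u v : E m) :
    σ.form (modifyFrame φ S y g A.1).proj
      ![(modifyFrame φ S y g A.1).snd u, (modifyFrame φ S y g A.1).snd v] = stdForm u v := by
  by_cases hS : A.1.proj ∈ S
  · rw [modifyFrame_of_mem hS]; exact chartFrame_symplectic hφ (h hS).1 (h hS).2 u v
  · rw [modifyFrame_of_notMem hS]; exact A.2 u v

/-! ### Deforming frames into a compact set -/

/-- The frames over a compact set in a Darboux chart whose matrices are bounded by `1` are contained
in a compact set. -/
theorem exists_isCompact_frames (hφ : IsDarboux σ φ) {K : Set (E m)} (hK : IsCompact K)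
    (hKφ : K ⊆ φ.target) : ∃ C : Set (Fr σ), IsCompact C ∧ ∀ A : Fr σ, A.1.proj ∈ φ.source →
      φ A.1.proj ∈ K → ‖frameMat φ A.1‖ ≤ 1 → A ∈ C := by
  have hclosed : IsClosed {g : E m →L[ℝ] E m | IsSymplectic g} := by
    have : {g : E m →L[ℝ] E m | IsSymplectic g} =
        ⋂ (u : E m) (v : E m), {g | stdFormL m (g u) (g v) = stdForm u v} := by
      ext g; simp [IsSymplectic]
    rw [this]
    refine isClosed_iInter fun u => isClosed_iInter fun v => isClosed_eq ?_ continuous_const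
    fun_prop
  let T : Set (E m × (E m →L[ℝ] E m)) := K ×ˢ ({g | IsSymplectic g} ∩ Metric.closedBall 0 1)
  have hT : IsCompact T := hK.prod ((isCompact_closedBall _ _).inter_left hclosed)
  have : CompactSpace T := isCompact_iff_compactSpace.1 hT
  let f : T → Fr σ := fun q => ⟨chartFrame φ q.1.1 q.1.2,
    chartFrame_symplectic hφ (hKφ q.2.1) q.2.2.1⟩
  have hf : Continuous f := by
    refine Continuous.subtype_mk (continuous_iff_continuousAt.2 fun q => ?_) _
    exact ContinuousAt.comp (f := fun q : T => q.1)
      (continuousAt_chartFrame hφ.1 (hKφ q.2.1) q.1.2) continuous_subtype_val.continuousAt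
  refine ⟨range f, isCompact_range hf, fun A hA hAK hA1 => ?_⟩
  exact ⟨⟨(φ A.1.proj, frameMat φ A.1), hAK, Fr.isSymplectic_frameMat hφ A hA, by simpa using hA1⟩,
    Subtype.ext (chartFrame_frameMat hφ.1 hA)⟩

theorem cutoff_mul_mem (b : DarbouxBall σ) (t : unitInterval) (x : M) :
    0 ≤ t * b.cutoff x ∧ t * b.cutoff x ≤ 1 :=
  ⟨mul_nonneg t.2.1 (b.cutoff_nonneg x), mul_le_one₀ t.2.2 (b.cutoff_nonneg x) (b.cutoff_le_one x)⟩

/-- The polar deformation over a Darboux ball. -/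
theorem exists_bound_darbouxBall [T2Space M] (b : DarbouxBall σ) :
    ∃ H : C(unitInterval × Fr σ, Fr σ), (∀ A, H (0, A) = A) ∧
      (∀ q, (H q).1.proj = q.2.1.proj) ∧
      ∃ C, IsCompact C ∧ ∀ A, A.1.proj ∈ b.core → H (1, A) ∈ C := by
  have hsub : b.supp ⊆ b.chart.source := fun x hx => hx.1
  have hsymp : ∀ (q : unitInterval × Fr σ), q.2.1.proj ∈ b.supp → b.chart q.2.1.proj ∈ b.chart.target ∧
      IsSymplectic ((frameMat b.chart q.2.1).comp
        (polarPath (q.1 * b.cutoff q.2.1.proj) (frameMat b.chart q.2.1))) := fun q hq =>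
    ⟨b.chart.map_source (hsub hq), (Fr.isSymplectic_frameMat b.darboux q.2 (hsub hq)).comp
      (isSymplectic_polarPath (cutoff_mul_mem b _ _).1 (cutoff_mul_mem b _ _).2
        (Fr.isSymplectic_frameMat b.darboux q.2 (hsub hq)))⟩
  have hcomp : ∀ g : E m →L[ℝ] E m, IsSymplectic g → g.comp (polarPath 0 g) = g := fun g hg => by
    ext1 u; rw [ContinuousLinearMap.comp_apply, polarPath_zero hg]
  let H : unitInterval × Fr σ → Fr σ := fun q => ⟨_, modifyFrame_symplectic b.darboux q.2 (hsymp q)⟩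
  have hH : Continuous H := by
    refine Continuous.subtype_mk (continuous_iff_continuousAt.2 fun q₀ => ?_) _
    have hval : Continuous fun q : unitInterval × Fr σ => q.2.1 :=
      Fr.continuous_val.comp continuous_snd
    have hproj : Continuous fun q : unitInterval × Fr σ => q.2.1.proj :=
      Fr.continuous_proj.comp continuous_snd
    refine continuousAt_modifyFrame b.isClosed_supp hsub b.darboux.1 hval.continuousAt fun h0 => ?_
    have hmat : ContinuousAt (fun q : unitInterval × Fr σ => frameMat b.chart q.2.1) q₀ :=
      ContinuousAt.comp (f := fun q : unitInterval × Fr σ => q.2.1)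
        (continuousAt_frameMat b.darboux.1 h0) hval.continuousAt
    have hτ : ContinuousAt (fun q : unitInterval × Fr σ => (q.1 : ℝ) * b.cutoff q.2.1.proj) q₀ :=
      ((continuous_subtype_val.comp continuous_fst).mul
        (b.continuous_cutoff.comp hproj)).continuousAt
    refine ⟨?_, hmat.clm_comp ?_, b.chart.map_source h0, ?_⟩
    · exact ContinuousAt.comp (f := fun q : unitInterval × Fr σ => q.2.1.proj)
        (b.chart.continuousAt h0) hproj.continuousAt
    · exact ContinuousAt.comp (f := fun q : unitInterval × Fr σ =>
        ((q.1 : ℝ) * b.cutoff q.2.1.proj, frameMat b.chart q.2.1))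
        (continuousAt_polarPath (cutoff_mul_mem b _ _).1 (cutoff_mul_mem b _ _).2
          (Fr.isSymplectic_frameMat b.darboux _ h0)) (hτ.prodMk hmat)
    · filter_upwards [hproj.continuousAt.eventually (b.chart.open_source.mem_nhds h0)] with q hq hqS
      refine ⟨rfl, ?_⟩
      rw [b.cutoff_eq_zero hqS, mul_zero, hcomp _ (Fr.isSymplectic_frameMat b.darboux _ hq)]
  obtain ⟨C, hC, hCmem⟩ := exists_isCompact_frames b.darboux
    (isCompact_closedBall b.center (2 * b.radius)) b.closedBall_two_subset
  have hHproj : ∀ q, (H q).1.proj = q.2.1.proj := fun q => by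
    by_cases h : q.2.1.proj ∈ b.supp
    · exact (congrArg (fun A : HomTM m M => A.proj) (modifyFrame_of_mem h _ _)).trans
        (b.chart.left_inv (hsub h))
    · exact congrArg (fun A : HomTM m M => A.proj) (modifyFrame_of_notMem h _ _)
  refine ⟨⟨H, hH⟩, fun A => Subtype.ext ?_, hHproj, C, hC, fun A hA => ?_⟩
  · change modifyFrame _ _ _ _ A.1 = A.1
    by_cases h : A.1.proj ∈ b.supp
    · have h0 : ((0 : unitInterval) : ℝ) * b.cutoff A.1.proj = 0 := by simp
      rw [modifyFrame_of_mem h]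
      simp only [h0]
      rw [hcomp _ (Fr.isSymplectic_frameMat b.darboux A (hsub h)),
        chartFrame_frameMat b.darboux.1 (hsub h)]
    · exact modifyFrame_of_notMem h _ _
  · have hS := b.core_subset_supp hA
    have h1 := hHproj (1, A)
    refine hCmem _ ?_ ?_ ?_
    · exact h1 ▸ hsub hS
    · change b.chart (H (1, A)).1.proj ∈ _
      rw [h1]; exact hS.2
    · change ‖frameMat b.chart (modifyFrame _ _ _ _ A.1)‖ ≤ 1
      rw [modifyFrame_of_mem hS, frameMat_chartFrame b.darboux.1 (b.chart.map_source (hsub hS))]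
      refine ContinuousLinearMap.opNorm_le_bound _ zero_le_one fun u => ?_
      have h2 : ((1 : unitInterval) : ℝ) * b.cutoff A.1.proj = 1 := by simp [b.cutoff_eq_one hA]
      simp only [h2]
      rw [ContinuousLinearMap.comp_apply,
        norm_polarPath_one (Fr.isSymplectic_frameMat b.darboux A (hsub hS)), one_mul]

/-- The polar deformations over several Darboux balls can be performed one after the other: the image
of a compact set of frames under the time-one map of a further deformation is compact. -/
theorem exists_bound [T2Space M] (l : List (DarbouxBall σ)) :
    ∃ H : C(unitInterval × Fr σ, Fr σ), (∀ A, H (0, A) = A) ∧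
      (∀ q, (H q).1.proj = q.2.1.proj) ∧
      ∃ C, IsCompact C ∧ ∀ A, (∃ b ∈ l, A.1.proj ∈ b.core) → H (1, A) ∈ C := by
  induction l with
  | nil => exact ⟨⟨Prod.snd, continuous_snd⟩, fun _ => rfl, fun _ => rfl, ∅, isCompact_empty, by simp⟩
  | cons b l ih =>
    obtain ⟨H, hH0, hHp, C, hC, hHC⟩ := ih
    obtain ⟨H', hH0', hHp', C', hC', hHC'⟩ := exists_bound_darbouxBall b
    refine ⟨⟨fun q => H' (q.1, H q), by fun_prop⟩, fun A => ?_, fun q => ?_,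
      (fun A => H' (1, A)) '' C ∪ C', (hC.image (by fun_prop)).union hC', ?_⟩
    · change H' (0, H (0, A)) = A
      rw [hH0, hH0']
    · change (H' (q.1, H q)).1.proj = _
      rw [hHp', hHp]
    · rintro A ⟨b', hb', hA⟩
      rcases List.mem_cons.1 hb' with rfl | hb'
      · exact Or.inr (hHC' _ (by rw [hHp]; exact hA))
      · exact Or.inl ⟨_, hHC A ⟨b', hb', hA⟩, rfl⟩

end SymplecticBalls
end
noncomputable section
namespace SymplecticBalls

universe u

/-! ### Repelling points in Euclidean space -/

section Push

variable {V : Type*} [NormedAddCommGroup V] [InnerProductSpace ℝ V] {n : ℕ}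

/-- The unit vector in the direction of `u` (zero for `u = 0`). -/
def unitDir (u : V) : V := ‖u‖⁻¹ • u

@[simp] theorem unitDir_zero : unitDir (0 : V) = 0 := by simp [unitDir]

theorem norm_unitDir_le (u : V) : ‖unitDir u‖ ≤ 1 := by
  rw [unitDir, norm_smul, norm_inv, norm_norm]
  exact inv_mul_le_one

theorem inner_unitDir (u : V) : inner ℝ u (unitDir u) = ‖u‖ := by
  rcases eq_or_ne u 0 with rfl | h
  · simp
  · have := norm_ne_zero_iff.2 h
    rw [unitDir, inner_smul_right, real_inner_self_eq_norm_sq]; field_simp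

theorem unitDir_neg (u : V) : unitDir (-u) = -unitDir u := by simp [unitDir]

/-- `unitDir` is monotone, as the gradient of the norm. -/
theorem inner_sub_unitDir_nonneg (a b : V) : 0 ≤ inner ℝ (a - b) (unitDir a - unitDir b) := by
  have h1 : inner ℝ a (unitDir b) ≤ ‖a‖ :=
    (real_inner_le_norm _ _).trans (mul_le_of_le_one_right (norm_nonneg _) (norm_unitDir_le b))
  have h2 : inner ℝ b (unitDir a) ≤ ‖b‖ :=
    (real_inner_le_norm _ _).trans (mul_le_of_le_one_right (norm_nonneg _) (norm_unitDir_le a))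
  rw [inner_sub_left, inner_sub_right, inner_sub_right, inner_unitDir, inner_unitDir]
  linarith

theorem continuousAt_unitDir {u : V} (h : u ≠ 0) : ContinuousAt (unitDir (V := V)) u :=
  (continuous_norm.continuousAt.inv₀ (norm_ne_zero_iff.2 h)).smul continuousAt_id

/-- The velocity of the `i`-th of `n` points `y` with weights `Λ` that repel each other. -/
def push (Λ : Fin n → ℝ) (y : Fin n → V) (i : Fin n) : V :=
  Λ i • ∑ k, Λ k • unitDir (y i - y k)

theorem norm_push_le {Λ : Fin n → ℝ} (h0 : ∀ i, 0 ≤ Λ i) (h1 : ∀ i, Λ i ≤ 1) (y : Fin n → V)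
    (i : Fin n) : ‖push Λ y i‖ ≤ n := by
  have h2 : ∀ (a : Fin n) (v : V), ‖Λ a • v‖ ≤ ‖v‖ := fun a v => by
    rw [norm_smul, Real.norm_of_nonneg (h0 a)]
    exact mul_le_of_le_one_left (norm_nonneg _) (h1 a)
  refine (h2 _ _).trans ((norm_sum_le _ _).trans ?_)
  refine (Finset.sum_le_sum fun k _ => (h2 k _).trans (norm_unitDir_le _)).trans ?_
  simp

/-- Points move apart under `push`, provided that the weights are Lipschitz functions of the
points. -/
theorem push_expand {Λ : Fin n → ℝ} (h0 : ∀ i, 0 ≤ Λ i) (h1 : ∀ i, Λ i ≤ 1) {y : Fin n → V}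
    {i j : Fin n} {ρ s : ℝ} (hρ : 0 < ρ) (hL : |Λ i - Λ j| ≤ ‖y i - y j‖ / ρ) (hs : 0 ≤ s)
    (hsn : s * n ≤ ρ / 2) (hij : y i ≠ y j) :
    ‖y i - y j‖ / 2 + 2 * s * (Λ i * Λ j) ≤ ‖(y i + s • push Λ y i) - (y j + s • push Λ y j)‖ := by
  set u := y i - y j with hu
  have hne : i ≠ j := fun h => hij (by rw [h])
  have hupos : 0 < ‖u‖ := norm_pos_iff.2 (sub_ne_zero.2 hij)
  have hexp : inner ℝ u (push Λ y i - push Λ y j) = ∑ k, Λ k *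
      (Λ i * inner ℝ u (unitDir (y i - y k)) - Λ j * inner ℝ u (unitDir (y j - y k))) := by
    simp only [push, inner_sub_right, inner_smul_right, inner_sum, Finset.mul_sum,
      ← Finset.sum_sub_distrib]
    exact Finset.sum_congr rfl fun k _ => by ring
  -- the terms `k = i` and `k = j` push the points apart, and every other term brings them closer only
  -- because the weights of the two points differ, by an amount that the Lipschitz bound controls
  have hterm : ∀ k, (if k = i then Λ i * Λ j * ‖u‖ else 0) + (if k = j then Λ i * Λ j * ‖u‖ else 0) -
      ‖u‖ ^ 2 / ρ ≤ Λ k *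
      (Λ i * inner ℝ u (unitDir (y i - y k)) - Λ j * inner ℝ u (unitDir (y j - y k))) := by
    intro k
    have hpos : 0 ≤ ‖u‖ ^ 2 / ρ := by positivity
    by_cases hki : k = i
    · subst hki
      have h2 : unitDir (y j - y k) = -unitDir u := by rw [← unitDir_neg, hu, neg_sub]
      rw [if_pos rfl, if_neg hne, h2, sub_self, unitDir_zero, inner_zero_right, inner_neg_right,
        inner_unitDir]
      linarith
    · by_cases hkj : k = j
      · subst hkj
        rw [if_neg hki, if_pos rfl, sub_self, unitDir_zero, inner_zero_right, ← hu, inner_unitDir]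
        linarith
      · rw [if_neg hki, if_neg hkj]
        have h2 : 0 ≤ inner ℝ u (unitDir (y i - y k)) - inner ℝ u (unitDir (y j - y k)) := by
          have := inner_sub_unitDir_nonneg (y i - y k) (y j - y k)
          rwa [sub_sub_sub_cancel_right, inner_sub_right] at this
        have h3 : |inner ℝ u (unitDir (y j - y k))| ≤ ‖u‖ :=
          (abs_real_inner_le_norm _ _).trans
            (mul_le_of_le_one_right (norm_nonneg _) (norm_unitDir_le _))
        have h4 : |(Λ i - Λ j) * inner ℝ u (unitDir (y j - y k))| ≤ ‖u‖ ^ 2 / ρ := by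
          rw [abs_mul]
          calc _ ≤ ‖u‖ / ρ * ‖u‖ := by gcongr
            _ = _ := by ring
        have h5 := (abs_le.1 h4).1
        have h6 : -(‖u‖ ^ 2 / ρ) ≤ Λ i * inner ℝ u (unitDir (y i - y k)) -
            Λ j * inner ℝ u (unitDir (y j - y k)) := by nlinarith [mul_nonneg (h0 i) h2]
        nlinarith [h0 k, h1 k]
  have hsum := Finset.sum_le_sum fun k (_ : k ∈ Finset.univ) => hterm k
  rw [← hexp, Finset.sum_sub_distrib, Finset.sum_add_distrib] at hsum
  simp only [Finset.sum_ite_eq', Finset.mem_univ, if_true, Finset.sum_const, Finset.card_univ,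
    Fintype.card_fin, nsmul_eq_mul] at hsum
  have hu' : (y i + s • push Λ y i) - (y j + s • push Λ y j) = u + s • (push Λ y i - push Λ y j) := by
    rw [hu, smul_sub]; abel
  rw [hu']
  have h7 := real_inner_le_norm u (u + s • (push Λ y i - push Λ y j))
  rw [inner_add_right, real_inner_self_eq_norm_sq, inner_smul_right] at h7
  have h8 : s * (n * (‖u‖ ^ 2 / ρ)) ≤ ‖u‖ ^ 2 / 2 := by
    have : s * (n * (‖u‖ ^ 2 / ρ)) = s * n * (‖u‖ ^ 2 / ρ) := by ring
    rw [this]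
    calc _ ≤ ρ / 2 * (‖u‖ ^ 2 / ρ) := by gcongr
      _ = _ := by field_simp
  have h9 := mul_le_mul_of_nonneg_left hsum hs
  refine le_of_mul_le_mul_left ?_ hupos
  nlinarith

end Push

end SymplecticBalls
end
noncomputable section
namespace SymplecticBalls

universe u

variable {m n : ℕ} {M : Type u} [TopologicalSpace M] [ChartedSpace (E m) M]
  [IsManifold 𝓘(ℝ, E m) ∞ M] {σ : SymplecticForm m M}

/-! ### Moving points apart -/

/-- A continuous distance function on `M`. -/
structure IsDist (d : M → M → ℝ) : Prop where
  continuous : Continuous fun q : M × M => d q.1 q.2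
  self : ∀ x, d x x = 0
  symm : ∀ x y, d x y = d y x
  triangle : ∀ x y z, d x z ≤ d x y + d y z
  pos : ∀ x y, x ≠ y → 0 < d x y

/-- The metric of a compact manifold, with a Lebesgue number of the cover by Darboux balls. -/
theorem exists_isDist [T2Space M] [CompactSpace M] {l : List (DarbouxBall σ)}
    (hl : ∀ x : M, ∃ b ∈ l, x ∈ b.core) :
    ∃ d : M → M → ℝ, IsDist d ∧ ∃ r > 0, ∀ x, ∃ b ∈ l, ∀ x', d x x' < r → x' ∈ b.core := by
  have : SecondCountableTopology M := ChartedSpace.secondCountable_of_sigmaCompact (E m) M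
  have : TopologicalSpace.MetrizableSpace M :=
    TopologicalSpace.metrizableSpace_of_t3_secondCountable M
  let _ := TopologicalSpace.metrizableSpaceMetric M
  refine ⟨dist, ⟨continuous_dist, dist_self, dist_comm, dist_triangle, fun x y h => dist_pos.2 h⟩, ?_⟩
  obtain ⟨r, hr, h⟩ := lebesgue_number_lemma_of_metric (c := fun b : {b // b ∈ l} => b.1.core)
    isCompact_univ (fun b => b.1.isOpen_core) (fun x _ => by
      obtain ⟨b, hb, hx⟩ := hl x
      exact mem_iUnion.2 ⟨⟨b, hb⟩, hx⟩)
  refine ⟨r, hr, fun x => ?_⟩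
  obtain ⟨b, hb⟩ := h x (mem_univ x)
  exact ⟨b.1, b.2, fun x' hx' => hb (by rwa [Metric.mem_ball, dist_comm])⟩

/-- The base point of the `i`-th frame. -/
def SpFr.pt (A : SpFr σ n) (i : Fin n) : M := (A.1 i).proj

theorem SpFr.pt_injective (A : SpFr σ n) : Function.Injective A.pt := A.2.1

theorem SpFr.continuous_pt (i : Fin n) : Continuous fun A : SpFr σ n => A.pt i :=
  Fr.continuous_proj.comp (SpFr.continuous_fr i)

variable {d : M → M → ℝ}

/-- Moving points by small amounts in a chart moves them by small amounts in `M`. -/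
theorem IsDist.exists_move (hd : IsDist d) (b : DarbouxBall σ) {η : ℝ} (hη : 0 < η) :
    ∃ ε > 0, ∀ y ∈ Metric.closedBall b.center (3 * b.radius),
      ∀ y' ∈ Metric.closedBall b.center (3 * b.radius), ‖y - y'‖ ≤ ε →
      d (b.chart.symm y) (b.chart.symm y') ≤ η := by
  have hK := isCompact_closedBall b.center (3 * b.radius)
  have hcont : ContinuousOn (fun q : E m × E m => d (b.chart.symm q.1) (b.chart.symm q.2))
      (Metric.closedBall b.center (3 * b.radius) ×ˢ Metric.closedBall b.center (3 * b.radius)) :=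
    hd.continuous.comp_continuousOn
      (((b.chart.continuousOn_symm.mono b.subset).comp continuousOn_fst fun q hq => hq.1).prodMk
        ((b.chart.continuousOn_symm.mono b.subset).comp continuousOn_snd fun q hq => hq.2))
  have hu := (hK.prod hK).uniformContinuousOn_of_continuous hcont
  obtain ⟨ε, hε, h⟩ := Metric.uniformContinuousOn_iff.1 hu η hη
  refine ⟨ε / 2, by positivity, fun y hy y' hy' hyy => ?_⟩
  have h1 := h (y, y') ⟨hy, hy'⟩ (y, y) ⟨hy, hy⟩ (by
    rw [Prod.dist_eq, dist_self, dist_comm, dist_eq_norm]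
    exact max_lt hε (by linarith))
  rw [Real.dist_eq] at h1
  simp only [hd.self, sub_zero] at h1
  exact ((le_abs_self _).trans_lt h1).le

/-- Points with a certain distance in a chart have a certain distance in `M`. -/
theorem IsDist.exists_separate (hd : IsDist d) (b : DarbouxBall σ) {ε : ℝ} (hε : 0 < ε) :
    ∃ δ > 0, ∀ y ∈ Metric.closedBall b.center (3 * b.radius),
      ∀ y' ∈ Metric.closedBall b.center (3 * b.radius), ε ≤ ‖y - y'‖ →
      δ ≤ d (b.chart.symm y) (b.chart.symm y') := by
  have hK := isCompact_closedBall b.center (3 * b.radius)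
  have hcont : ContinuousOn (fun q : E m × E m => d (b.chart.symm q.1) (b.chart.symm q.2))
      (Metric.closedBall b.center (3 * b.radius) ×ˢ Metric.closedBall b.center (3 * b.radius)) :=
    hd.continuous.comp_continuousOn
      (((b.chart.continuousOn_symm.mono b.subset).comp continuousOn_fst fun q hq => hq.1).prodMk
        ((b.chart.continuousOn_symm.mono b.subset).comp continuousOn_snd fun q hq => hq.2))
  have hT : IsCompact ((Metric.closedBall b.center (3 * b.radius) ×ˢ
      Metric.closedBall b.center (3 * b.radius)) ∩ {q | ε ≤ ‖q.1 - q.2‖}) :=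
    (hK.prod hK).inter_right (isClosed_le continuous_const (by fun_prop))
  rcases eq_empty_or_nonempty ((Metric.closedBall b.center (3 * b.radius) ×ˢ
      Metric.closedBall b.center (3 * b.radius)) ∩ {q : E m × E m | ε ≤ ‖q.1 - q.2‖}) with he | hne
  · exact ⟨1, one_pos, fun y hy y' hy' h => by
      have h1 : (y, y') ∈ (Metric.closedBall b.center (3 * b.radius) ×ˢ
        Metric.closedBall b.center (3 * b.radius)) ∩ {q : E m × E m | ε ≤ ‖q.1 - q.2‖} :=
        ⟨⟨hy, hy'⟩, h⟩
      rw [he] at h1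
      exact h1.elim⟩
  · obtain ⟨q, hq, hmin⟩ := hT.exists_isMinOn hne (hcont.mono inter_subset_left)
    refine ⟨_, hd.pos (b.chart.symm q.1) (b.chart.symm q.2) fun h => ?_, fun y hy y' hy' h => ?_⟩
    rotate_left
    · have h1 : (y, y') ∈ (Metric.closedBall b.center (3 * b.radius) ×ˢ
        Metric.closedBall b.center (3 * b.radius)) ∩ {q : E m × E m | ε ≤ ‖q.1 - q.2‖} :=
        ⟨⟨hy, hy'⟩, h⟩
      exact hmin h1
    have h1 := b.chart.symm.injOn (b.subset hq.1.1) (b.subset hq.1.2) h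
    have h2 : ε ≤ ‖q.1 - q.2‖ := hq.2
    rw [h1, sub_self, norm_zero] at h2
    linarith

/-- The new position, in the chart, of the `i`-th point. -/
def pushChart (b : DarbouxBall σ) (s : ℝ) (x : Fin n → M) (i : Fin n) : E m :=
  b.chart (x i) + s • push (fun k => b.cutoff (x k)) (fun k => b.chart (x k)) i

theorem pushChart_of_cutoff (b : DarbouxBall σ) (s : ℝ) {x : Fin n → M} {i : Fin n}
    (h : b.cutoff (x i) = 0) : pushChart b s x i = b.chart (x i) := by
  simp [pushChart, push, h]

theorem norm_pushChart_sub_le (b : DarbouxBall σ) {s : ℝ} (hs : 0 ≤ s) (x : Fin n → M) (i : Fin n) :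
    ‖pushChart b s x i - b.chart (x i)‖ ≤ s * n := by
  rw [pushChart, add_sub_cancel_left, norm_smul, Real.norm_of_nonneg hs]
  gcongr
  exact norm_push_le (fun _ => b.cutoff_nonneg _) (fun _ => b.cutoff_le_one _) _ _

theorem pushChart_mem (b : DarbouxBall σ) {s : ℝ} (hs : 0 ≤ s) (hsn : s * n ≤ b.radius / 2)
    {x : Fin n → M} {i : Fin n} (hi : x i ∈ b.supp) :
    pushChart b s x i ∈ Metric.closedBall b.center (3 * b.radius) := by
  have h1 := norm_pushChart_sub_le b hs x i
  have h2 : dist (b.chart (x i)) b.center ≤ 2 * b.radius := hi.2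
  have := b.radius_pos
  rw [Metric.mem_closedBall]
  refine (dist_triangle _ (b.chart (x i)) _).trans ?_
  rw [dist_eq_norm]
  linarith

/-- Distinct points of the chart are moved apart; if they lie in the core of the ball, their new
distance is at least `2 s`. -/
theorem pushChart_expand (b : DarbouxBall σ) {s : ℝ} (hs : 0 ≤ s) (hsn : s * n ≤ b.radius / 2)
    {x : Fin n → M} {i j : Fin n} (hi : x i ∈ b.chart.source) (hj : x j ∈ b.chart.source)
    (hij : x i ≠ x j) :
    ‖b.chart (x i) - b.chart (x j)‖ / 2 + 2 * s * (b.cutoff (x i) * b.cutoff (x j)) ≤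
      ‖pushChart b s x i - pushChart b s x j‖ := by
  have hne : b.chart (x i) ≠ b.chart (x j) := fun h => hij (b.chart.injOn hi hj h)
  refine push_expand (Λ := fun k => b.cutoff (x k)) (y := fun k => b.chart (x k))
    (fun _ => b.cutoff_nonneg _) (fun _ => b.cutoff_le_one _) b.radius_pos ?_ hs hsn hne
  rw [b.cutoff_of_mem hi, b.cutoff_of_mem hj]
  exact b.abs_bump_sub_le _ _

theorem continuousAt_pushChart [T2Space M] {P : Type*} [TopologicalSpace P] (b : DarbouxBall σ)
    {s : P → ℝ} {x : P → Fin n → M} (hs : Continuous s) (hx : ∀ i, Continuous fun p => x p i)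
    {p₀ : P} (hinj : Function.Injective (x p₀)) {i : Fin n} (hi : x p₀ i ∈ b.chart.source) :
    ContinuousAt (fun p => pushChart b (s p) (x p) i) p₀ := by
  have hΛ : ∀ k, Continuous fun p => b.cutoff (x p k) := fun k => b.continuous_cutoff.comp (hx k)
  have hy : ∀ k, x p₀ k ∈ b.chart.source → ContinuousAt (fun p => b.chart (x p k)) p₀ := fun k hk =>
    ContinuousAt.comp (f := fun p => x p k) (b.chart.continuousAt hk) (hx k).continuousAt
  refine (hy i hi).add (hs.continuousAt.smul ((hΛ i).continuousAt.smul ?_))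
  refine tendsto_finsetSum _ fun k _ => ?_
  by_cases hk : x p₀ k ∈ b.chart.source
  · refine (hΛ k).continuousAt.smul ?_
    by_cases hki : k = i
    · subst hki; simp only [sub_self]; exact tendsto_const_nhds
    · exact ContinuousAt.comp (f := fun p => b.chart (x p i) - b.chart (x p k))
        (continuousAt_unitDir (sub_ne_zero.2 fun h => hki (hinj (b.chart.injOn hi hk h)).symm))
        ((hy i hi).sub (hy k hk))
  · have h0 : ∀ᶠ p in 𝓝 p₀, b.cutoff (x p k) = 0 := by
      filter_upwards [(hx k).continuousAt.eventually
        (b.isClosed_supp.isOpen_compl.mem_nhds fun h => hk h.1)] with p hp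
      exact b.cutoff_eq_zero hp
    have h1 : ContinuousAt (fun _ : P => (0 : E m)) p₀ := continuousAt_const
    refine h1.congr ?_
    filter_upwards [h0] with p hp
    simp [hp]

/-- Points in a Darboux ball can be moved apart. -/
theorem IsDist.exists_spread_darbouxBall [T2Space M] (hd : IsDist d) (b : DarbouxBall σ) (n : ℕ)
    {η : ℝ} (hη : 0 < η) :
    ∃ H : C(unitInterval × SpFr σ n, SpFr σ n), (∀ A, H (0, A) = A) ∧
      (∀ A i, d (A.pt i) ((H (1, A)).pt i) ≤ η) ∧
      ∃ δ > 0, ∀ A i j, i ≠ j → A.pt i ∈ b.core → A.pt j ∈ b.core →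
        δ ≤ d ((H (1, A)).pt i) ((H (1, A)).pt j) := by
  have hρ := b.radius_pos
  have hsub : b.supp ⊆ b.chart.source := fun x hx => hx.1
  have hball : Metric.closedBall b.center (2 * b.radius) ⊆
      Metric.closedBall b.center (3 * b.radius) := Metric.closedBall_subset_closedBall (by linarith)
  obtain ⟨ε₀, hε₀, hmove⟩ := hd.exists_move b hη
  obtain ⟨ε, hε, hε1, hε2⟩ : ∃ ε > 0, ε * n ≤ b.radius / 2 ∧ ε * n ≤ ε₀ := by
    have hn : (0 : ℝ) < n + 1 := by positivity
    have h1 : ∀ a : ℝ, 0 < a → a / (n + 1) * n ≤ a := fun a ha => by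
      rw [div_mul_eq_mul_div, div_le_iff₀ hn]; nlinarith
    refine ⟨min (b.radius / 2) ε₀ / (n + 1), by positivity,
      (h1 _ (by positivity)).trans (min_le_left _ _), (h1 _ (by positivity)).trans (min_le_right _ _)⟩
  obtain ⟨δ, hδ, hsep⟩ := hd.exists_separate b (ε := 2 * ε) (by positivity)
  have hs0 : ∀ t : unitInterval, 0 ≤ (t : ℝ) * ε := fun t => mul_nonneg t.2.1 hε.le
  have hsn : ∀ t : unitInterval, (t : ℝ) * ε * n ≤ b.radius / 2 := fun t => by
    rw [mul_assoc]
    exact (mul_le_of_le_one_left (by positivity) t.2.2).trans hε1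
  let fr : unitInterval × SpFr σ n → Fin n → HomTM m M := fun q i =>
    modifyFrame b.chart b.supp (pushChart b (q.1 * ε) q.2.pt i) (frameMat b.chart (q.2.1 i)) (q.2.1 i)
  have hin : ∀ q i, q.2.pt i ∈ b.supp → (fr q i).proj = b.chart.symm (pushChart b (q.1 * ε) q.2.pt i) :=
    fun q i h => congrArg (fun A : HomTM m M => A.proj)
      (modifyFrame_of_mem (A := q.2.1 i) h _ _)
  have hout : ∀ q i, q.2.pt i ∉ b.supp → (fr q i).proj = q.2.pt i := fun q i h =>
    congrArg (fun A : HomTM m M => A.proj) (modifyFrame_of_notMem (A := q.2.1 i) h _ _)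
  have hmem : ∀ (q : unitInterval × SpFr σ n) i, q.2.pt i ∈ b.supp →
      pushChart b (q.1 * ε) q.2.pt i ∈ b.chart.target := fun q i h =>
    b.subset (pushChart_mem b (hs0 _) (hsn _) h)
  -- the new positions of points in the domain of the chart
  have hsrc : ∀ q i, q.2.pt i ∈ b.chart.source →
      pushChart b (q.1 * ε) q.2.pt i ∈ b.chart.target ∧
        (fr q i).proj = b.chart.symm (pushChart b (q.1 * ε) q.2.pt i) := fun q i h => by
    by_cases hS : q.2.pt i ∈ b.supp
    · exact ⟨hmem q i hS, hin q i hS⟩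
    · rw [hout q i hS, pushChart_of_cutoff b _ (b.cutoff_eq_zero hS), b.chart.left_inv h]
      exact ⟨b.chart.map_source h, rfl⟩
  have hnsrc : ∀ q i, q.2.pt i ∉ b.chart.source → (fr q i).proj ∉ b.chart.source := fun q i h => by
    rw [hout q i fun hS => h (hsub hS)]; exact h
  have hinj : ∀ q, Function.Injective fun i => (fr q i).proj := by
    intro q i j hij
    by_contra hne
    have hne' : q.2.pt i ≠ q.2.pt j := fun h => hne (q.2.pt_injective h)
    change (fr q i).proj = (fr q j).proj at hij
    by_cases hi : q.2.pt i ∈ b.chart.source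
    · by_cases hj : q.2.pt j ∈ b.chart.source
      · rw [(hsrc q i hi).2, (hsrc q j hj).2] at hij
        have h1 := b.chart.symm.injOn (hsrc q i hi).1 (hsrc q j hj).1 hij
        have h2 := pushChart_expand b (hs0 q.1) (hsn q.1) hi hj hne'
        have h3 : 0 < ‖b.chart (q.2.pt i) - b.chart (q.2.pt j)‖ :=
          norm_pos_iff.2 (sub_ne_zero.2 fun h => hne' (b.chart.injOn hi hj h))
        have h4 := mul_nonneg (hs0 q.1)
          (mul_nonneg (b.cutoff_nonneg (q.2.pt i)) (b.cutoff_nonneg (q.2.pt j)))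
        rw [h1, sub_self, norm_zero] at h2
        linarith
      · refine hnsrc q j hj ?_
        rw [← hij, (hsrc q i hi).2]
        exact b.chart.map_target (hsrc q i hi).1
    · by_cases hj : q.2.pt j ∈ b.chart.source
      · refine hnsrc q i hi ?_
        rw [hij, (hsrc q j hj).2]
        exact b.chart.map_target (hsrc q j hj).1
      · rw [hout q i fun h => hi (hsub h), hout q j fun h => hj (hsub h)] at hij
        exact hne' hij
  let H : unitInterval × SpFr σ n → SpFr σ n := fun q => ⟨fr q, hinj q, fun i =>
    modifyFrame_symplectic b.darboux (q.2.fr i) fun h =>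
      ⟨hmem q i h, Fr.isSymplectic_frameMat b.darboux (q.2.fr i) (hsub h)⟩⟩
  have hH : Continuous H := by
    refine Continuous.subtype_mk (continuous_pi fun i => continuous_iff_continuousAt.2 fun q₀ => ?_) _
    have hval : Continuous fun q : unitInterval × SpFr σ n => q.2.1 i :=
      Fr.continuous_val.comp ((SpFr.continuous_fr i).comp continuous_snd)
    have hpt : ∀ i, Continuous fun q : unitInterval × SpFr σ n => q.2.pt i := fun i =>
      (SpFr.continuous_pt i).comp continuous_snd
    refine continuousAt_modifyFrame b.isClosed_supp hsub b.darboux.1 hval.continuousAt fun h0 =>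
      ⟨?_, ?_, (hsrc q₀ i h0).1, Filter.Eventually.of_forall fun q hq => ⟨?_, rfl⟩⟩
    · exact continuousAt_pushChart b
        (s := fun q : unitInterval × SpFr σ n => (q.1 : ℝ) * ε) (x := fun q => q.2.pt)
        (by fun_prop) hpt q₀.2.pt_injective h0
    · exact ContinuousAt.comp (f := fun q : unitInterval × SpFr σ n => q.2.1 i)
        (continuousAt_frameMat b.darboux.1 h0) hval.continuousAt
    · exact pushChart_of_cutoff b _ (b.cutoff_eq_zero hq)
  refine ⟨⟨H, hH⟩, fun A => Subtype.ext (funext fun i => ?_), fun A i => ?_, δ, hδ,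
    fun A i j hij hi hj => ?_⟩
  · change modifyFrame _ _ _ _ (A.1 i) = A.1 i
    by_cases hS : (A.1 i).proj ∈ b.supp
    · rw [modifyFrame_of_mem hS]
      have h1 : pushChart b (((0 : unitInterval) : ℝ) * ε) A.pt i = b.chart (A.1 i).proj := by
        simp [pushChart, SpFr.pt]
      simp only [h1]
      exact chartFrame_frameMat b.darboux.1 (hsub hS)
    · exact modifyFrame_of_notMem hS _ _
  · change d (A.pt i) (fr (1, A) i).proj ≤ η
    by_cases hS : A.pt i ∈ b.supp
    · rw [hin (1, A) i hS]
      have h1 := hmove (b.chart (A.pt i)) (hball hS.2) _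
        (pushChart_mem b (hs0 1) (hsn 1) hS) (by
          rw [norm_sub_rev]
          refine (norm_pushChart_sub_le b (hs0 1) A.pt i).trans ?_
          simpa using hε2)
      rwa [b.chart.left_inv (hsub hS)] at h1
    · rw [hout (1, A) i hS, hd.self]; exact hη.le
  · change δ ≤ d (fr (1, A) i).proj (fr (1, A) j).proj
    have hi' := b.core_subset_supp hi
    have hj' := b.core_subset_supp hj
    rw [hin (1, A) i hi', hin (1, A) j hj']
    refine hsep _ (pushChart_mem b (hs0 1) (hsn 1) hi') _ (pushChart_mem b (hs0 1) (hsn 1) hj') ?_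
    have h1 := pushChart_expand b (hs0 1) (hsn 1) (hsub hi') (hsub hj')
      fun h => hij (A.pt_injective h)
    rw [b.cutoff_eq_one hi, b.cutoff_eq_one hj] at h1
    have h2 : (((1 : unitInterval) : ℝ)) * ε = ε := by simp
    rw [h2] at h1 ⊢
    linarith [norm_nonneg (b.chart (A.pt i) - b.chart (A.pt j))]

/-- Points can be moved apart in several Darboux balls one after the other: the moves in later balls are
so small that they do not bring points together again that have been separated in an earlier one. -/
theorem IsDist.exists_spread_list [T2Space M] (hd : IsDist d) (l : List (DarbouxBall σ)) (n : ℕ) :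
    ∀ η > 0, ∃ H : C(unitInterval × SpFr σ n, SpFr σ n), (∀ A, H (0, A) = A) ∧
      (∀ A i, d (A.pt i) ((H (1, A)).pt i) ≤ η) ∧
      ∃ δ > 0, ∀ A i j, i ≠ j → ∀ b ∈ l, (∀ x, d (A.pt i) x ≤ η → x ∈ b.core) →
        (∀ x, d (A.pt j) x ≤ η → x ∈ b.core) → δ ≤ d ((H (1, A)).pt i) ((H (1, A)).pt j) := by
  induction l with
  | nil =>
    exact fun η hη => ⟨⟨Prod.snd, continuous_snd⟩, fun _ => rfl, fun A i => (hd.self _).le.trans hη.le,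
      1, one_pos, by simp⟩
  | cons b l ih =>
    intro η hη
    obtain ⟨H, hH0, hHm, δ, hδ, hHδ⟩ := hd.exists_spread_darbouxBall b n (half_pos hη)
    obtain ⟨H', hH0', hHm', δ', hδ', hHδ'⟩ := ih (min (η / 2) (δ / 4)) (by positivity)
    have hm1 : ∀ A i, d ((H (1, A)).pt i) ((H' (1, H (1, A))).pt i) ≤ η / 2 := fun A i =>
      (hHm' _ i).trans (min_le_left _ _)
    have hm2 : ∀ A i, d ((H (1, A)).pt i) ((H' (1, H (1, A))).pt i) ≤ δ / 4 := fun A i =>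
      (hHm' _ i).trans (min_le_right _ _)
    refine ⟨⟨fun q => H' (q.1, H q), by fun_prop⟩, fun A => ?_, fun A i => ?_,
      min (δ / 2) δ', by positivity, fun A i j hij b' hb' hi hj => ?_⟩
    · change H' (0, H (0, A)) = A
      rw [hH0, hH0']
    · change d (A.pt i) ((H' (1, H (1, A))).pt i) ≤ η
      linarith [hd.triangle (A.pt i) ((H (1, A)).pt i) ((H' (1, H (1, A))).pt i), hHm A i, hm1 A i]
    · change _ ≤ d ((H' (1, H (1, A))).pt i) ((H' (1, H (1, A))).pt j)
      rcases List.mem_cons.1 hb' with rfl | hb'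
      · refine (min_le_left _ _).trans ?_
        have h1 := hHδ A i j hij (hi _ ((hd.self _).le.trans hη.le))
          (hj _ ((hd.self _).le.trans hη.le))
        have h2 := hd.triangle ((H (1, A)).pt i) ((H' (1, H (1, A))).pt i) ((H (1, A)).pt j)
        have h3 := hd.triangle ((H' (1, H (1, A))).pt i) ((H' (1, H (1, A))).pt j) ((H (1, A)).pt j)
        have h4 := hd.symm ((H' (1, H (1, A))).pt j) ((H (1, A)).pt j)
        linarith [hm2 A i, hm2 A j]
      · refine (min_le_right _ _).trans (hHδ' _ i j hij b' hb' (fun x hx => hi x ?_) fun x hx => hj x ?_)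
        · have := hx.trans (min_le_left _ _)
          linarith [hd.triangle (A.pt i) ((H (1, A)).pt i) x, hHm A i]
        · have := hx.trans (min_le_left _ _)
          linarith [hd.triangle (A.pt j) ((H (1, A)).pt j) x, hHm A j]

/-- The space of tuples of symplectic frames can be deformed into a compact subset of itself. -/
theorem exists_deformation [T2Space M] [CompactSpace M]
    (hD : ∀ x : M, ∃ φ, IsDarboux σ φ ∧ x ∈ φ.source) (n : ℕ) :
    ∃ h : C(SpFr σ n, SpFr σ n), (ContinuousMap.id (SpFr σ n)).Homotopic h ∧
      ∃ K, IsCompact K ∧ ∀ A, h A ∈ K := by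
  obtain ⟨l, hl⟩ := exists_darbouxBall_cover hD
  obtain ⟨d, hd, r, hr, hrl⟩ := exists_isDist hl
  obtain ⟨H, hH0, hHm, δ, hδ, hHδ⟩ := hd.exists_spread_list l n (r / 4) (by positivity)
  obtain ⟨H', hH0', hHp', C, hC, hHC⟩ := exists_bound l
  have hcont : Continuous fun q : unitInterval × SpFr σ n => fun i => H' (q.1, (H q).fr i) :=
    continuous_pi fun i => H'.continuous.comp
      (continuous_fst.prodMk ((SpFr.continuous_fr i).comp H.continuous))
  let G : C(unitInterval × SpFr σ n, SpFr σ n) :=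
    ⟨fun q => ⟨fun i => (H' (q.1, (H q).fr i)).1, by
      simp only [hHp']; exact (H q).2.1, fun i => (H' (q.1, (H q).fr i)).2⟩,
      Continuous.subtype_mk (f := fun q : unitInterval × SpFr σ n => fun i => (H' (q.1, (H q).fr i)).1)
        (continuous_pi fun i => Fr.continuous_val.comp ((continuous_apply i).comp hcont)) _⟩
  have hGp : ∀ q i, (G q).pt i = (H q).pt i := fun q i => hHp' _
  refine ⟨⟨fun A => G (1, A), by fun_prop⟩, ⟨⟨⟨G, G.continuous⟩, fun A => ?_, fun A => rfl⟩⟩,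
    {A | (∀ i, A.fr i ∈ C) ∧ ∀ i j, i ≠ j → min δ (r / 4) ≤ d (A.pt i) (A.pt j)}, ?_,
    fun A => ⟨fun i => hHC _ (hl _), fun i j hij => ?_⟩⟩
  · refine Subtype.ext (funext fun i => ?_)
    change (H' (0, (H (0, A)).fr i)).1 = A.1 i
    rw [hH0, hH0']; rfl
  · -- the set is closed in a product of compact sets of frames
    have hT : IsCompact ({a : Fin n → Fr σ | ∀ i, a i ∈ C} ∩
        {a | ∀ i j, i ≠ j → min δ (r / 4) ≤ d (a i).1.proj (a j).1.proj}) := by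
      refine IsCompact.inter_right ?_ ?_
      · simpa [Set.pi] using isCompact_univ_pi fun _ : Fin n => hC
      · simp only [Set.ofPred_forall]
        refine isClosed_iInter fun i => isClosed_iInter fun j => isClosed_iInter fun _ => ?_
        refine isClosed_le continuous_const (hd.continuous.comp (f := fun a : Fin n → Fr σ =>
          ((a i).1.proj, (a j).1.proj)) ?_)
        exact (Fr.continuous_proj.comp (continuous_apply i)).prodMk
          (Fr.continuous_proj.comp (continuous_apply j))
    have := isCompact_iff_compactSpace.1 hT
    have hmin : 0 < min δ (r / 4) := by positivity
    let f : ({a : Fin n → Fr σ | ∀ i, a i ∈ C} ∩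
        {a | ∀ i j, i ≠ j → min δ (r / 4) ≤ d (a i).1.proj (a j).1.proj} : Set _) → SpFr σ n :=
      fun a => ⟨fun i => (a.1 i).1, fun i j hij => by
        by_contra hne
        have h1 := a.2.2 i j hne
        change (a.1 i).1.proj = (a.1 j).1.proj at hij
        rw [hij, hd.self] at h1
        linarith, fun i => (a.1 i).2⟩
    have hf : Continuous f := Continuous.subtype_mk (f := fun a : ({a : Fin n → Fr σ | ∀ i, a i ∈ C} ∩
        {a | ∀ i j, i ≠ j → min δ (r / 4) ≤ d (a i).1.proj (a j).1.proj} : Set _) =>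
        fun i => (a.1 i).1) (continuous_pi fun i =>
      Fr.continuous_val.comp ((continuous_apply i).comp continuous_subtype_val)) _
    convert isCompact_range hf using 1
    ext A
    constructor
    · exact fun hA => ⟨⟨fun i => A.fr i, hA.1, hA.2⟩, rfl⟩
    · rintro ⟨a, rfl⟩
      exact ⟨a.2.1, a.2.2⟩
  · change _ ≤ d ((G (1, A)).pt i) ((G (1, A)).pt j)
    rw [hGp, hGp]
    by_cases hA : d (A.pt i) (A.pt j) < 3 / 4 * r
    · refine (min_le_left _ _).trans ?_
      obtain ⟨b, hb, hbr⟩ := hrl (A.pt i)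
      refine hHδ A i j hij b hb (fun x hx => hbr x (by linarith)) fun x hx => hbr x ?_
      linarith [hd.triangle (A.pt i) (A.pt j) x]
    · refine (min_le_right _ _).trans ?_
      have h1 := hHm A i
      have h2 := hHm A j
      have h3 := hd.triangle (A.pt i) ((H (1, A)).pt i) (A.pt j)
      have h4 := hd.triangle ((H (1, A)).pt i) ((H (1, A)).pt j) (A.pt j)
      have h5 := hd.symm ((H (1, A)).pt j) (A.pt j)
      push Not at hA
      linarith

end SymplecticBalls
end
noncomputable section
namespace SymplecticBalls

/-! ### Compactly supported symplectic diffeomorphisms of Euclidean space -/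

section Cayley

/-- A small perturbation of the identity is a diffeomorphism. -/
theorem exists_diffeo_of_fderiv_le {V : Type*} [NormedAddCommGroup V] [NormedSpace ℝ V]
    [FiniteDimensional ℝ V] {u : V → V} (hu : ContDiff ℝ ∞ u) (h : ∀ y, ‖fderiv ℝ u y‖ ≤ 1 / 2) :
    ∃ ψ : V ≃ₜ V, (∀ y, ψ y = y + u y) ∧ ContDiff ℝ ∞ ψ.symm := by
  have : CompleteSpace V := FiniteDimensional.complete ℝ V
  have hlip : LipschitzWith (1 / 2) u := lipschitzWith_of_nnnorm_fderiv_le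
    (hu.differentiable (by simp)) fun y => by
      rw [← NNReal.coe_le_coe, coe_nnnorm]; simpa using h y
  have happrox : ApproximatesLinearOn (fun y => y + u y)
      (ContinuousLinearEquiv.refl ℝ V : V →L[ℝ] V) univ (1 / 2) := by
    intro y _ z _
    have h1 := hlip.norm_sub_le y z
    rwa [show (y + u y) - (z + u z) - (ContinuousLinearEquiv.refl ℝ V : V →L[ℝ] V) (y - z) =
      u y - u z by simp; abel]
  have hN : Subsingleton V ∨
      (1 / 2 : NNReal) < ‖((ContinuousLinearEquiv.refl ℝ V).symm : V →L[ℝ] V)‖₊⁻¹ := by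
    rcases subsingleton_or_nontrivial V with h | h
    · exact Or.inl h
    · right
      have h1 : ‖((ContinuousLinearEquiv.refl ℝ V).symm : V →L[ℝ] V)‖₊ = 1 := by
        rw [← NNReal.coe_inj, coe_nnnorm]
        exact ContinuousLinearMap.norm_id
      rw [h1, inv_one]
      exact NNReal.half_lt_self one_ne_zero
  let ψ : V ≃ₜ V := happrox.toHomeomorph _ hN
  have hψ : ∀ y, ψ y = y + u y := fun y => rfl
  have hD : ∀ y, HasFDerivAt ψ (ContinuousLinearMap.id ℝ V + fderiv ℝ u y) y := fun y =>
    (hasFDerivAt_id y).add (hu.differentiable (by simp) y).hasFDerivAt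
  have hinj : ∀ y, Function.Injective (ContinuousLinearMap.id ℝ V + fderiv ℝ u y) := fun y => by
    refine (injective_iff_map_eq_zero _).2 fun v hv => ?_
    have h1 : v = -fderiv ℝ u y v := eq_neg_of_add_eq_zero_left hv
    have h2 : ‖v‖ ≤ 1 / 2 * ‖v‖ := by
      conv_lhs => rw [h1, norm_neg]
      exact (fderiv ℝ u y).le_of_opNorm_le (h y) v
    rw [← norm_eq_zero]
    linarith [norm_nonneg v]
  refine ⟨ψ, hψ, ψ.contDiff_symm (f₀' := fun y =>
    (LinearEquiv.ofInjectiveEndo (ContinuousLinearMap.id ℝ V + fderiv ℝ u y).toLinearMap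
      (hinj y)).toContinuousLinearEquiv) hD ?_⟩
  exact contDiff_id.add hu

variable {m : ℕ}

variable (m) in
theorem stdFormL_bijective : Function.Bijective (stdFormL m).toLinearMap := by
  have hinj : Function.Injective (stdFormL m).toLinearMap :=
    (injective_iff_map_eq_zero _).2 fun u hu => stdForm_nondegenerate fun v =>
      congrArg (fun L : E m →L[ℝ] ℝ => L v) hu
  refine ⟨hinj, (LinearMap.injective_iff_surjective_of_finrank_eq_finrank ?_).1 hinj⟩
  rw [LinearEquiv.finrank_eq (LinearMap.toContinuousLinearMap (𝕜 := ℝ) (E := E m) (F' := ℝ)).symm]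
  exact (Subspace.dual_finrank_eq).symm

variable (m) in
/-- The identification of covectors with vectors given by the standard symplectic form. -/
def stdSharp : (E m →L[ℝ] ℝ) →L[ℝ] E m :=
  (LinearEquiv.ofBijective (stdFormL m).toLinearMap
    (stdFormL_bijective m)).symm.toLinearMap.toContinuousLinearMap

@[simp] theorem stdForm_stdSharp (ξ : E m →L[ℝ] ℝ) (v : E m) : stdForm (stdSharp m ξ) v = ξ v :=
  congrArg (fun L : E m →L[ℝ] ℝ => L v) (LinearEquiv.apply_symm_apply
    (LinearEquiv.ofBijective (stdFormL m).toLinearMap (stdFormL_bijective m)) ξ)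

theorem stdSharp_eq {ξ : E m →L[ℝ] ℝ} {u : E m} (h : ∀ v, stdForm u v = ξ v) :
    stdSharp m ξ = u := by
  refine sub_eq_zero.1 (stdForm_nondegenerate fun v => ?_)
  rw [stdForm_sub_left, stdForm_stdSharp, h, sub_self]

/-- The Hamiltonian vector field of a function. -/
def hamField (S : E m → ℝ) (y : E m) : E m := stdSharp m (fderiv ℝ S y)

theorem contDiff_hamField {S : E m → ℝ} (hS : ContDiff ℝ ∞ S) : ContDiff ℝ ∞ (hamField S) :=
  (stdSharp m).contDiff.comp (hS.fderiv_right (by simp))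

/-- The derivative of a Hamiltonian vector field belongs to the symplectic Lie algebra, by the
symmetry of second derivatives. -/
theorem stdForm_fderiv_hamField {S : E m → ℝ} (hS : ContDiff ℝ ∞ S) (y u v : E m) :
    stdForm (fderiv ℝ (hamField S) y u) v = -stdForm u (fderiv ℝ (hamField S) y v) := by
  have hd : DifferentiableAt ℝ (fderiv ℝ S) y :=
    (hS.fderiv_right (m := ∞) (by simp)).differentiable (by simp) y
  have h1 : fderiv ℝ (hamField S) y = (stdSharp m).comp (fderiv ℝ (fderiv ℝ S) y) :=
    ((stdSharp m).hasFDerivAt.comp y hd.hasFDerivAt).fderiv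
  have h2 : IsSymmSndFDerivAt ℝ S y := hS.contDiffAt.isSymmSndFDerivAt (by
    rw [minSmoothness_of_isRCLikeNormedField]; exact WithTop.coe_le_coe.2 (le_top : (2 : ℕ∞) ≤ ⊤))
  rw [stdForm_swap u, h1, ContinuousLinearMap.comp_apply, ContinuousLinearMap.comp_apply,
    stdForm_stdSharp, stdForm_stdSharp, neg_neg, h2 u v]

theorem IsSymplectic.of_comp {L L' L'' : E m →L[ℝ] E m} (h : L.comp L' = L'')
    (hs : ∀ u v, stdForm (L' u) (L' v) = stdForm (L'' u) (L'' v)) (hsurj : Function.Surjective L') :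
    IsSymplectic L := fun u v => by
  obtain ⟨u, rfl⟩ := hsurj u
  obtain ⟨v, rfl⟩ := hsurj v
  rw [hs, ← h]; rfl

/-- The symplectic diffeomorphism with generating function `S`: it maps `w - X w / 2` to
`w + X w / 2`, where `X` is the Hamiltonian vector field of `S`. -/
theorem exists_symplectic_diffeo {S : E m → ℝ} (hS : ContDiff ℝ ∞ S)
    (h : ∀ y, ‖fderiv ℝ (hamField S) y‖ ≤ 1) :
    ∃ f : E m ≃ E m, ContDiff ℝ ∞ f ∧ ContDiff ℝ ∞ f.symm ∧ (∀ y, IsSymplectic (fderiv ℝ f y)) ∧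
      (∀ y, IsSymplectic (fderiv ℝ f.symm y)) ∧ ∀ w,
      f (w - (1 / 2 : ℝ) • hamField S w) = w + (1 / 2 : ℝ) • hamField S w ∧
      (fderiv ℝ f (w - (1 / 2 : ℝ) • hamField S w)).comp
        (ContinuousLinearMap.id ℝ (E m) - (1 / 2 : ℝ) • fderiv ℝ (hamField S) w) =
        ContinuousLinearMap.id ℝ (E m) + (1 / 2 : ℝ) • fderiv ℝ (hamField S) w := by
  have hX := contDiff_hamField hS
  have hXd : ∀ y, DifferentiableAt ℝ (hamField S) y := hX.differentiable (by simp)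
  have hscale : ∀ (a : ℝ) y, fderiv ℝ (fun y => a • hamField S y) y =
      a • fderiv ℝ (hamField S) y := fun a y => ((hXd y).hasFDerivAt.const_smul a).fderiv
  obtain ⟨ψ₁, h₁, hs₁⟩ := exists_diffeo_of_fderiv_le (u := fun y => (1 / 2 : ℝ) • hamField S y)
    (hX.const_smul _) fun y => by
      rw [hscale, norm_smul, Real.norm_of_nonneg (by norm_num)]; linarith [h y]
  obtain ⟨ψ₂, h₂, hs₂⟩ := exists_diffeo_of_fderiv_le (u := fun y => (-(1 / 2) : ℝ) • hamField S y)
    (hX.const_smul _) fun y => by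
      rw [hscale, norm_smul, norm_neg, Real.norm_of_nonneg (by norm_num)]; linarith [h y]
  have hψ₁ : (ψ₁ : E m → E m) = fun y => y + (1 / 2 : ℝ) • hamField S y := funext h₁
  have hψ₂ : (ψ₂ : E m → E m) = fun y => y - (1 / 2 : ℝ) • hamField S y := by
    funext y; rw [h₂, neg_smul, sub_eq_add_neg]
  have hc₁ : ContDiff ℝ ∞ ψ₁ := by rw [hψ₁]; exact contDiff_id.add (hX.const_smul (1 / 2 : ℝ))
  have hc₂ : ContDiff ℝ ∞ ψ₂ := by rw [hψ₂]; exact contDiff_id.sub (hX.const_smul (1 / 2 : ℝ))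
  have hD₁ : ∀ w, fderiv ℝ ψ₁ w =
      ContinuousLinearMap.id ℝ (E m) + (1 / 2 : ℝ) • fderiv ℝ (hamField S) w := fun w => by
    rw [hψ₁]; exact ((hasFDerivAt_id w).add ((hXd w).hasFDerivAt.const_smul (1 / 2 : ℝ))).fderiv
  have hD₂ : ∀ w, fderiv ℝ ψ₂ w =
      ContinuousLinearMap.id ℝ (E m) - (1 / 2 : ℝ) • fderiv ℝ (hamField S) w := fun w => by
    rw [hψ₂]; exact ((hasFDerivAt_id w).sub ((hXd w).hasFDerivAt.const_smul (1 / 2 : ℝ))).fderiv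
  have hform : ∀ w u v, stdForm (fderiv ℝ ψ₂ w u) (fderiv ℝ ψ₂ w v) =
      stdForm (fderiv ℝ ψ₁ w u) (fderiv ℝ ψ₁ w v) := fun w u v => by
    have := stdForm_fderiv_hamField hS w u v
    simp only [hD₁, hD₂, _root_.add_apply, _root_.sub_apply, _root_.smul_apply,
      ContinuousLinearMap.id_apply, stdForm_add_left, stdForm_add_right, stdForm_sub_left,
      stdForm_sub_right, stdForm_smul_left, stdForm_smul_right, this]
    ring
  -- the chain rule for a composition of one of the maps with the inverse of the other
  have hchain : ∀ ψ ψ' : E m ≃ₜ E m, ContDiff ℝ ∞ ψ → ContDiff ℝ ∞ ψ' → ContDiff ℝ ∞ ψ'.symm →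
      ∀ w, (fderiv ℝ (fun y => ψ (ψ'.symm y)) (ψ' w)).comp (fderiv ℝ ψ' w) = fderiv ℝ ψ w := by
    intro ψ ψ' hψ hψ' hψs w
    have hc : DifferentiableAt ℝ (fun y => ψ (ψ'.symm y)) (ψ' w) :=
      (hψ.comp hψs).differentiable (by simp) _
    rw [← fderiv_comp w hc (hψ'.differentiable (by simp) w)]
    congr 1
    funext y; simp
  have hsurj : ∀ ψ' : E m ≃ₜ E m, ContDiff ℝ ∞ ψ' → ContDiff ℝ ∞ ψ'.symm → ∀ w,
      Function.Surjective (fderiv ℝ ψ' w) := by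
    intro ψ' hψ' hψs w
    refine LinearMap.injective_iff_surjective (f := (fderiv ℝ ψ' w).toLinearMap) |>.1 ?_
    refine (injective_iff_map_eq_zero _).2 fun v hv => ?_
    have h3 := fderiv_comp w (hψs.differentiable (by simp) (ψ' w)) (hψ'.differentiable (by simp) w)
    have h4 : (ψ'.symm ∘ ψ' : E m → E m) = id := by funext y; simp
    rw [h4, fderiv_id] at h3
    have h5 := congrArg (fun L : E m →L[ℝ] E m => L v) h3
    have h6 : fderiv ℝ ψ' w v = 0 := hv
    simpa [h6] using h5
  refine ⟨ψ₂.symm.toEquiv.trans ψ₁.toEquiv, hc₁.comp hs₂, hc₂.comp hs₁, fun y => ?_, fun y => ?_,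
    fun w => ⟨?_, ?_⟩⟩
  · obtain ⟨w, rfl⟩ := ψ₂.surjective y
    exact IsSymplectic.of_comp (hchain ψ₁ ψ₂ hc₁ hc₂ hs₂ w) (hform w) (hsurj ψ₂ hc₂ hs₂ w)
  · obtain ⟨w, rfl⟩ := ψ₁.surjective y
    exact IsSymplectic.of_comp (hchain ψ₂ ψ₁ hc₂ hc₁ hs₁ w) (fun u v => (hform w u v).symm)
      (hsurj ψ₁ hc₁ hs₁ w)
  · change ψ₁ (ψ₂.symm _) = _
    have : w - (1 / 2 : ℝ) • hamField S w = ψ₂ w := by rw [hψ₂]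
    rw [this, ψ₂.symm_apply_apply, h₁]
  · have h3 := hchain ψ₁ ψ₂ hc₁ hc₂ hs₂ w
    rw [hD₁, hD₂, hψ₂] at h3
    exact h3

/-- The Cayley transform of a symplectic map belongs to the symplectic Lie algebra. -/
theorem stdForm_cayley {G L : E m →L[ℝ] E m} (hG : IsSymplectic G)
    (hGu : IsUnit (G + 1)) (hL : L = (2 : ℝ) • ((G - 1) * Ring.inverse (G + 1))) (u v : E m) :
    stdForm (L u) v = -stdForm u (L v) := by
  have hLG : ∀ a, L (G a + a) = (2 : ℝ) • (G a - a) := fun a => by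
    have h := Ring.inverse_mul_cancel _ hGu
    have h2 : Ring.inverse (G + 1) (G a + a) = a := congrArg (fun L : E m →L[ℝ] E m => L a) h
    rw [hL]
    simp [h2]
  have hsurj := (ContinuousLinearMap.isUnit_iff_bijective.1 hGu).2
  obtain ⟨a, rfl⟩ := hsurj u
  obtain ⟨b, rfl⟩ := hsurj v
  change stdForm (L (G a + a)) (G b + b) = -stdForm (G a + a) (L (G b + b))
  rw [hLG, hLG]
  have hab := hG a b
  simp only [stdForm_add_left, stdForm_add_right, stdForm_sub_left, stdForm_sub_right,
    stdForm_smul_left, stdForm_smul_right, hab]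
  ring

/-- Symplectic diffeomorphisms supported in a small ball act locally transitively on positions and
derivatives. -/
theorem eventually_exists_symplectic_diffeo (p : E m) {r : ℝ} (hr : 0 < r) :
    ∀ᶠ q : E m × (E m →L[ℝ] E m) in 𝓝 (p, 1), IsSymplectic q.2 →
      ∃ f : E m ≃ E m, ContDiff ℝ ∞ f ∧ ContDiff ℝ ∞ f.symm ∧ (∀ y, IsSymplectic (fderiv ℝ f y)) ∧
      (∀ y, IsSymplectic (fderiv ℝ f.symm y)) ∧ (∀ y ∉ Metric.ball p r, f y = y) ∧
      f p = q.1 ∧ fderiv ℝ f p = q.2 := by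
  let χ : ContDiffBump p := ⟨r / 4, r / 2, by positivity, by linarith⟩
  -- generating functions that are quadratic near `p`
  let S : (E m × (E m →L[ℝ] E m)) → E m → ℝ := fun w y =>
    χ y * (stdForm w.1 (y - p) + (1 / 2) * stdForm (w.2 (y - p)) (y - p))
  have hS : ContDiff ℝ ∞ (Function.uncurry S) := by
    have h1 : ContDiff ℝ ∞ fun q : (E m × (E m →L[ℝ] E m)) × E m => stdForm q.1.1 (q.2 - p) :=
      ((stdFormL m).contDiff.comp (contDiff_fst.comp contDiff_fst)).clm_apply
        (contDiff_snd.sub contDiff_const)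
    have h2 : ContDiff ℝ ∞ fun q : (E m × (E m →L[ℝ] E m)) × E m => q.1.2 (q.2 - p) :=
      (contDiff_snd.comp contDiff_fst).clm_apply (contDiff_snd.sub contDiff_const)
    have h3 : ContDiff ℝ ∞ fun q : (E m × (E m →L[ℝ] E m)) × E m =>
        stdForm (q.1.2 (q.2 - p)) (q.2 - p) :=
      ((stdFormL m).contDiff.comp h2).clm_apply (contDiff_snd.sub contDiff_const)
    exact (χ.contDiff.comp contDiff_snd).mul (h1.add (contDiff_const.mul h3))
  have hSw : ∀ w, ContDiff ℝ ∞ (S w) := fun w => hS.comp (contDiff_const.prodMk contDiff_id)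
  have hX : ContDiff ℝ ∞ fun q : (E m × (E m →L[ℝ] E m)) × E m => hamField (S q.1) q.2 :=
    (stdSharp m).contDiff.comp (ContDiff.fderiv (f := fun q : (E m × (E m →L[ℝ] E m)) × E m => S q.1)
      (hS.comp ((contDiff_fst.comp contDiff_fst).prodMk contDiff_snd)) contDiff_snd (by simp))
  have hDX : Continuous fun q : (E m × (E m →L[ℝ] E m)) × E m => fderiv ℝ (hamField (S q.1)) q.2 :=
    (ContDiff.fderiv (f := fun q : (E m × (E m →L[ℝ] E m)) × E m => hamField (S q.1)) (n := 0)
      (m := 1) ((hX.of_le (by simp)).comp ((contDiff_fst.comp contDiff_fst).prodMk contDiff_snd))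
      contDiff_snd (by simp)).continuous
  have hS0 : S 0 = fun _ => 0 := by
    funext y
    have h1 : stdForm (0 : E m) (y - p) = 0 := by rw [← stdFormL_apply, map_zero]; rfl
    simp [S, h1]
  have hX0 : hamField (S 0) = fun _ => 0 := by
    funext y; rw [hamField, hS0, fderiv_const_apply, map_zero]
  have hXout : ∀ w, ∀ y ∉ Metric.closedBall p (r / 2), hamField (S w) y = 0 := fun w y hy => by
    have h1 : S w =ᶠ[𝓝 y] fun _ => 0 := by
      filter_upwards [Metric.isClosed_closedBall.isOpen_compl.mem_nhds hy] with z hz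
      have h2 : χ z = 0 := χ.zero_of_le_dist (by
        rw [mem_compl_iff, Metric.mem_closedBall, not_le] at hz; exact hz.le)
      simp [S, h2]
    rw [hamField, h1.fderiv_eq, fderiv_const_apply, map_zero]
  have hsmall : ∀ᶠ w : E m × (E m →L[ℝ] E m) in 𝓝 0, ∀ y, ‖fderiv ℝ (hamField (S w)) y‖ ≤ 1 := by
    have h1 : ∀ᶠ w : E m × (E m →L[ℝ] E m) in 𝓝 0, ∀ y ∈ Metric.closedBall p (r / 2),
        ‖fderiv ℝ (hamField (S w)) y‖ < 1 := by
      refine (isCompact_closedBall p (r / 2)).eventually_forall_of_forall_eventually fun y _ => ?_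
      refine hDX.norm.continuousAt.eventually (Iio_mem_nhds ?_)
      simp [hX0]
    filter_upwards [h1] with w hw y
    by_cases hy : y ∈ Metric.closedBall p (r / 2)
    · exact (hw y hy).le
    · have h2 : hamField (S w) =ᶠ[𝓝 y] fun _ => 0 := by
        filter_upwards [Metric.isClosed_closedBall.isOpen_compl.mem_nhds hy] with z hz
          using hXout w z hz
      rw [h2.fderiv_eq, fderiv_const_apply, norm_zero]
      exact zero_le_one
  -- the parameters of the generating function of a map with value `q.1` and derivative `q.2` at `p`
  let Λ : (E m →L[ℝ] E m) → (E m →L[ℝ] E m) := fun G => (2 : ℝ) • ((G - 1) * Ring.inverse (G + 1))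
  let a : E m × (E m →L[ℝ] E m) → E m := fun q => q.1 - p - Λ q.2 ((1 / 2 : ℝ) • (q.1 - p))
  have hunit : IsUnit ((1 : E m →L[ℝ] E m) + 1) := by
    refine ContinuousLinearMap.isUnit_iff_bijective.2 ⟨fun u v huv => ?_, fun u =>
      ⟨(1 / 2 : ℝ) • u, ?_⟩⟩
    · have h1 : u + u = v + v := huv
      rw [← two_smul ℝ u, ← two_smul ℝ v] at h1
      exact smul_right_injective _ two_ne_zero h1
    · change (1 / 2 : ℝ) • u + (1 / 2 : ℝ) • u = u
      module
  have hΛ : ContinuousAt Λ 1 := by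
    obtain ⟨d, hd⟩ := hunit
    have h1 : ContinuousAt (Ring.inverse (M₀ := E m →L[ℝ] E m)) (1 + 1) :=
      hd ▸ NormedRing.inverse_continuousAt d
    have h2 : ContinuousAt (fun G : E m →L[ℝ] E m => Ring.inverse (G + 1)) 1 :=
      ContinuousAt.comp (f := fun G : E m →L[ℝ] E m => G + 1) h1
        (continuous_id.add continuous_const).continuousAt
    have h3 : ContinuousAt (fun G : E m →L[ℝ] E m => (G - 1) * Ring.inverse (G + 1)) 1 :=
      (continuous_id.sub continuous_const).continuousAt.mul h2
    exact h3.const_smul (2 : ℝ)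
  have hΛ1 : Λ 1 = 0 := by simp [Λ]
  have hΛ' : ContinuousAt (fun q : E m × (E m →L[ℝ] E m) => Λ q.2) (p, 1) :=
    ContinuousAt.comp (g := Λ) (f := fun q : E m × (E m →L[ℝ] E m) => q.2)
      (x := (p, (1 : E m →L[ℝ] E m))) hΛ continuousAt_snd
  have hpar : Filter.Tendsto (fun q => (a q, Λ q.2)) (𝓝 (p, 1)) (𝓝 0) := by
    have hsub : ContinuousAt (fun q : E m × (E m →L[ℝ] E m) => q.1 - p) (p, 1) := by fun_prop
    have hhalf : ContinuousAt (fun q : E m × (E m →L[ℝ] E m) => (1 / 2 : ℝ) • (q.1 - p)) (p, 1) := by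
      fun_prop
    have ha : ContinuousAt a (p, 1) := hsub.sub (hΛ'.clm_apply hhalf)
    have h1 : ContinuousAt (fun q => (a q, Λ q.2)) (p, 1) := ha.prodMk hΛ'
    have h2 : (a (p, 1), Λ 1) = 0 := by simp [a, hΛ1]
    rw [← h2]
    exact h1
  have hunit' : ∀ᶠ q : E m × (E m →L[ℝ] E m) in 𝓝 (p, 1), IsUnit (q.2 + 1) := by
    have h1 : ContinuousAt (fun q : E m × (E m →L[ℝ] E m) => q.2 + 1) (p, 1) := by fun_prop
    exact h1.eventually (Units.isOpen.mem_nhds hunit)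
  have hnear : ∀ᶠ q : E m × (E m →L[ℝ] E m) in 𝓝 (p, 1), q.1 ∈ Metric.ball p (r / 4) :=
    continuousAt_fst.eventually (Metric.ball_mem_nhds p (by positivity))
  filter_upwards [hpar.eventually hsmall, hunit', hnear] with q hq hqu hqn hqs
  set w : E m × (E m →L[ℝ] E m) := (a q, Λ q.2) with hw
  obtain ⟨f, hf, hfs, hfsy, hfssy, hfeq⟩ := exists_symplectic_diffeo (hSw w) hq
  -- the vector field near `p`
  have hXin : ∀ y ∈ Metric.ball p (r / 4), hamField (S w) y = a q + Λ q.2 (y - p) := fun y hy => by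
    have h1 : S w =ᶠ[𝓝 y] fun y =>
        stdForm w.1 (y - p) + (1 / 2) * stdForm (w.2 (y - p)) (y - p) := by
      filter_upwards [Metric.isOpen_ball.mem_nhds hy] with z hz
      have h2 : χ z = 1 := χ.one_of_mem_closedBall (Metric.ball_subset_closedBall hz)
      simp [S, h2]
    rw [hamField, h1.fderiv_eq]
    refine stdSharp_eq fun v => ?_
    have h2 : HasFDerivAt (fun y : E m => y - p) (ContinuousLinearMap.id ℝ (E m)) y :=
      (hasFDerivAt_id y).sub_const p
    have h3 : HasFDerivAt (fun y : E m => stdFormL m (w.2 (y - p)) (y - p)) _ y :=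
      ((stdFormL m).hasFDerivAt.comp y (w.2.hasFDerivAt.comp y h2)).clm_apply h2
    have h4 : HasFDerivAt (fun y : E m => stdFormL m w.1 (y - p)) _ y :=
      (stdFormL m w.1).hasFDerivAt.comp y h2
    have h6 : HasFDerivAt (fun y : E m => stdForm w.1 (y - p) +
        (1 / 2) * stdForm (w.2 (y - p)) (y - p)) _ y := h4.add (h3.const_mul (1 / 2))
    rw [h6.fderiv]
    have h5 := stdForm_cayley hqs hqu (L := Λ q.2) rfl v (y - p)
    change stdForm (a q + Λ q.2 (y - p)) v = stdForm (a q) v +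
      (1 / 2) * (stdForm (Λ q.2 (y - p)) v + stdForm (Λ q.2 v) (y - p))
    rw [stdForm_add_left, h5, stdForm_swap v]
    ring
  have hmid : p + (1 / 2 : ℝ) • (q.1 - p) ∈ Metric.ball p (r / 4) := by
    rw [Metric.mem_ball, dist_eq_norm] at hqn ⊢
    rw [add_sub_cancel_left, norm_smul, Real.norm_of_nonneg (by norm_num)]
    linarith [norm_nonneg (q.1 - p)]
  have hXmid : hamField (S w) (p + (1 / 2 : ℝ) • (q.1 - p)) = q.1 - p := by
    rw [hXin _ hmid, add_sub_cancel_left]; simp [a]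
  have hDmid : fderiv ℝ (hamField (S w)) (p + (1 / 2 : ℝ) • (q.1 - p)) = Λ q.2 := by
    have h1 : hamField (S w) =ᶠ[𝓝 (p + (1 / 2 : ℝ) • (q.1 - p))] fun y => a q + Λ q.2 (y - p) := by
      filter_upwards [Metric.isOpen_ball.mem_nhds hmid] with z hz using hXin z hz
    rw [h1.fderiv_eq]
    exact (((Λ q.2).hasFDerivAt.comp _ ((hasFDerivAt_id _).sub_const p)).const_add (a q)).fderiv
  obtain ⟨h1, h2⟩ := hfeq (p + (1 / 2 : ℝ) • (q.1 - p))
  rw [hXmid, add_sub_cancel_right] at h1 h2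
  refine ⟨f, hf, hfs, hfsy, hfssy, fun y hy => ?_, ?_, ?_⟩
  · have h3 := (hfeq y).1
    rw [hXout w y fun h => hy (Metric.closedBall_subset_ball (by linarith) h)] at h3
    simpa using h3
  · rw [h1]; module
  · rw [hDmid] at h2
    refine ContinuousLinearMap.ext fun u => ?_
    -- `u` is the image of `(G u + u) / 2` under `1 - L / 2`
    have h3 : Ring.inverse (q.2 + 1) ((q.2 + 1) u) = u :=
      congrArg (fun L : E m →L[ℝ] E m => L u) (Ring.inverse_mul_cancel _ hqu)
    have h4 : Λ q.2 ((q.2 + 1) u) = (2 : ℝ) • (q.2 u - u) := by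
      change (2 : ℝ) • ((q.2 - 1) (Ring.inverse (q.2 + 1) ((q.2 + 1) u))) = _
      rw [h3]; rfl
    have h5 := congrArg (fun L : E m →L[ℝ] E m => L ((1 / 2 : ℝ) • (q.2 + 1) u)) h2
    simp only [ContinuousLinearMap.comp_apply, _root_.sub_apply, _root_.add_apply,
      _root_.smul_apply, ContinuousLinearMap.id_apply, map_smul] at h5 h4
    have h6 : (1 : E m →L[ℝ] E m) u = u := rfl
    rw [h6] at h4 h5
    rw [h4] at h5
    have h8 : q.2 u + u - (1 / 2 : ℝ) • (2 : ℝ) • (q.2 u - u) = (2 : ℝ) • u := by module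
    have h9 : q.2 u + u + (1 / 2 : ℝ) • (2 : ℝ) • (q.2 u - u) = (2 : ℝ) • q.2 u := by module
    rw [h8, h9, map_smul, smul_smul, smul_smul] at h5
    norm_num at h5
    exact h5

end Cayley

end SymplecticBalls
end
noncomputable section
namespace SymplecticBalls

universe u

variable {m n : ℕ} {M : Type u} [TopologicalSpace M] [ChartedSpace (E m) M]
  [IsManifold 𝓘(ℝ, E m) ∞ M] {σ : SymplecticForm m M} {φ : OpenPartialHomeomorph M (E m)}

/-! ### Symplectic diffeomorphisms -/

variable (σ) in
/-- A symplectic self-map of `M`, characterised by its action on continuous families of local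
symplectic maps. -/
def IsSympMap (Φ : M → M) : Prop :=
  ∀ {P : Type u} [TopologicalSpace P] (Y : P → E m → M) (p : P) (z : E m),
    GoodAt σ Y p z → GoodAt σ (fun p z => Φ (Y p z)) p z

theorem IsSympMap.id : IsSympMap σ (_root_.id : M → M) := fun _ _ _ h => h

theorem IsSympMap.comp {Φ Ψ : M → M} (hΦ : IsSympMap σ Φ) (hΨ : IsSympMap σ Ψ) :
    IsSympMap σ fun x => Φ (Ψ x) := fun Y p z h => hΦ _ p z (hΨ Y p z h)

theorem IsSympMap.mdifferentiable (hD : ∀ x : M, ∃ φ, IsDarboux σ φ ∧ x ∈ φ.source) {Φ : M → M}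
    (hΦ : IsSympMap σ Φ) (x : M) : MDifferentiableAt 𝓘(ℝ, E m) 𝓘(ℝ, E m) Φ x := by
  obtain ⟨φ, hφ, hx⟩ := hD x
  have h1 : GoodAt σ (fun _ : PUnit.{u + 1} => affineGerm φ 0 (ContinuousLinearMap.id ℝ (E m)))
      PUnit.unit (φ x) :=
    goodAt_affineGerm hφ continuous_const continuous_const (fun _ => IsSymplectic.id)
      (by simpa using φ.map_source hx)
  have h2 : MDifferentiableAt 𝓘(ℝ, E m) 𝓘(ℝ, E m)
      (fun z => Φ (affineGerm φ 0 (ContinuousLinearMap.id ℝ (E m)) z)) (φ x) :=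
    ((hΦ _ _ _ h1).contMDiffAt).mdifferentiableAt (by simp)
  have h3 := h2.comp x ((contMDiffAt_chart hφ.1 hx).mdifferentiableAt (by simp))
  refine h3.congr_of_eventuallyEq ?_
  filter_upwards [φ.open_source.mem_nhds hx] with w hw
  simp [affineGerm, φ.left_inv hw]

/-- The image of a frame under a map. -/
def pushFrame (Φ : M → M) (A : HomTM m M) : HomTM m M :=
  ⟨Φ A.proj, (mfderiv 𝓘(ℝ, E m) 𝓘(ℝ, E m) Φ A.proj : E m →L[ℝ] E m).comp
    (show E m →L[ℝ] E m from A.snd)⟩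

theorem frameOf_comp {Φ : M → M} {y : E m → M}
    (hΦ : MDifferentiableAt 𝓘(ℝ, E m) 𝓘(ℝ, E m) Φ (y 0))
    (hy : MDifferentiableAt 𝓘(ℝ, E m) 𝓘(ℝ, E m) y 0) :
    frameOf (fun z => Φ (y z)) = pushFrame Φ (frameOf y) :=
  homTM_ext rfl (mfderiv_comp (I := 𝓘(ℝ, E m)) (I' := 𝓘(ℝ, E m)) (I'' := 𝓘(ℝ, E m)) 0 hΦ hy)

theorem pushFrame_comp {Φ Ψ : M → M} {A : HomTM m M}
    (hΦ : MDifferentiableAt 𝓘(ℝ, E m) 𝓘(ℝ, E m) Φ (Ψ A.proj))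
    (hΨ : MDifferentiableAt 𝓘(ℝ, E m) 𝓘(ℝ, E m) Ψ A.proj) :
    pushFrame (fun x => Φ (Ψ x)) A = pushFrame Φ (pushFrame Ψ A) := by
  refine homTM_ext rfl ?_
  have h := mfderiv_comp (I := 𝓘(ℝ, E m)) (I' := 𝓘(ℝ, E m)) (I'' := 𝓘(ℝ, E m)) A.proj hΦ hΨ
  exact congrArg (fun L : E m →L[ℝ] E m => L.comp (show E m →L[ℝ] E m from A.snd)) h

theorem pushFrame_of_eventuallyEq {Φ : M → M} {A : HomTM m M} (h : Φ =ᶠ[𝓝 A.proj] id) :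
    pushFrame Φ A = A := by
  have h1 := h.mfderiv_eq (I := 𝓘(ℝ, E m)) (I' := 𝓘(ℝ, E m))
  rw [mfderiv_id] at h1
  exact homTM_ext h.eq_of_nhds
    (congrArg (fun L : E m →L[ℝ] E m => L.comp (show E m →L[ℝ] E m from A.snd)) h1)

open Classical in
/-- The extension by the identity of a map in a chart. -/
def chartExtend (φ : OpenPartialHomeomorph M (E m)) (f : E m → E m) (x : M) : M :=
  if x ∈ φ.source then φ.symm (f (φ x)) else x

theorem chartExtend_of_mem {x : M} (hx : x ∈ φ.source) (f : E m → E m) :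
    chartExtend φ f x = φ.symm (f (φ x)) := if_pos hx

theorem chartExtend_of_notMem {x : M} (hx : x ∉ φ.source) (f : E m → E m) :
    chartExtend φ f x = x := if_neg hx

section ChartExtend

variable {p : E m} {r : ℝ}

theorem map_target_of_fixed (f : E m ≃ E m) (hf : ∀ y ∉ Metric.ball p r, f y = y)
    (hr : Metric.closedBall p r ⊆ φ.target) {y : E m} (hy : y ∈ φ.target) : f y ∈ φ.target := by
  by_cases h : f y ∈ Metric.ball p r
  · exact hr (Metric.ball_subset_closedBall h)
  · rwa [f.injective (hf _ h)]

theorem chartExtend_chartExtend {f g : E m → E m} (hfg : ∀ y, g (f y) = y)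
    (hf : ∀ y ∈ φ.target, f y ∈ φ.target) (x : M) : chartExtend φ g (chartExtend φ f x) = x := by
  by_cases hx : x ∈ φ.source
  · have h1 := hf _ (φ.map_source hx)
    rw [chartExtend_of_mem hx, chartExtend_of_mem (φ.map_target h1), φ.right_inv h1, hfg,
      φ.left_inv hx]
  · rw [chartExtend_of_notMem hx, chartExtend_of_notMem hx]

theorem chartExtend_of_fixed {f : E m → E m} (hf : ∀ y ∉ Metric.ball p r, f y = y) {x : M}
    (hx : x ∉ φ.symm '' Metric.closedBall p r) : chartExtend φ f x = x := by
  by_cases h : x ∈ φ.source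
  · rw [chartExtend_of_mem h, hf _ fun hb => hx ⟨φ x, Metric.ball_subset_closedBall hb,
      φ.left_inv h⟩, φ.left_inv h]
  · exact chartExtend_of_notMem h f

theorem isSympMap_chartExtend [T2Space M] (hφ : IsDarboux σ φ) {f : E m → E m}
    (hfc : ContDiff ℝ ∞ f) (hfs : ∀ y, IsSymplectic (fderiv ℝ f y))
    (hf : ∀ y ∉ Metric.ball p r, f y = y) (hr : Metric.closedBall p r ⊆ φ.target)
    (hft : ∀ y ∈ φ.target, f y ∈ φ.target) : IsSympMap σ (chartExtend φ f) := by
  intro P _ Y p₀ z₀ hY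
  by_cases h0 : Y p₀ z₀ ∈ φ.source
  · obtain ⟨Ω, hΩ, hmem, hg⟩ := hY.exists_goodOn hφ h0
    have he : ∀ q ∈ Ω, φ (chartExtend φ f (Y q.1 q.2)) = f (φ (Y q.1 q.2)) := fun q hq => by
      rw [chartExtend_of_mem (hg.1 q hq), φ.right_inv (hft _ (φ.map_source (hg.1 q hq)))]
    refine ⟨φ, hφ, Ω, hΩ, hmem, fun q hq => ?_, fun k => ?_, fun q hq => ?_⟩
    · change chartExtend φ f (Y q.1 q.2) ∈ φ.source
      rw [chartExtend_of_mem (hg.1 q hq)]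
      exact φ.map_target (hft _ (φ.map_source (hg.1 q hq)))
    · exact ((hg.2.1 k).comp_left (f := f) hΩ fun q _ =>
        (hfc.of_le (by exact_mod_cast le_top)).contDiffAt).congr hΩ he
    · have h1 : (fun z => φ (chartExtend φ f (Y q.1 z))) =ᶠ[𝓝 q.2] f ∘ fun z => φ (Y q.1 z) := by
        filter_upwards [slice_mem_nhds hΩ hq] with z hz using he (q.1, z) hz
      rw [h1.fderiv_eq, fderiv_comp q.2 (hfc.differentiable (by simp) _)
        (((hg.2.1 1).1 q hq).differentiableAt (by simp))]
      exact (hfs _).comp (hg.2.2 q hq)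
  · have hcl : IsClosed (φ.symm '' Metric.closedBall p r) :=
      ((isCompact_closedBall p r).image_of_continuousOn (φ.continuousOn_symm.mono hr)).isClosed
    have h1 : Y p₀ z₀ ∉ φ.symm '' Metric.closedBall p r := by
      rintro ⟨y, hy, hyY⟩
      exact h0 (hyY ▸ φ.map_target (hr hy))
    refine hY.congr ?_
    filter_upwards [hY.continuousAt.eventually (hcl.isOpen_compl.mem_nhds h1)] with q hq
    exact chartExtend_of_fixed hf hq

end ChartExtend

/-- Symplectic diffeomorphisms supported near a point act locally transitively on the frames at
points nearby. -/
theorem eventually_exists_perm [T2Space M] (hD : ∀ x : M, ∃ φ, IsDarboux σ φ ∧ x ∈ φ.source)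
    (A : Fr σ) {U : Set M} (hU : U ∈ 𝓝 A.1.proj) :
    ∀ᶠ B in 𝓝 A, ∃ Φ : Equiv.Perm M, IsSympMap σ Φ ∧ IsSympMap σ Φ.symm ∧ (∀ x ∉ U, Φ x = x) ∧
      pushFrame Φ A.1 = B.1 := by
  obtain ⟨φ, hφ, hx⟩ := hD A.1.proj
  set p := φ A.1.proj with hp
  obtain ⟨r, hr, hrs⟩ : ∃ r > 0, Metric.closedBall p r ⊆ φ.target ∩ φ.symm ⁻¹' U := by
    refine Metric.nhds_basis_closedBall.mem_iff.1 (Filter.inter_mem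
      (φ.open_target.mem_nhds (φ.map_source hx)) ?_)
    refine (φ.continuousAt_symm (φ.map_source hx)).preimage_mem_nhds ?_
    rwa [φ.left_inv hx]
  have hA := Fr.isSymplectic_frameMat hφ A hx
  have hproj : ContinuousAt (fun B : Fr σ => B.1.proj) A := Fr.continuous_proj.continuousAt
  have hq : Filter.Tendsto (fun B : Fr σ => (φ B.1.proj,
      (frameMat φ B.1).comp (hA.equiv.symm : E m →L[ℝ] E m))) (𝓝 A) (𝓝 (p, 1)) := by
    have h1 : ContinuousAt (fun B : Fr σ => φ B.1.proj) A :=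
      ContinuousAt.comp (f := fun B : Fr σ => B.1.proj) (φ.continuousAt hx) hproj
    have h2 : ContinuousAt (fun B : Fr σ => frameMat φ B.1) A :=
      ContinuousAt.comp (f := fun B : Fr σ => B.1) (continuousAt_frameMat hφ.1 hx)
        Fr.continuous_val.continuousAt
    have h3 := h1.prodMk (h2.clm_comp (continuousAt_const (y := (hA.equiv.symm : E m →L[ℝ] E m))))
    rw [ContinuousAt] at h3
    convert h3 using 2
    refine Prod.ext rfl (ContinuousLinearMap.ext fun u => ?_)
    exact (hA.equiv.apply_symm_apply u).symm
  filter_upwards [hq.eventually (eventually_exists_symplectic_diffeo p hr),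
    hproj.eventually (φ.open_source.mem_nhds hx)] with B hB hBs
  obtain ⟨f, hf, hfs, hfy, hfsy, hfix, hfp, hfd⟩ :=
    hB ((Fr.isSymplectic_frameMat hφ B hBs).comp hA.equiv_symm)
  have hrt : Metric.closedBall p r ⊆ φ.target := fun y hy => (hrs hy).1
  have hfix' : ∀ y ∉ Metric.ball p r, f.symm y = y := fun y hy => by
    rw [Equiv.symm_apply_eq, hfix y hy]
  have hft : ∀ y ∈ φ.target, f y ∈ φ.target := fun y => map_target_of_fixed f hfix hrt
  have hft' : ∀ y ∈ φ.target, f.symm y ∈ φ.target := fun y => map_target_of_fixed f.symm hfix' hrt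
  let Φ : Equiv.Perm M := ⟨chartExtend φ f, chartExtend φ f.symm,
    chartExtend_chartExtend f.symm_apply_apply hft, chartExtend_chartExtend f.apply_symm_apply hft'⟩
  have hΦ : IsSympMap σ Φ := isSympMap_chartExtend hφ hf hfy hfix hrt hft
  refine ⟨Φ, hΦ, isSympMap_chartExtend hφ hfs hfsy hfix' hrt hft', fun x hxU => ?_, ?_⟩
  · refine chartExtend_of_fixed hfix ?_
    rintro ⟨y, hy, rfl⟩
    exact hxU (hrs hy).2
  · -- compute the image of the frame by means of the affine germ representing it
    set y := affineGerm φ (φ A.1.proj) (frameMat φ A.1) with hy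
    have hfy : frameOf y = A.1 := frameOf_affineGerm hφ A hx
    have hy0 : y 0 = A.1.proj := congrArg (fun A : HomTM m M => A.proj) hfy
    have hyg : GoodAt σ (fun _ : PUnit.{u + 1} => y) PUnit.unit 0 :=
      goodAt_affineGerm hφ continuous_const continuous_const (fun _ => hA)
        (by simpa using φ.map_source hx)
    have hyd : MDifferentiableAt 𝓘(ℝ, E m) 𝓘(ℝ, E m) y 0 :=
      hyg.contMDiffAt.mdifferentiableAt (by simp)
    have hΦd : MDifferentiableAt 𝓘(ℝ, E m) 𝓘(ℝ, E m) Φ (y 0) := hΦ.mdifferentiable hD _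
    have hΦx : Φ A.1.proj = φ.symm (f p) := chartExtend_of_mem hx f
    have hfpt : f p ∈ φ.target := hft _ (φ.map_source hx)
    have hsrc : Φ A.1.proj ∈ φ.source := hΦx ▸ φ.map_target hfpt
    refine frame_ext hφ.1 hsrc hBs ?_ ?_
    · change φ (Φ A.1.proj) = _
      rw [hΦx, φ.right_inv hfpt, hfp]
    · conv_lhs => rw [← hfy, ← frameOf_comp hΦd hyd]
      have hcd : MDifferentiableAt 𝓘(ℝ, E m) 𝓘(ℝ, E m) (fun z => Φ (y z)) 0 := hΦd.comp 0 hyd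
      have hsrc0 : Φ (y 0) ∈ φ.source := by rw [hy0]; exact hsrc
      change frameMat φ (frameOf fun z => Φ (y z)) = _
      rw [frameMat_frameOf hφ.1 hcd hsrc0]
      have h1 : (fun z => φ (Φ (y z))) =ᶠ[𝓝 0] f ∘ fun z => φ (y z) := by
        filter_upwards [hyd.continuousAt.eventually
          (φ.open_source.mem_nhds (by rw [hy0]; exact hx))] with z hz
        change φ (chartExtend φ f (y z)) = f (φ (y z))
        rw [chartExtend_of_mem hz, φ.right_inv (hft _ (φ.map_source hz))]
      have h2 : DifferentiableAt ℝ (fun z => φ (y z)) 0 :=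
        (contDiffAt_chart_comp hφ.1 hyg.contMDiffAt (by rw [hy0]; exact hx)).differentiableAt
          (by simp)
      rw [h1.fderiv_eq, fderiv_comp 0 (hf.differentiable (by simp) _) h2,
        ← frameMat_frameOf hφ.1 hyd (by rw [hy0]; exact hx), hfy, hy0, ← hp, hfd]
      refine ContinuousLinearMap.ext fun u => ?_
      exact congrArg (frameMat φ B.1) (hA.equiv.symm_apply_apply u)

variable (σ) in
/-- Tuples of frames that are related by a symplectic diffeomorphism. -/
def Moves (a b : Fin n → HomTM m M) : Prop :=
  ∃ Φ : Equiv.Perm M, IsSympMap σ Φ ∧ IsSympMap σ Φ.symm ∧ ∀ i, pushFrame Φ (a i) = b i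

theorem Moves.refl (a : Fin n → HomTM m M) : Moves σ a a :=
  ⟨Equiv.refl M, IsSympMap.id, IsSympMap.id, fun _ =>
    pushFrame_of_eventuallyEq Filter.EventuallyEq.rfl⟩

theorem pushFrame_symm (hD : ∀ x : M, ∃ φ, IsDarboux σ φ ∧ x ∈ φ.source) {Φ : Equiv.Perm M}
    (hΦ : IsSympMap σ Φ) (hΦ' : IsSympMap σ Φ.symm) (A : HomTM m M) :
    pushFrame Φ.symm (pushFrame Φ A) = A := by
  rw [← pushFrame_comp (hΦ'.mdifferentiable hD _) (hΦ.mdifferentiable hD _)]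
  exact pushFrame_of_eventuallyEq (Filter.Eventually.of_forall fun x => Φ.symm_apply_apply x)

theorem Moves.symm (hD : ∀ x : M, ∃ φ, IsDarboux σ φ ∧ x ∈ φ.source) {a b : Fin n → HomTM m M}
    (h : Moves σ a b) : Moves σ b a := by
  obtain ⟨Φ, h1, h2, h3⟩ := h
  exact ⟨Φ.symm, h2, h1, fun i => by rw [← h3, pushFrame_symm hD h1 h2]⟩

theorem Moves.trans (hD : ∀ x : M, ∃ φ, IsDarboux σ φ ∧ x ∈ φ.source) {a b c : Fin n → HomTM m M}
    (h : Moves σ a b) (h' : Moves σ b c) : Moves σ a c := by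
  obtain ⟨Φ, h1, h2, h3⟩ := h
  obtain ⟨Φ', h1', h2', h3'⟩ := h'
  refine ⟨Φ.trans Φ', h1'.comp h1, h2.comp h2', fun i => ?_⟩
  rw [← h3', ← h3]
  exact pushFrame_comp (h1'.mdifferentiable hD _) (h1.mdifferentiable hD _)

/-- Symplectic diffeomorphisms act locally transitively on tuples of frames at distinct points. -/
theorem eventually_moves [T2Space M] (hD : ∀ x : M, ∃ φ, IsDarboux σ φ ∧ x ∈ φ.source)
    (A : SpFr σ n) : ∀ᶠ B : SpFr σ n in 𝓝 A, Moves σ A.1 B.1 := by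
  obtain ⟨U, hU, hUd⟩ : ∃ U : Fin n → Set M, (∀ i, A.pt i ∈ U i ∧ IsOpen (U i)) ∧
      ∀ i j, i ≠ j → Disjoint (U i) (U j) := by
    obtain ⟨U, hU, hUd⟩ := (Set.finite_range A.pt).t2_separation
    exact ⟨fun i => U (A.pt i), fun i => hU _, fun i j hij =>
      hUd (mem_range_self i) (mem_range_self j) fun h => hij (A.pt_injective h)⟩
  have h1 : ∀ᶠ B : SpFr σ n in 𝓝 A, ∀ i, ∃ Φ : Equiv.Perm M, IsSympMap σ Φ ∧
      IsSympMap σ Φ.symm ∧ (∀ x ∉ U i, Φ x = x) ∧ pushFrame Φ (A.1 i) = B.1 i :=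
    Filter.eventually_all.2 fun i => (SpFr.continuous_fr i).continuousAt.eventually
      (eventually_exists_perm hD (A.fr i) ((hU i).2.mem_nhds (hU i).1))
  have h2 : ∀ᶠ B : SpFr σ n in 𝓝 A, ∀ i, B.pt i ∈ U i :=
    Filter.eventually_all.2 fun i => (SpFr.continuous_pt i).continuousAt.eventually
      ((hU i).2.mem_nhds (hU i).1)
  filter_upwards [h1, h2] with B hB hBU
  -- move the frames one after the other
  classical
  have key : ∀ s : Finset (Fin n), Moves σ A.1 fun i => if i ∈ s then B.1 i else A.1 i := by
    intro s
    induction s using Finset.induction_on with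
    | empty => simpa using Moves.refl A.1
    | insert j s hj ih =>
      refine ih.trans hD ?_
      obtain ⟨Φ, hΦ, hΦ', hfix, hpush⟩ := hB j
      refine ⟨Φ, hΦ, hΦ', fun i => ?_⟩
      rcases eq_or_ne i j with rfl | hij
      · simp [hj, hpush]
      · have hnear : ∀ x ∈ U i, Φ =ᶠ[𝓝 x] id := fun x hx => by
          filter_upwards [(hU i).2.mem_nhds hx] with w hw
          exact hfix w fun h => (hUd i j hij).le_bot ⟨hw, h⟩
        by_cases his : i ∈ s
        · simp only [his, Finset.mem_insert, or_true, if_true]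
          exact pushFrame_of_eventuallyEq (hnear _ (hBU i))
        · simp only [his, hij, Finset.mem_insert, or_false, if_false]
          exact pushFrame_of_eventuallyEq (hnear _ (hU i).1)
  simpa using key Finset.univ

/-- A deformation of the space of tuples of frames moves each tuple within its orbit under symplectic
diffeomorphisms, since the orbits are open and the path of the tuple is connected. -/
theorem Moves.of_homotopic [T2Space M] (hD : ∀ x : M, ∃ φ, IsDarboux σ φ ∧ x ∈ φ.source)
    {h : C(SpFr σ n, SpFr σ n)} (H : (ContinuousMap.id (SpFr σ n)).Homotopic h) (A : SpFr σ n) :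
    Moves σ (h A).1 A.1 := by
  obtain ⟨F⟩ := H
  have key := PreconnectedSpace.induction₂'
    (fun t t' : unitInterval => Moves σ (F (t, A)).1 (F (t', A)).1) (fun t => by
      have hc : Continuous fun t' : unitInterval => F (t', A) := by fun_prop
      filter_upwards [hc.continuousAt.eventually (eventually_moves hD (F (t, A)))] with _ h
      exact ⟨h, h.symm hD⟩)
    ⟨fun _ _ _ h h' => h.trans hD h'⟩ 1 0
  simpa using key

/-! ### Surjectivity on homotopy groups -/

/-- The action of a symplectic diffeomorphism on tuples of frames. -/
theorem exists_pushSp [T2Space M] [CompactSpace M]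
    (hD : ∀ x : M, ∃ φ, IsDarboux σ φ ∧ x ∈ φ.source) {Φ : Equiv.Perm M} (hΦ : IsSympMap σ Φ)
    (n : ℕ) : ∃ g : C(SpFr σ n, SpFr σ n), ∀ A i, (g A).1 i = pushFrame Φ (A.1 i) := by
  obtain ⟨Op, s, -, hs, hfs, -⟩ := exists_section hD
  have hs0 : ∀ A : Fr σ, s A 0 = A.1.proj := fun A =>
    congrArg (fun A : HomTM m M => A.proj) (hfs A)
  obtain ⟨g, hg⟩ := exists_continuous_frame (P := SpFr σ n)
    (Y := fun i A z => Φ (s (A.fr i) z))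
    (fun A i => hΦ (fun A : SpFr σ n => s (A.fr i)) A 0 (GoodAt.comap (hs _) (SpFr.continuous_fr i)))
    (fun A => by simp only [hs0]; exact Φ.injective.comp A.2.1)
  refine ⟨g, fun A i => ?_⟩
  rw [hg, frameOf_comp (hΦ.mdifferentiable hD _) ((hs _).contMDiffAt.mdifferentiableAt (by simp)),
    hfs]
  rfl

/-- A deformation `h` into a compact set lifts to the embeddings of small balls. For surjectivity over
the base point `A`, the lift is conjugated with a symplectic diffeomorphism that carries `h A` to
`A`. -/
theorem exists_capacities [T2Space M] [CompactSpace M]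
    (hD : ∀ x : M, ∃ φ, IsDarboux σ φ ∧ x ∈ φ.source) (n : ℕ) :
    ∃ c₀ : Cap n, ∀ c : Cap n, c ≤ c₀ →
      Function.Surjective (pi0Map (jc σ c)) ∧
      ∀ A : SpFr σ n, ∃ f : Emb σ c, jc σ c f = A ∧
        ∀ k : ℕ, 1 ≤ k → Function.Surjective (piMap k (jc σ c) f) := by
  obtain ⟨h, hid, K, hK, hKh⟩ := exists_deformation hD n
  obtain ⟨Op, s, -, hs, hfs, -⟩ := exists_section hD
  have hs0 : ∀ A : Fr σ, s A 0 = A.1.proj := fun A =>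
    congrArg (fun A : HomTM m M => A.proj) (hfs A)
  have := isCompact_iff_compactSpace.1 hK
  obtain ⟨c₀, hc₀⟩ := exists_embCond_of_compact (P := K) (Y := fun i A => s (A.1.fr i))
    (fun A i => GoodAt.comap (a := fun A : K => A.1.fr i) (hs _)
      ((SpFr.continuous_fr i).comp continuous_subtype_val))
    (fun A => by simp only [hs0]; exact A.1.2.1)
  refine ⟨c₀, fun c hc => ?_⟩
  have main : ∀ A : SpFr σ n, ∃ f : Emb σ c, jc σ c f = A ∧
      ∀ k : ℕ, 1 ≤ k → Function.Surjective (piMap k (jc σ c) f) := by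
    intro A
    obtain ⟨Φ, hΦ, hΦ', hΦA⟩ := Moves.of_homotopic hD hid A
    obtain ⟨g, hg⟩ := exists_pushSp hD hΦ n
    obtain ⟨g', hg'⟩ := exists_pushSp hD hΦ' n
    have hg'g : ∀ B, g' (g B) = B := fun B => Subtype.ext (funext fun i => by
      rw [hg', hg, pushFrame_symm hD hΦ hΦ'])
    have hgg' : ∀ B, g (g' B) = B := fun B => Subtype.ext (funext fun i => by
      rw [hg, hg']; exact pushFrame_symm hD hΦ' hΦ _)
    -- `W` is the lift of `g ∘ h ∘ g'`, which is homotopic to the identity and maps `g A` to `A`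
    -- since `g' (g A) = A`
    let a : SpFr σ n → K := fun B => ⟨h (g' B), hKh _⟩
    have ha : Continuous a := Continuous.subtype_mk (h.continuous.comp g'.continuous) _
    have hcond : ∀ B, EmbCond σ c (fun i (B : SpFr σ n) z => Φ (s ((h (g' B)).fr i) z)) B :=
      fun B => EmbCond.anti ⟨fun i z hz => hΦ (fun B : SpFr σ n => s ((h (g' B)).fr i)) B z
        (GoodAt.comap (Y := fun A : K => s (A.1.fr i)) (a := a) ((hc₀ (a B)).1 i z hz) ha),
        fun i j z hz w hw hzw => (hc₀ (a B)).2 i j z hz w hw (Φ.injective hzw)⟩ hc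
    let W : C(SpFr σ n, Emb σ c) := ⟨fun B => (hcond B).toEmb, continuous_toEmb hcond⟩
    have hW : ∀ B, jc σ c (W B) = g (h (g' B)) := fun B => Subtype.ext (funext fun i => by
      refine (jc_toEmb (hcond B) i).trans ?_
      rw [frameOf_comp (hΦ.mdifferentiable hD _)
        ((hs _).contMDiffAt.mdifferentiableAt (by simp)), hfs, hg]
      rfl)
    have hWid : (ContinuousMap.id (SpFr σ n)).Homotopic ((jc σ c).comp W) := by
      have h1 : (jc σ c).comp W = (g.comp h).comp g' := ContinuousMap.ext hW
      have h2 : ContinuousMap.id (SpFr σ n) = (g.comp (ContinuousMap.id _)).comp g' :=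
        ContinuousMap.ext fun B => (hgg' B).symm
      rw [h1, h2]
      exact ((ContinuousMap.Homotopic.refl g).comp hid).comp (ContinuousMap.Homotopic.refl g')
    refine ⟨W (g A), ?_, fun k _ p => ?_⟩
    · rw [hW, hg'g]
      exact Subtype.ext (funext fun i => by rw [hg, hΦA])
    · obtain ⟨q, hq⟩ := (piMap_bijective_of_homotopic_id hWid k (g A)).2 p
      exact ⟨piMap k W (g A) q, by rw [← hq, piMap_comp]⟩
  refine ⟨?_, main⟩
  rintro ⟨A⟩
  obtain ⟨f, hf, -⟩ := main A
  exact ⟨ZerothHomotopy.mk f, congrArg ZerothHomotopy.mk hf⟩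

end SymplecticBalls
end

noncomputable section

namespace SymplecticBalls

/-! ### Superposition operators and smooth dependence of flows on initial values -/

section Superposition

variable {V G : Type} [NormedAddCommGroup V] [NormedSpace ℝ V] [NormedAddCommGroup G]
  [NormedSpace ℝ G]

variable (V) in
/-- The Banach space of continuous curves `[0, 1] → V`. -/
def Curve : Type := C(unitInterval, V)

instance : NormedAddCommGroup (Curve V) := inferInstanceAs (NormedAddCommGroup C(unitInterval, V))

instance : NormedSpace ℝ (Curve V) := inferInstanceAs (NormedSpace ℝ C(unitInterval, V))

instance [CompleteSpace V] : CompleteSpace (Curve V) :=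
  inferInstanceAs (CompleteSpace C(unitInterval, V))

instance : FunLike (Curve V) unitInterval V :=
  inferInstanceAs (FunLike C(unitInterval, V) unitInterval V)

namespace Curve

@[continuity, fun_prop] theorem continuous (γ : Curve V) : Continuous γ := ContinuousMap.continuous γ

@[ext] theorem ext {γ η : Curve V} (h : ∀ s, γ s = η s) : γ = η := ContinuousMap.ext h

@[simp] theorem zero_apply (s : unitInterval) : (0 : Curve V) s = 0 := rfl

@[simp] theorem add_apply (γ η : Curve V) (s : unitInterval) : (γ + η) s = γ s + η s := rfl

@[simp] theorem sub_apply (γ η : Curve V) (s : unitInterval) : (γ - η) s = γ s - η s := rfl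

theorem norm_apply_le (γ : Curve V) (s : unitInterval) : ‖γ s‖ ≤ ‖γ‖ :=
  ContinuousMap.norm_coe_le_norm (f := γ) s

theorem norm_le (γ : Curve V) {C : ℝ} (hC : 0 ≤ C) : ‖γ‖ ≤ C ↔ ∀ s, ‖γ s‖ ≤ C :=
  ContinuousMap.norm_le (f := γ) hC

variable (V) in
/-- Constant curves. -/
def const : V →L[ℝ] Curve V := ContinuousLinearMap.const ℝ unitInterval

@[simp] theorem const_apply (v : V) (s : unitInterval) : const V v s = v := rfl

variable (V) in
/-- Evaluation of curves at `s`. -/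
def eval (s : unitInterval) : Curve V →L[ℝ] V := ContinuousMap.evalCLM ℝ s

end Curve

/-- The superposition operator `γ ↦ (s ↦ F (s, γ s))` on continuous curves. -/
def superpose (F : C(ℝ × V, G)) (γ : Curve V) : Curve G :=
  (⟨fun s => F ((s : ℝ), γ s), by fun_prop⟩ : C(unitInterval, G))

@[simp] theorem superpose_apply (F : C(ℝ × V, G)) (γ : Curve V) (s : unitInterval) :
    superpose F γ s = F ((s : ℝ), γ s) := rfl

theorem continuous_superpose (F : C(ℝ × V, G)) : Continuous (superpose F) := by
  have h : superpose F = fun γ : C(unitInterval, V) =>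
      F.comp ((⟨Subtype.val, continuous_subtype_val⟩ : C(unitInterval, ℝ)).prodMk γ) := rfl
  rw [h]
  refine (ContinuousMap.continuous_postcomp F).comp ?_
  exact ContinuousMap.continuous_of_continuous_uncurry _ (by
    change Continuous fun q : C(unitInterval, V) × unitInterval => ((q.2 : ℝ), q.1 q.2)
    fun_prop)

variable (V G) in
/-- Pointwise application of a curve of linear maps to a curve of vectors. -/
def curveApply : Curve (V →L[ℝ] G) →L[ℝ] Curve V →L[ℝ] Curve G :=
  LinearMap.mkContinuous₂
    (LinearMap.mk₂ ℝ (fun (A : Curve (V →L[ℝ] G)) (γ : Curve V) =>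
        ((⟨fun s => A s (γ s), by fun_prop⟩ : C(unitInterval, G)) : Curve G))
      (fun _ _ _ => rfl) (fun _ _ _ => rfl)
      (fun A _ _ => Curve.ext fun s => (A s).map_add _ _)
      (fun a A _ => Curve.ext fun s => (A s).map_smul a _)) 1
    (fun A γ => by
      rw [one_mul, Curve.norm_le _ (by positivity)]
      exact fun s => ((A s).le_opNorm _).trans
        (mul_le_mul (A.norm_apply_le s) (γ.norm_apply_le s) (by positivity) (by positivity)))

/-- The derivative in the second variable. -/
def spatialDeriv (F : ℝ × V → G) (q : ℝ × V) : V →L[ℝ] G :=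
  (fderiv ℝ F q).comp (ContinuousLinearMap.inr ℝ ℝ V)

theorem contDiff_spatialDeriv {F : ℝ × V → G} (hF : ContDiff ℝ ∞ F) :
    ContDiff ℝ ∞ (spatialDeriv F) :=
  (hF.fderiv_right (m := ∞) (by simp)).clm_comp contDiff_const

theorem hasFDerivAt_spatialDeriv {F : ℝ × V → G} (hF : ContDiff ℝ ∞ F) (t : ℝ) (y : V) :
    HasFDerivAt (fun y => F (t, y)) (spatialDeriv F (t, y)) y :=
  (hF.differentiable (by simp) (t, y)).hasFDerivAt.comp y (hasFDerivAt_prodMk_right t y)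

theorem hasFDerivAt_superpose {F : ℝ × V → G} (hF : ContDiff ℝ ∞ F) (γ : Curve V) :
    HasFDerivAt (superpose ⟨F, hF.continuous⟩)
      (curveApply V G (superpose ⟨spatialDeriv F, (contDiff_spatialDeriv hF).continuous⟩ γ)) γ := by
  rw [hasFDerivAt_iff_isLittleO_nhds_zero, Asymptotics.isLittleO_iff]
  intro ε hε
  obtain ⟨δ, hδ, h⟩ := Metric.continuousAt_iff.1 ((continuous_superpose
    ⟨spatialDeriv F, (contDiff_spatialDeriv hF).continuous⟩).continuousAt (x := γ)) ε hε
  filter_upwards [Metric.ball_mem_nhds (0 : Curve V) hδ] with η hη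
  rw [Curve.norm_le _ (by positivity)]
  intro s
  have hs : ∀ y ∈ Metric.ball (γ s) δ,
      ‖spatialDeriv F ((s : ℝ), y) - spatialDeriv F ((s : ℝ), γ s)‖ ≤ ε := by
    intro y hy
    -- the bound for paths is applied to the translate of `γ` by the constant `y - γ s`
    have h1 := h (x := γ + Curve.const V (y - γ s)) (by
      rw [dist_eq_norm, add_sub_cancel_left]
      refine ((Curve.norm_le _ (norm_nonneg (y - γ s))).2 fun _ => le_rfl).trans_lt ?_
      simpa [dist_eq_norm] using hy)
    rw [dist_eq_norm] at h1
    have h2 := (Curve.norm_apply_le _ s).trans h1.le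
    simpa using h2
  have hηs : γ s + η s ∈ Metric.ball (γ s) δ := by
    rw [mem_ball_iff_norm, add_sub_cancel_left]
    exact (η.norm_apply_le s).trans_lt (by simpa using hη)
  have h3 := (convex_ball (γ s) δ).norm_image_sub_le_of_norm_hasFDerivWithin_le'
    (f := fun y => F ((s : ℝ), y)) (f' := fun y => spatialDeriv F ((s : ℝ), y))
    (φ := spatialDeriv F ((s : ℝ), γ s)) (C := ε)
    (fun y _ => (hasFDerivAt_spatialDeriv hF s y).hasFDerivWithinAt) hs
    (Metric.mem_ball_self hδ) hηs
  rw [add_sub_cancel_left] at h3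
  exact h3.trans (mul_le_mul_of_nonneg_left (η.norm_apply_le s) hε.le)

/-- A superposition operator with smooth `F` is smooth. -/
theorem contDiff_superpose {F : ℝ × V → G} (hF : ContDiff ℝ ∞ F) :
    ContDiff ℝ ∞ (superpose ⟨F, hF.continuous⟩) := by
  have key : ∀ k : ℕ, ∀ (G : Type) [NormedAddCommGroup G] [NormedSpace ℝ G] (F : ℝ × V → G)
      (hF : ContDiff ℝ ∞ F), ContDiff ℝ k (superpose ⟨F, hF.continuous⟩) := by
    intro k
    induction k with
    | zero => exact fun G _ _ F hF => contDiff_zero.2 (continuous_superpose _)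
    | succ k ih =>
      intro G _ _ F hF
      have h := hasFDerivAt_superpose hF
      push_cast
      rw [contDiff_succ_iff_hasFDerivAt]
      exact ⟨_, (curveApply V G).contDiff.comp (ih _ _ (contDiff_spatialDeriv hF)), h⟩
  exact contDiff_infty.2 fun k => key k G F hF

variable [CompleteSpace G]

variable (G) in
/-- The primitive `t ↦ ∫₀ᵗ g` of a continuous path `g`. -/
def primitive : Curve G →L[ℝ] Curve G :=
  LinearMap.mkContinuous
    { toFun := fun g => (⟨fun t => ∫ s in (0 : ℝ)..t, Set.IccExtend zero_le_one g s, by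
        have h := intervalIntegral.continuous_primitive (μ := MeasureTheory.volume)
          (fun a b => (g.continuous.Icc_extend' (h := zero_le_one)).intervalIntegrable a b) 0
        exact h.comp continuous_subtype_val⟩ : C(unitInterval, G))
      map_add' := fun g g' => by
        refine Curve.ext fun t => ?_
        exact intervalIntegral.integral_add
          ((g.continuous.Icc_extend' (h := zero_le_one)).intervalIntegrable _ _)
          ((g'.continuous.Icc_extend' (h := zero_le_one)).intervalIntegrable _ _)
      map_smul' := fun a g => by
        refine Curve.ext fun t => ?_
        exact intervalIntegral.integral_smul a _ } 1
    (fun g => by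
      rw [one_mul, Curve.norm_le _ (norm_nonneg _)]
      intro t
      refine (intervalIntegral.norm_integral_le_of_norm_le_const fun s _ =>
        g.norm_apply_le _).trans ?_
      rw [sub_zero, abs_of_nonneg t.2.1]
      exact mul_le_of_le_one_right (norm_nonneg _) t.2.2)

theorem hasDerivAt_primitive (g : Curve G) (t : ℝ) :
    HasDerivAt (fun t : ℝ => ∫ s in (0 : ℝ)..t, Set.IccExtend zero_le_one g s)
      (Set.IccExtend zero_le_one g t) t := by
  have hc := g.continuous.Icc_extend' (h := zero_le_one)
  exact intervalIntegral.integral_hasDerivAt_right (hc.intervalIntegrable _ _)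
    (hc.stronglyMeasurableAtFilter _ _) hc.continuousAt

end Superposition

/-- The time-one map of a time-dependent vector field that vanishes to second order at the origin
is defined and smooth near the origin. Its value and its derivative at `x` are the end points of the
integral curve `c` starting at `x` and of the solutions `ξ u` of the linearised equation along
`c`. -/
theorem exists_flow {V : Type} [NormedAddCommGroup V] [NormedSpace ℝ V] [CompleteSpace V]
    {X : ℝ × V → V} (hX : ContDiff ℝ ∞ X) (h0 : ∀ t, X (t, 0) = 0)
    (hd : ∀ t, spatialDeriv X (t, 0) = 0) :
    ∃ ψ : V → V, (∀ᶠ x in 𝓝 0, ContDiffAt ℝ ∞ ψ x) ∧ ψ 0 = 0 ∧ ∀ U ∈ 𝓝 (0 : V), ∀ᶠ x in 𝓝 0,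
      ∃ (c : ℝ → V) (ξ : V → ℝ → V), c 0 = x ∧ c 1 = ψ x ∧ (∀ u, ξ u 0 = u) ∧
        (∀ u, ξ u 1 = fderiv ℝ ψ x u) ∧ ∀ t ∈ Icc (0 : ℝ) 1, c t ∈ U ∧
          HasDerivAt c (X (t, c t)) t ∧
          ∀ u, HasDerivAt (ξ u) (spatialDeriv X (t, c t) (ξ u t)) t := by
  -- integral curves are the solutions `γ` of `Ψ γ = const`; the inverse function theorem applies
  -- to `Ψ` at the constant path `0`
  set N := superpose (⟨X, hX.continuous⟩ : C(ℝ × V, V)) with hN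
  set DX : C(ℝ × V, V →L[ℝ] V) := ⟨spatialDeriv X, (contDiff_spatialDeriv hX).continuous⟩ with hDX
  set Ψ : Curve V → Curve V := fun γ => γ - primitive V (N γ) with hΨ
  have hΨs : ContDiff ℝ ∞ Ψ :=
    contDiff_id.sub ((primitive V).contDiff.comp (contDiff_superpose hX))
  have hΨd : ∀ γ, HasFDerivAt Ψ (ContinuousLinearMap.id ℝ _ -
      (primitive V).comp (curveApply V V (superpose DX γ))) γ := fun γ =>
    (hasFDerivAt_id γ).sub ((primitive V).hasFDerivAt.comp γ (hasFDerivAt_superpose hX γ))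
  have hDX0 : superpose DX 0 = 0 := Curve.ext fun s => hd s
  have hN0 : N 0 = 0 := Curve.ext fun s => h0 s
  have hΨ0 : Ψ 0 = 0 := by simp [hΨ, hN0]
  have hΨd0 : HasFDerivAt Ψ
      ((ContinuousLinearEquiv.refl ℝ (Curve V) : _ ≃L[ℝ] _) : _ →L[ℝ] _) 0 := by
    have h := hΨd 0
    rw [hDX0] at h
    simpa using h
  have hn : (∞ : WithTop ℕ∞) ≠ 0 := by simp
  set e := hΨs.contDiffAt.toOpenPartialHomeomorph Ψ hΨd0 hn with he
  have h0s : (0 : Curve V) ∈ e.source := hΨs.contDiffAt.mem_toOpenPartialHomeomorph_source hΨd0 hn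
  have h0t : (0 : Curve V) ∈ e.target := by
    have := e.map_source h0s
    rwa [show e 0 = 0 from hΨ0] at this
  set Λ : Curve V → Curve V := fun g => e.symm g with hΛ
  have hΛ0 : Λ 0 = 0 := by
    have := e.left_inv h0s
    rwa [show e 0 = 0 from hΨ0] at this
  have hΛc : ContinuousAt Λ 0 := e.continuousAt_symm h0t
  have hΛr : ∀ᶠ g in 𝓝 0, Ψ (Λ g) = g := by
    filter_upwards [e.open_target.mem_nhds h0t] with g hg using e.right_inv hg
  have hΛs : ∀ᶠ g in 𝓝 0, ContDiffAt ℝ ∞ Λ g := by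
    have hc : Continuous (fderiv ℝ Ψ) := hΨs.continuous_fderiv hn
    have h1 := ContinuousLinearEquiv.nhds (ContinuousLinearEquiv.refl ℝ (Curve V))
    rw [← hΨd0.fderiv] at h1
    have h2 := hΛc.eventually (hc.continuousAt.eventually (hΛ0.symm ▸ h1))
    filter_upwards [h2, e.open_target.mem_nhds h0t] with g hg hgt
    obtain ⟨A, hA⟩ := hg
    refine e.contDiffAt_symm hgt (f₀' := A) ?_ hΨs.contDiffAt
    rw [hA]
    exact (hΨs.differentiable hn _).hasFDerivAt
  let κ : V →L[ℝ] Curve V := Curve.const V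
  have hκ : Filter.Tendsto κ (𝓝 0) (𝓝 0) := by simpa using κ.continuous.tendsto 0
  set γ : V → Curve V := fun x => Λ (κ x) with hγ
  have hγs : ∀ᶠ x in 𝓝 0, ContDiffAt ℝ ∞ γ x := by
    filter_upwards [hκ.eventually hΛs] with x hx
    exact ContDiffAt.comp (g := Λ) x hx κ.contDiff.contDiffAt
  have hγ0 : γ 0 = 0 := by simp [hγ, hΛ0]
  let ev : Curve V →L[ℝ] V := Curve.eval V 1
  refine ⟨fun x => ev (γ x), hγs.mono fun x hx => ev.contDiff.contDiffAt.comp x hx, by simp [hγ0], fun U hU => ?_⟩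
  obtain ⟨r, hr, hrU⟩ := Metric.mem_nhds_iff.1 hU
  have hsmall : ∀ᶠ x in 𝓝 0, γ x ∈ Metric.ball (0 : Curve V) r :=
    hγs.self_of_nhds.continuousAt.eventually (by rw [hγ0]; exact Metric.ball_mem_nhds _ hr)
  have heq : ∀ᶠ x in 𝓝 0, Ψ (γ x) = κ x := hκ.eventually hΛr
  have hdiff : ∀ᶠ x in 𝓝 0, DifferentiableAt ℝ γ x := by
    filter_upwards [hγs] with x hx using hx.differentiableAt hn
  filter_upwards [hsmall, heq, heq.eventually_nhds, hdiff] with x hxr hx hxe hxd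
  have hlin : ∀ u, fderiv ℝ γ x u =
      κ u + primitive V (curveApply V V (superpose DX (γ x)) (fderiv ℝ γ x u)) := by
    intro u
    have h1 := (hΨd (γ x)).comp x hxd.hasFDerivAt
    have h2 : HasFDerivAt (fun x => Ψ (γ x)) κ x := κ.hasFDerivAt.congr_of_eventuallyEq hxe
    have h3 := congrArg (fun L : V →L[ℝ] Curve V => L u) (h1.unique h2)
    simp only [ContinuousLinearMap.comp_apply, _root_.sub_apply,
      ContinuousLinearMap.id_apply] at h3
    exact sub_eq_iff_eq_add.1 h3
  have hcx : ∀ t : unitInterval, γ x t = x + primitive V (N (γ x)) t := fun t => by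
    have := congrArg (fun g : Curve V => g t) (sub_eq_iff_eq_add.1 hx)
    exact this
  set c : ℝ → V := fun t => x + ∫ s in (0 : ℝ)..t, Set.IccExtend zero_le_one (N (γ x)) s with hc
  set ξ : V → ℝ → V := fun u t => u + ∫ s in (0 : ℝ)..t, Set.IccExtend zero_le_one
    (curveApply V V (superpose DX (γ x)) (fderiv ℝ γ x u)) s with hξ
  have hct : ∀ t : unitInterval, c t = γ x t := fun t => (hcx t).symm
  have hξt : ∀ u, ∀ t : unitInterval, ξ u t = fderiv ℝ γ x u t := fun u t => by
    rw [hlin u]; rfl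
  refine ⟨c, ξ, by simp [hc], hct 1, fun u => by simp [hξ], fun u => ?_, fun t ht => ⟨?_, ?_, ?_⟩⟩
  · rw [show (fderiv ℝ (fun x => ev (γ x)) x) = ev.comp (fderiv ℝ γ x) from
      (ev.hasFDerivAt.comp x hxd.hasFDerivAt).fderiv]
    exact hξt u 1
  · rw [hct ⟨t, ht⟩]
    refine hrU ?_
    rw [mem_ball_zero_iff] at hxr ⊢
    exact ((γ x).norm_apply_le _).trans_lt hxr
  · have h := (hasDerivAt_primitive (N (γ x)) t).const_add x
    rw [Set.IccExtend_of_mem _ _ ht] at h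
    rw [hct ⟨t, ht⟩]
    exact h
  · intro u
    have h := (hasDerivAt_primitive
      (curveApply V V (superpose DX (γ x)) (fderiv ℝ γ x u)) t).const_add u
    rw [Set.IccExtend_of_mem _ _ ht] at h
    rw [hct ⟨t, ht⟩, hξt u ⟨t, ht⟩]
    exact h

end SymplecticBalls
end

noncomputable section

-- this scoped instance, which is very costly for operator spaces, plays no role here
attribute [-instance] Bundle.instNormedAddCommGroupOfRiemannianBundleOfIsTopologicalAddGroupOfContinuousConstSMulReal

namespace SymplecticBalls

/-! ### Linear Darboux bases -/

/-- A nondegenerate alternating form admits families `e`, `f` of any length `k ≤ dim / 2` with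
`B(eᵢ, fⱼ) = δᵢⱼ` and `B(eᵢ, eⱼ) = B(fᵢ, fⱼ) = 0`. -/
theorem exists_symplectic_family {V : Type*} [AddCommGroup V] [Module ℝ V] [FiniteDimensional ℝ V]
    {B : V →ₗ[ℝ] V →ₗ[ℝ] ℝ} (hB : B.IsAlt) (hnd : ∀ u, (∀ v, B u v = 0) → u = 0) (k : ℕ)
    (hk : 2 * k ≤ Module.finrank ℝ V) :
    ∃ e f : Fin k → V, (∀ i j, B (e i) (e j) = 0) ∧ (∀ i j, B (f i) (f j) = 0) ∧
      ∀ i j, B (e i) (f j) = if i = j then 1 else 0 := by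
  induction k with
  | zero => exact ⟨fun _ => 0, fun _ => 0, by simp, by simp, fun i => i.elim0⟩
  | succ k ih =>
    obtain ⟨e, f, hee, hff, hef⟩ := ih (by omega)
    have hfe : ∀ i j, B (f i) (e j) = -if j = i then 1 else 0 := fun i j => by
      rw [← hB.neg, hef]
    -- the projection to the orthogonal complement of the span
    let P : V → V := fun x => x - ∑ i, (B x (f i) • e i - B x (e i) • f i)
    have hPe : ∀ x j, B (P x) (e j) = 0 := fun x j => by
      simp [P, hee, hfe]
    have hPf : ∀ x j, B (P x) (f j) = 0 := fun x j => by
      simp [P, hff, hef]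
    obtain ⟨x, hx⟩ : ∃ x, P x ≠ 0 := by
      by_contra! h
      have htop : Submodule.span ℝ (range (Sum.elim e f)) = ⊤ := by
        refine Submodule.eq_top_iff'.2 fun x => ?_
        rw [sub_eq_zero.1 (h x)]
        refine Submodule.sum_mem _ fun i _ => Submodule.sub_mem _ (Submodule.smul_mem _ _ ?_)
          (Submodule.smul_mem _ _ ?_)
        · exact Submodule.subset_span ⟨Sum.inl i, rfl⟩
        · exact Submodule.subset_span ⟨Sum.inr i, rfl⟩
      have h1 := finrank_range_le_card (R := ℝ) (Sum.elim e f)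
      rw [Set.finrank, htop, finrank_top, Fintype.card_sum, Fintype.card_fin] at h1
      omega
    obtain ⟨y, hy⟩ : ∃ y, B (P x) y = 1 := by
      obtain ⟨y, hy⟩ : ∃ y, B (P x) y ≠ 0 := by
        by_contra! h
        exact hx (hnd _ h)
      exact ⟨(B (P x) y)⁻¹ • y, by simp [hy]⟩
    have hxy : B (P x) (P y) = 1 := by
      simp only [show P y = y - ∑ i, (B y (f i) • e i - B y (e i) • f i) from rfl]
      simp [hPe, hPf, hy]
    have hPe' : ∀ x j, B (e j) (P x) = 0 := fun x j => by rw [← hB.neg, hPe, neg_zero]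
    have hPf' : ∀ x j, B (f j) (P x) = 0 := fun x j => by rw [← hB.neg, hPf, neg_zero]
    refine ⟨Fin.cons (P x) e, Fin.cons (P y) f, fun i j => ?_, fun i j => ?_, fun i j => ?_⟩ <;>
      refine Fin.cases ?_ (fun i => ?_) i <;> refine Fin.cases ?_ (fun j => ?_) j <;>
      simp [hPe, hPf, hPe', hPf', hee, hff, hef, hxy, hB.self_eq_zero, Fin.succ_ne_zero,
        (Fin.succ_ne_zero _).symm]

variable {m : ℕ}

/-- Every nondegenerate alternating form on `ℝ²ᵐ` is linearly equivalent to the standard one. -/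
theorem exists_equiv_stdForm {B : E m →L[ℝ] E m →L[ℝ] ℝ} (hB : ∀ u, B u u = 0)
    (hnd : ∀ u, (∀ v, B u v = 0) → u = 0) :
    ∃ L : E m ≃L[ℝ] E m, ∀ u v, B (L u) (L v) = stdForm u v := by
  let B' : E m →ₗ[ℝ] E m →ₗ[ℝ] ℝ := LinearMap.mk₂ ℝ (fun u v => B u v) (by simp) (by simp)
    (by simp) (by simp)
  obtain ⟨e, f, hee, hff, hef⟩ := exists_symplectic_family (B := B') hB hnd m
    (by simp [two_mul])
  have hee' : ∀ i j, B (e i) (e j) = 0 := hee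
  have hff' : ∀ i j, B (f i) (f j) = 0 := hff
  have hef' : ∀ i j, B (e i) (f j) = if i = j then 1 else 0 := hef
  have hfe : ∀ i j, B (f i) (e j) = -if j = i then 1 else 0 := fun i j => by
    rw [← hef j i]
    exact ((LinearMap.IsAlt.neg (B := B') hB (e j) (f i))).symm
  let T : E m →ₗ[ℝ] E m :=
    { toFun := fun u => ∑ i, (u (Sum.inl i) • e i + u (Sum.inr i) • f i)
      map_add' := fun u v => by
        simp only [PiLp.add_apply, add_smul, ← Finset.sum_add_distrib]
        exact Finset.sum_congr rfl fun i _ => by abel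
      map_smul' := fun a u => by
        simp [Finset.smul_sum, smul_smul] }
  have hT : ∀ u v, B (T u) (T v) = stdForm u v := fun u v => by
    simp only [T, LinearMap.coe_mk, AddHom.coe_mk, map_sum, map_add, map_smul,
      _root_.sum_apply, _root_.add_apply, _root_.smul_apply, smul_eq_mul, hee', hff',
      hef', hfe, mul_zero, zero_add, add_zero]
    rw [stdForm]
    refine Finset.sum_congr rfl fun i _ => ?_
    simp [mul_ite]
    ring
  have hinj : Function.Injective T := (injective_iff_map_eq_zero _).2 fun u hu =>
    stdForm_nondegenerate fun v => by rw [← hT, hu]; simp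
  exact ⟨(LinearEquiv.ofInjectiveEndo T hinj).toContinuousLinearEquiv, hT⟩

/-! ### The Poincaré lemma for 2-forms near the origin -/

theorem fderiv_skew {V : Type*} [NormedAddCommGroup V] [NormedSpace ℝ V]
    {β : V → V →L[ℝ] V →L[ℝ] ℝ} {y : V} (hβ : DifferentiableAt ℝ β y)
    (halt : ∀ y u v, β y u v = -β y v u) (a b c : V) :
    fderiv ℝ β y a b c = -fderiv ℝ β y a c b := by
  have h1 := (hβ.hasFDerivAt.clm_apply (hasFDerivAt_const b y)).clm_apply (hasFDerivAt_const c y)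
  have h2 := (hβ.hasFDerivAt.clm_apply (hasFDerivAt_const c y)).clm_apply (hasFDerivAt_const b y)
  have h3 := congrArg (fun L : V →L[ℝ] ℝ => L a)
    (h1.unique (h2.neg.congr_of_eventuallyEq (Filter.Eventually.of_forall fun y => halt y b c)))
  simpa using h3

/-- A 2-form that is closed near the origin and vanishes at the origin has a primitive near the
origin that vanishes to second order there. The forms are encoded as maps to the (bi)linear
forms. -/
theorem exists_primitive {V : Type} [NormedAddCommGroup V] [NormedSpace ℝ V]
    {β : V → V →L[ℝ] V →L[ℝ] ℝ} (hβ : ContDiff ℝ ∞ β) (halt : ∀ y u v, β y u v = -β y v u)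
    (h0 : β 0 = 0) (hcl : ∀ᶠ y in 𝓝 (0 : V), ∀ a b c,
      fderiv ℝ β y a b c + fderiv ℝ β y b c a + fderiv ℝ β y c a b = 0) :
    ∃ α : V → V →L[ℝ] ℝ, ContDiff ℝ ∞ α ∧ α 0 = 0 ∧ fderiv ℝ α 0 = 0 ∧
      ∀ᶠ y in 𝓝 0, ∀ a b, fderiv ℝ α y a b - fderiv ℝ α y b a = β y a b := by
  have hβd : ∀ y, HasFDerivAt β (fderiv ℝ β y) y := fun y =>
    (hβ.differentiable (by simp) y).hasFDerivAt
  -- the integrand of the homotopy operator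
  set F : ℝ × V → V →L[ℝ] ℝ := fun q => q.1 • β (q.1 • q.2) q.2 with hF
  have hFs : ContDiff ℝ ∞ F := contDiff_fst.smul
    ((hβ.comp (contDiff_fst.smul contDiff_snd)).clm_apply contDiff_snd)
  have hFd : ∀ s x a, spatialDeriv F (s, x) a =
      s • (s • fderiv ℝ β (s • x) a x + β (s • x) a) := by
    intro s x a
    have h1 : HasFDerivAt (fun y : V => s • y) (s • ContinuousLinearMap.id ℝ V) x :=
      (hasFDerivAt_id x).const_smul s
    have hb : HasFDerivAt (fun y : V => β (s • y))
        ((fderiv ℝ β (s • x)).comp (s • ContinuousLinearMap.id ℝ V)) x :=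
      HasFDerivAt.comp (g := β) x (hβd (s • x)) h1
    have h2 := (hb.clm_apply (hasFDerivAt_id x)).const_smul s
    rw [(hasFDerivAt_spatialDeriv hFs s x).unique h2]
    simp [add_comm]
  set DF : C(ℝ × V, V →L[ℝ] V →L[ℝ] ℝ) := ⟨spatialDeriv F, (contDiff_spatialDeriv hFs).continuous⟩
    with hDF
  let κ : V →L[ℝ] Curve V := Curve.const V
  let ev : Curve (V →L[ℝ] ℝ) →L[ℝ] V →L[ℝ] ℝ := Curve.eval _ 1
  set α : V → V →L[ℝ] ℝ := fun x =>
    ev (primitive _ (superpose ⟨F, hFs.continuous⟩ (κ x))) with hα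
  have hαs : ContDiff ℝ ∞ α := ev.contDiff.comp
    ((primitive _).contDiff.comp ((contDiff_superpose hFs).comp κ.contDiff))
  have hαd : ∀ x a, fderiv ℝ α x a =
      primitive _ (curveApply V _ (superpose DF (κ x)) (κ a)) 1 := by
    intro x a
    have h1 := (ev.comp (primitive _)).hasFDerivAt.comp x
      ((hasFDerivAt_superpose hFs (κ x)).comp x κ.hasFDerivAt)
    have h2 : HasFDerivAt α _ x := h1
    rw [h2.fderiv]
    rfl
  refine ⟨α, hαs, ?_, ?_, ?_⟩
  · have h1 : superpose ⟨F, hFs.continuous⟩ (κ 0) = 0 :=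
      Curve.ext fun s => by simp [hF]
    change ev (primitive _ (superpose ⟨F, hFs.continuous⟩ (κ 0))) = 0
    rw [h1, map_zero, map_zero]
  · refine ContinuousLinearMap.ext fun a => ?_
    have h1 : curveApply V _ (superpose DF (κ 0)) (κ a) = 0 := Curve.ext fun s => by
      change spatialDeriv F ((s : ℝ), 0) a = 0
      rw [hFd]
      simp [h0]
    rw [hαd, h1]
    simp
  · obtain ⟨r, hr, hball⟩ := Metric.eventually_nhds_iff_ball.1 hcl
    filter_upwards [Metric.ball_mem_nhds (0 : V) hr] with x hx a b
    set g : V → Curve (V →L[ℝ] ℝ) := fun a =>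
      curveApply V _ (superpose DF (κ x)) (κ a) with hg
    set G : V → ℝ → V →L[ℝ] ℝ := fun a t =>
      ∫ s in (0 : ℝ)..t, Set.IccExtend zero_le_one (g a) s with hG
    have hGd : ∀ a, ∀ t, HasDerivAt (G a) (Set.IccExtend zero_le_one (g a) t) t :=
      fun a t => hasDerivAt_primitive (g a) t
    have hGt : ∀ a, ∀ t ∈ Icc (0 : ℝ) 1, HasDerivAt (G a) (spatialDeriv F (t, x) a) t := by
      intro a t ht
      have := hGd a t
      rwa [Set.IccExtend_of_mem _ _ ht] at this
    have hQ : ∀ t : ℝ, HasDerivAt (fun t : ℝ => t ^ 2 * β (t • x) a b)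
        (2 * t * β (t • x) a b + t ^ 2 * fderiv ℝ β (t • x) x a b) t := by
      intro t
      have h1 : HasDerivAt (fun t : ℝ => t • x) x t := by
        simpa using (hasDerivAt_id t).smul_const x
      have h2 : HasDerivAt (fun t : ℝ => β (t • x)) (fderiv ℝ β (t • x) x) t :=
        HasFDerivAt.comp_hasDerivAt (l := β) t (hβd (t • x)) h1
      have h3 := (h2.clm_apply (hasDerivAt_const t a)).clm_apply (hasDerivAt_const t b)
      have h4 := (hasDerivAt_pow 2 t).mul h3
      refine h4.congr_deriv ?_
      simp
    -- the two sides have the same derivative along the ray through `x`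
    have hH : ∀ t ∈ Icc (0 : ℝ) 1, HasDerivAt
        (fun t => G a t b - G b t a - t ^ 2 * β (t • x) a b) 0 t := by
      intro t ht
      have h1 := ((hGt a t ht).clm_apply (hasDerivAt_const t b)).sub
        ((hGt b t ht).clm_apply (hasDerivAt_const t a))
      refine (h1.sub (hQ t)).congr_deriv ?_
      have htx : t • x ∈ Metric.ball (0 : V) r := by
        rw [mem_ball_zero_iff] at hx ⊢
        rw [norm_smul, Real.norm_of_nonneg ht.1]
        exact (mul_le_of_le_one_left (norm_nonneg _) ht.2).trans_lt hx
      have h2 := hball _ htx x a b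
      have h3 := fderiv_skew (hβd (t • x)).differentiableAt halt a b x
      have h4 := halt (t • x) b a
      simp only [hFd, map_zero, add_zero, _root_.smul_apply, _root_.add_apply, smul_eq_mul]
      rw [h4]
      linear_combination (-t ^ 2) * h2 + t ^ 2 * h3
    have hconst := constant_of_has_deriv_right_zero
      (fun t ht => (hH t ht).continuousAt.continuousWithinAt)
      (fun t ht => (hH t ⟨ht.1, ht.2.le⟩).hasDerivWithinAt) 1 ⟨zero_le_one, le_rfl⟩
    have hG0 : ∀ a, G a 0 = 0 := fun a => by simp [hG]
    have hG1 : ∀ a, G a 1 = fderiv ℝ α x a := fun a => (hαd x a).symm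
    simp only [hG0, hG1, one_pow, one_mul, one_smul] at hconst
    simpa [sub_eq_zero] using hconst

end SymplecticBalls
end

noncomputable section

-- this scoped instance, which is very costly for operator spaces, plays no role here
attribute [-instance] Bundle.instNormedAddCommGroupOfRiemannianBundleOfIsTopologicalAddGroupOfContinuousConstSMulReal

namespace SymplecticBalls

/-! ### Moser's argument near the origin -/

variable {m : ℕ}

/-- A closed 2-form `ω₀ + β` near the origin of `ℝ²ᵐ` with `β(0) = 0` is pulled back to the standard
form `ω₀` by a smooth map. This is the time-one map of the vector field `X` with
`ι_X (ω₀ + τ β) = -τ' α`, where `dα = β` and `τ` grows from `0` to `1`. -/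
theorem exists_pullback_eq_stdForm {β : E m → E m →L[ℝ] E m →L[ℝ] ℝ} (hβ : ContDiff ℝ ∞ β)
    (halt : ∀ y u v, β y u v = -β y v u) (h0 : β 0 = 0)
    (hsmall : ∀ y, ‖(stdSharp m).comp (β y)‖ < 1)
    (hcl : ∀ᶠ y in 𝓝 (0 : E m), ∀ a b c,
      fderiv ℝ β y a b c + fderiv ℝ β y b c a + fderiv ℝ β y c a b = 0) :
    ∃ ψ : E m → E m, (∀ᶠ x in 𝓝 0, ContDiffAt ℝ ∞ ψ x) ∧ ψ 0 = 0 ∧ ∀ᶠ x in 𝓝 0, ∀ u v,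
      stdForm (fderiv ℝ ψ x u) (fderiv ℝ ψ x v) + β (ψ x) (fderiv ℝ ψ x u) (fderiv ℝ ψ x v) =
        stdForm u v := by
  obtain ⟨α, hαs, hα0, hαd0, hαβ⟩ := exists_primitive hβ halt h0 hcl
  have hβd : ∀ y, HasFDerivAt β (fderiv ℝ β y) y := fun y =>
    (hβ.differentiable (by simp) y).hasFDerivAt
  have hαd : ∀ y, HasFDerivAt α (fderiv ℝ α y) y := fun y =>
    (hαs.differentiable (by simp) y).hasFDerivAt
  -- any smooth `τ` with `τ 0 = 0`, `τ 1 = 1` and `|τ| ≤ 1` would do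
  set τ : ℝ → ℝ := fun t => Real.sin (Real.pi / 2 * t) with hτ
  set τ' : ℝ → ℝ := fun t => Real.pi / 2 * Real.cos (Real.pi / 2 * t) with hτ'
  have hτd : ∀ t, HasDerivAt τ (τ' t) t := fun t => by
    have := ((hasDerivAt_id t).const_mul (Real.pi / 2)).sin
    simpa [hτ, hτ', mul_comm] using this
  have hτs : ContDiff ℝ ∞ τ := Real.contDiff_sin.comp (contDiff_const.mul contDiff_id)
  have hτs' : ContDiff ℝ ∞ τ' :=
    contDiff_const.mul (Real.contDiff_cos.comp (contDiff_const.mul contDiff_id))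
  -- the operator representing `ω₀ + τ β` with respect to `ω₀`
  set R : ℝ × E m → E m →L[ℝ] E m := fun q => 1 + τ q.1 • (stdSharp m).comp (β q.2) with hR
  have hRs : ContDiff ℝ ∞ R := contDiff_const.add ((hτs.comp contDiff_fst).smul
    (contDiff_const.clm_comp (hβ.comp contDiff_snd)))
  have hRu : ∀ q, IsUnit (R q) := fun q => by
    have h1 : ‖-(τ q.1 • (stdSharp m).comp (β q.2))‖ < 1 := by
      rw [norm_neg, norm_smul]
      exact (mul_le_of_le_one_left (norm_nonneg _) (Real.abs_sin_le_one _)).trans_lt (hsmall _)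
    have h2 := (Units.oneSub _ h1).isUnit
    rwa [Units.val_oneSub, sub_neg_eq_add] at h2
  have hinv : ContDiff ℝ ∞ fun q => Ring.inverse (R q) := by
    refine contDiff_iff_contDiffAt.2 fun q => ?_
    obtain ⟨w, hw⟩ := hRu q
    have h1 := contDiffAt_ringInverse ℝ (n := ∞) w
    rw [hw] at h1
    exact h1.comp q hRs.contDiffAt
  set X : ℝ × E m → E m := fun q => -τ' q.1 • Ring.inverse (R q) (stdSharp m (α q.2)) with hX
  have hXs : ContDiff ℝ ∞ X := (hτs'.comp contDiff_fst).neg.smul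
    (hinv.clm_apply ((stdSharp m).contDiff.comp (hαs.comp contDiff_snd)))
  have hXeq : ∀ t y w, stdForm (X (t, y)) w + τ t * β y (X (t, y)) w = -τ' t * α y w := by
    intro t y w
    have h1 : R (t, y) (X (t, y)) = -τ' t • stdSharp m (α y) := by
      simp only [hX, map_smul]
      congr 1
      exact congrArg (fun L : E m →L[ℝ] E m => L (stdSharp m (α y)))
        (Ring.mul_inverse_cancel _ (hRu (t, y)))
    have h2 := congrArg (fun z => stdFormL m z w) h1
    simp only [hR, _root_.add_apply, one_apply_eq_self, _root_.smul_apply, map_add,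
      map_smul, ContinuousLinearMap.comp_apply, stdFormL_apply, stdForm_stdSharp,
      smul_eq_mul] at h2
    exact h2
  have hX0 : ∀ t, X (t, 0) = 0 := fun t => by simp [hX, hα0]
  -- the defining identity of `X`, differentiated
  have hXd : ∀ t y a w, stdForm (spatialDeriv X (t, y) a) w +
      τ t * (fderiv ℝ β y a (X (t, y)) w + β y (spatialDeriv X (t, y) a) w) =
        -τ' t * fderiv ℝ α y a w := by
    intro t y a w
    have hx := hasFDerivAt_spatialDeriv hXs t y
    have h1 : HasFDerivAt (fun y => stdFormL m (X (t, y)) w) _ y :=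
      ((stdFormL m).hasFDerivAt.comp y hx).clm_apply (hasFDerivAt_const w y)
    have h2 := (((hβd y).clm_apply hx).clm_apply (hasFDerivAt_const w y)).const_mul (τ t)
    have h3 := ((hαd y).clm_apply (hasFDerivAt_const w y)).const_mul (-τ' t)
    have h4 := (h1.add h2).unique
      (h3.congr_of_eventuallyEq (Filter.Eventually.of_forall fun y => hXeq t y w))
    have h5 := congrArg (fun L : E m →L[ℝ] ℝ => L a) h4
    simp at h5
    linear_combination h5
  have hXd0 : ∀ t, spatialDeriv X (t, 0) = 0 := fun t => ContinuousLinearMap.ext fun a =>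
    stdForm_nondegenerate fun w => by
      have := hXd t 0 a w
      simpa [hX0, h0, hαd0] using this
  obtain ⟨ψ, hψs, hψ0, hψ⟩ := exists_flow hXs hX0 hXd0
  refine ⟨ψ, hψs, hψ0, ?_⟩
  filter_upwards [hψ _ (hcl.and hαβ)] with x hx u v
  obtain ⟨c, ξ, hc0, hc1, hξ0, hξ1, hode⟩ := hx
  -- the pullback of `ω₀ + τ β` under the flow is constant in time
  set f : ℝ → ℝ := fun t => stdFormL m (ξ u t) (ξ v t) + τ t * β (c t) (ξ u t) (ξ v t) with hf
  have hfd : ∀ t ∈ Icc (0 : ℝ) 1, HasDerivAt f 0 t := by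
    intro t ht
    obtain ⟨⟨hcl', hαβ'⟩, hct, hξt⟩ := hode t ht
    have h1 : HasDerivAt (fun t => stdFormL m (ξ u t) (ξ v t)) _ t :=
      ((stdFormL m).hasFDerivAt.comp_hasDerivAt t (hξt u)).clm_apply (hξt v)
    have h2 : HasDerivAt (fun t => β (c t)) (fderiv ℝ β (c t) (X (t, c t))) t :=
      HasFDerivAt.comp_hasDerivAt (l := β) t (hβd (c t)) hct
    have h3 := (hτd t).mul ((h2.clm_apply (hξt u)).clm_apply (hξt v))
    refine (h1.add h3).congr_deriv ?_
    have e1 := hXd t (c t) (ξ u t) (ξ v t)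
    have e2 := hXd t (c t) (ξ v t) (ξ u t)
    have e3 := hcl' (X (t, c t)) (ξ u t) (ξ v t)
    have e4 := fderiv_skew (hβd (c t)).differentiableAt halt (ξ u t) (ξ v t) (X (t, c t))
    have e5 := hαβ' (ξ u t) (ξ v t)
    have e6 := halt (c t) (ξ u t) (spatialDeriv X (t, c t) (ξ v t))
    have e7 := stdForm_swap (spatialDeriv X (t, c t) (ξ v t)) (ξ u t)
    simp [stdFormL_apply]
    linear_combination e1 - e2 + τ t * e3 - τ t * e4 - τ' t * e5 + τ t * e6 + e7
  have hconst := constant_of_has_deriv_right_zero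
    (fun t ht => (hfd t ht).continuousAt.continuousWithinAt)
    (fun t ht => (hfd t ⟨ht.1, ht.2.le⟩).hasDerivWithinAt) 1 ⟨zero_le_one, le_rfl⟩
  have hτ0 : τ 0 = 0 := by simp [hτ]
  have hτ1 : τ 1 = 1 := by simp [hτ]
  simpa [hf, hτ0, hτ1, hc1, hξ0, hξ1, stdFormL_apply] using hconst

end SymplecticBalls
end

noncomputable section

-- this scoped instance, which is very costly for operator spaces, plays no role here
attribute [-instance] Bundle.instNormedAddCommGroupOfRiemannianBundleOfIsTopologicalAddGroupOfContinuousConstSMulReal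

namespace SymplecticBalls

/-! ### Darboux charts -/

variable {m : ℕ}

section Cutoff

variable {G : Type} [NormedAddCommGroup G] [NormedSpace ℝ G]

/-- A map that is smooth near the origin and vanishes there may be changed away from the origin to a
small globally smooth map, by multiplication with a function with values in `[0, 1]`. -/
theorem exists_contDiff_eventuallyEq {β₀ : E m → G} {U : Set (E m)} (hU : U ∈ 𝓝 0)
    (hβ : ∀ y ∈ U, ContDiffAt ℝ ∞ β₀ y) (h0 : β₀ 0 = 0) {N : Set G} (hN : N ∈ 𝓝 0) :
    ∃ κ : E m → ℝ, ContDiff ℝ ∞ (fun y => κ y • β₀ y) ∧ (∀ᶠ y in 𝓝 0, κ y = 1) ∧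
      ∀ y, κ y • β₀ y ∈ N := by
  obtain ⟨ε, hε, hεN⟩ := Metric.mem_nhds_iff.1 hN
  have h1 : ∀ᶠ y in 𝓝 (0 : E m), β₀ y ∈ Metric.ball 0 ε :=
    (hβ 0 (mem_of_mem_nhds hU)).continuousAt.eventually
      (by rw [h0]; exact Metric.ball_mem_nhds _ hε)
  obtain ⟨r, hr, hball⟩ := Metric.nhds_basis_closedBall.mem_iff.1 (Filter.inter_mem hU h1)
  let κ : ContDiffBump (0 : E m) := ⟨r / 2, r, half_pos hr, half_lt_self hr⟩
  have hκ0 : ∀ y ∉ Metric.closedBall (0 : E m) r, κ y = 0 := fun y hy => by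
    by_contra h
    have h2 : y ∈ Function.support κ := h
    rw [κ.support_eq] at h2
    exact hy (Metric.ball_subset_closedBall h2)
  refine ⟨κ, contDiff_iff_contDiffAt.2 fun y => ?_, κ.eventuallyEq_one, fun y => ?_⟩
  · by_cases hy : y ∈ Metric.closedBall (0 : E m) r
    · exact κ.contDiff.contDiffAt.smul (hβ y (hball hy).1)
    · refine (contDiffAt_const (c := (0 : G))).congr_of_eventuallyEq ?_
      filter_upwards [Metric.isClosed_closedBall.isOpen_compl.mem_nhds hy] with z hz
      rw [hκ0 z hz, zero_smul]
  · refine hεN ?_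
    by_cases hy : y ∈ Metric.closedBall (0 : E m) r
    · have h2 := (hball hy).2
      simp only [mem_ofPred_eq, mem_ball_zero_iff] at h2
      rw [mem_ball_zero_iff, norm_smul, Real.norm_of_nonneg κ.nonneg]
      exact (mul_le_of_le_one_left (norm_nonneg _) κ.le_one).trans_lt h2
    · rw [hκ0 y hy, zero_smul]
      exact Metric.mem_ball_self hε

end Cutoff

variable (m) in
/-- Alternating 2-forms as bilinear maps. -/
def toBilin : E m [⋀^Fin 2]→L[ℝ] ℝ →L[ℝ] E m →L[ℝ] E m →L[ℝ] ℝ :=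
  (ContinuousLinearMap.compL ℝ (E m) (E m [×1]→L[ℝ] ℝ) (E m →L[ℝ] ℝ)
    ((continuousMultilinearCurryFin1 ℝ (E m) ℝ).toContinuousLinearEquiv :
      (E m [×1]→L[ℝ] ℝ) →L[ℝ] E m →L[ℝ] ℝ)).comp
  (((continuousMultilinearCurryLeftEquiv ℝ (fun _ : Fin 2 => E m) ℝ).toContinuousLinearEquiv :
      (E m [×2]→L[ℝ] ℝ) →L[ℝ] E m →L[ℝ] E m [×1]→L[ℝ] ℝ).comp
    (ContinuousAlternatingMap.toContinuousMultilinearMapCLM ℝ))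

theorem toBilin_apply (w : E m [⋀^Fin 2]→L[ℝ] ℝ) (u v : E m) : toBilin m w u v = w ![u, v] := by
  have h : toBilin m w u v = w (Fin.cons u (Fin.snoc 0 v)) := rfl
  rw [h]
  congr 1
  ext i : 1
  fin_cases i <;> rfl

theorem contDiff_toBilin : ContDiff ℝ ∞ (toBilin m) :=
  ContinuousLinearMap.contDiff (𝕜 := ℝ) (E := E m [⋀^Fin 2]→L[ℝ] ℝ)
    (F := E m →L[ℝ] E m →L[ℝ] ℝ) (toBilin m)

theorem apply_swap (w : E m [⋀^Fin 2]→L[ℝ] ℝ) (u v : E m) : w ![u, v] = -w ![v, u] := by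
  have h := w.toAlternatingMap.map_swap ![v, u] (i := 0) (j := 1) (by decide)
  have h2 : ![v, u] ∘ Equiv.swap (0 : Fin 2) 1 = ![u, v] := by
    ext i : 1
    fin_cases i <;> rfl
  rw [h2] at h
  exact h

/-- Closedness of a 2-form in terms of the associated bilinear forms. -/
theorem fderiv_toBilin_of_extDeriv_eq_zero {w : E m → E m [⋀^Fin 2]→L[ℝ] ℝ} {y : E m}
    (hw : DifferentiableAt ℝ w y) (hcl : extDeriv w y = 0) (a b c : E m) :
    fderiv ℝ (fun y => toBilin m (w y)) y a b c + fderiv ℝ (fun y => toBilin m (w y)) y b c a +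
      fderiv ℝ (fun y => toBilin m (w y)) y c a b = 0 := by
  have hd : HasFDerivAt (fun y => toBilin m (w y)) (fderiv ℝ (fun y => toBilin m (w y)) y) y :=
    ((contDiff_toBilin.differentiable (by simp) (w y)).comp y hw).hasFDerivAt
  set D := fderiv ℝ (fun y => toBilin m (w y)) y with hD
  have h1 : ∀ a b c : E m, fderiv ℝ (fun y => w y ![b, c]) y a = D a b c := by
    intro a b c
    have h2 := (hd.clm_apply (hasFDerivAt_const b y)).clm_apply (hasFDerivAt_const c y)
    simp only [toBilin_apply] at h2
    rw [h2.fderiv]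
    simp
  have hskew : ∀ a b c : E m, D a b c = -D a c b := by
    intro a b c
    rw [← h1, ← h1, ← _root_.neg_apply, ← fderiv_neg]
    congr 2
    ext y
    exact apply_swap _ _ _
  have h3 := congrArg (fun η : E m [⋀^Fin 3]→L[ℝ] ℝ => η ![a, b, c]) hcl
  simp only [extDeriv_apply hw] at h3
  replace h3 := (Fin.sum_univ_three _).symm.trans h3
  have e0 : Fin.removeNth (0 : Fin 3) ![a, b, c] = ![b, c] := by
    ext i : 1
    fin_cases i <;> rfl
  have e1 : Fin.removeNth (1 : Fin 3) ![a, b, c] = ![a, c] := by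
    ext i : 1
    fin_cases i <;> rfl
  have e2 : Fin.removeNth (2 : Fin 3) ![a, b, c] = ![a, b] := by
    ext i : 1
    fin_cases i <;> rfl
  rw [e0, e1, e2] at h3
  simp [h1] at h3
  linear_combination h3 + hskew b a c

/-- A closed 2-form near a point `y₀` of `ℝ²ᵐ` that is nondegenerate at `y₀` is pulled back to the
standard form by a map that is smooth near the origin. -/
theorem exists_pullback_eq_stdForm_of_nondegenerate {w : E m → E m [⋀^Fin 2]→L[ℝ] ℝ}
    {T : Set (E m)} (hT : IsOpen T) {y₀ : E m} (hy₀ : y₀ ∈ T) (hw : ContDiffOn ℝ ∞ w T)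
    (hcl : ∀ y ∈ T, extDeriv w y = 0) (hnd : ∀ u, (∀ v, w y₀ ![u, v] = 0) → u = 0) :
    ∃ Θ : E m → E m, Θ 0 = y₀ ∧ (∀ᶠ x in 𝓝 0, ContDiffAt ℝ ∞ Θ x) ∧ ∀ᶠ x in 𝓝 0, ∀ u v,
      w (Θ x) ![fderiv ℝ Θ x u, fderiv ℝ Θ x v] = stdForm u v := by
  obtain ⟨L, hL⟩ := exists_equiv_stdForm (B := toBilin m (w y₀))
    (fun u => by
      rw [toBilin_apply]
      have := apply_swap (w y₀) u u
      linarith)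
    (fun u hu => hnd u fun v => by rw [← toBilin_apply, hu])
  -- pull back by the affine map `A` and split off the standard form
  let A : E m → E m := fun z => y₀ + L z
  have hA : ContDiff ℝ ∞ A := contDiff_const.add L.contDiff
  have hAd : ∀ z, HasFDerivAt A (L : E m →L[ℝ] E m) z := fun z =>
    L.hasFDerivAt.const_add y₀
  let P : (E m →L[ℝ] ℝ) →L[ℝ] E m →L[ℝ] ℝ :=
    (ContinuousLinearMap.compL ℝ (E m) (E m) ℝ).flip (L : E m →L[ℝ] E m)
  let β₀ : E m → E m →L[ℝ] E m →L[ℝ] ℝ := fun z =>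
    P.comp ((toBilin m (w (A z))).comp (L : E m →L[ℝ] E m)) - stdFormL m
  have hβ₀ : ∀ z u v, β₀ z u v = w (A z) ![L u, L v] - stdForm u v := fun z u v => by
    rw [← toBilin_apply]; rfl
  set U : Set (E m) := A ⁻¹' T with hU
  have hUo : IsOpen U := hT.preimage hA.continuous
  have hU0 : (0 : E m) ∈ U := by simpa [hU, A] using hy₀
  have hwA : ∀ z ∈ U, ContDiffAt ℝ ∞ w (A z) := fun z hz => hw.contDiffAt (hT.mem_nhds hz)
  have hs : ∀ z ∈ U, ContDiffAt ℝ ∞ β₀ z := fun z hz => by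
    have h1 : ContDiffAt ℝ ∞ (fun z => toBilin m (w (A z))) z :=
      contDiff_toBilin.contDiffAt.comp z ((hwA z hz).comp z hA.contDiffAt)
    exact (contDiffAt_const.clm_comp (h1.clm_comp contDiffAt_const)).sub contDiffAt_const
  have h00 : β₀ 0 = 0 := by
    ext u v
    rw [hβ₀, ← hL, toBilin_apply]
    simp [A]
  obtain ⟨κ, hκs, hκ1, hκN⟩ := exists_contDiff_eventuallyEq (hUo.mem_nhds hU0) hs h00
    (N := {B | ‖(stdSharp m).comp B‖ < 1}) (by
      refine (isOpen_lt ?_ continuous_const).mem_nhds (by simp)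
      exact (continuous_const.clm_comp continuous_id).norm)
  have hskew : ∀ z u v, β₀ z u v = -β₀ z v u := fun z u v => by
    rw [hβ₀, hβ₀, apply_swap, stdForm_swap]; ring
  have heq : (fun z => κ z • β₀ z) =ᶠ[𝓝 0] β₀ := hκ1.mono fun z hz => by simp [hz]
  obtain ⟨ψ, hψs, hψ0, hψ⟩ := exists_pullback_eq_stdForm hκs
    (fun z u v => by simp [hskew z u v]) (by simp [h00]) hκN (by
      filter_upwards [heq.eventually_nhds, hUo.mem_nhds hU0] with z hz hzU a b c
      have hdiff : DifferentiableAt ℝ w (A z) := (hwA z hzU).differentiableAt (by simp)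
      have h1 := fderiv_toBilin_of_extDeriv_eq_zero hdiff (hcl _ hzU)
      have h2 : HasFDerivAt (fun y => toBilin m (w y)) _ (A z) :=
        ((contDiff_toBilin.differentiable (by simp) (w (A z))).comp (A z) hdiff).hasFDerivAt
      have h3 : HasFDerivAt (fun z => toBilin m (w (A z))) _ z :=
        HasFDerivAt.comp (g := fun y => toBilin m (w y)) z h2 (hAd z)
      have h4 : HasFDerivAt β₀ (fderiv ℝ β₀ z) z :=
        ((hs z hzU).differentiableAt (by simp)).hasFDerivAt
      have h5 : ∀ a b c, fderiv ℝ β₀ z a b c =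
          fderiv ℝ (fun y => toBilin m (w y)) (A z) (L a) (L b) (L c) := fun a b c => by
        have k1 := (h4.clm_apply (hasFDerivAt_const b z)).clm_apply (hasFDerivAt_const c z)
        have k2 := ((h3.clm_apply (hasFDerivAt_const (L b) z)).clm_apply
          (hasFDerivAt_const (L c) z)).sub_const (stdForm b c)
        have k3 := congrArg (fun η : E m →L[ℝ] ℝ => η a) (k1.unique (k2.congr_of_eventuallyEq
          (Filter.Eventually.of_forall fun z =>
            (hβ₀ z b c).trans (by rw [← toBilin_apply]))))
        simp at k3
        exact k3
      rw [Filter.EventuallyEq.fderiv_eq hz, h5, h5, h5]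
      exact h1 _ _ _)
  have hψc : Filter.Tendsto ψ (𝓝 0) (𝓝 0) := by
    have := hψs.self_of_nhds.continuousAt
    rwa [ContinuousAt, hψ0] at this
  refine ⟨fun x => A (ψ x), by simp [A, hψ0], hψs.mono fun x hx => hA.contDiffAt.comp x hx, ?_⟩
  filter_upwards [hψ, hψs, hψc.eventually heq] with x hx hxs hxe u v
  have h1 : fderiv ℝ (fun x => A (ψ x)) x = (L : E m →L[ℝ] E m).comp (fderiv ℝ ψ x) :=
    ((hAd (ψ x)).comp x (hxs.differentiableAt (by simp)).hasFDerivAt).fderiv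
  have h2 := hx u v
  simp only [hxe, hβ₀] at h2
  rw [h1]
  simpa using h2

variable {M : Type*} [TopologicalSpace M] [ChartedSpace (E m) M] [IsManifold 𝓘(ℝ, E m) ∞ M]

/-- An open partial homeomorphism of `ℝ²ᵐ` with smooth inverse changes charts to charts. -/
theorem trans_symm_mem_maximalAtlas {χ : OpenPartialHomeomorph M (E m)}
    (hχ : χ ∈ atlas (E m) M) {T : OpenPartialHomeomorph (E m) (E m)}
    (hT : ContDiffOn ℝ ∞ T T.source) (hT' : ContDiffOn ℝ ∞ T.symm T.target) :
    χ.trans T.symm ∈ IsManifold.maximalAtlas 𝓘(ℝ, E m) ∞ M := by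
  have hTG : T ∈ contDiffGroupoid ∞ 𝓘(ℝ, E m) := by
    rw [contDiffGroupoid, mem_groupoid_of_pregroupoid]
    simpa [contDiffPregroupoid] using And.intro hT hT'
  intro e he
  constructor
  · rw [OpenPartialHomeomorph.trans_symm_eq_symm_trans_symm, OpenPartialHomeomorph.symm_symm,
      OpenPartialHomeomorph.trans_assoc]
    exact (contDiffGroupoid ∞ 𝓘(ℝ, E m)).trans hTG
      (HasGroupoid.compatible hχ he)
  · rw [← OpenPartialHomeomorph.trans_assoc]
    exact (contDiffGroupoid ∞ 𝓘(ℝ, E m)).trans (HasGroupoid.compatible he hχ)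
      ((contDiffGroupoid ∞ 𝓘(ℝ, E m)).symm hTG)

/-- **Darboux's theorem**. -/
theorem exists_isDarboux (σ : SymplecticForm m M) (x : M) :
    ∃ φ, IsDarboux σ φ ∧ x ∈ φ.source := by
  set χ := chartAt (E m) x with hχ
  have hχa : χ ∈ atlas (E m) M := chart_mem_atlas _ _
  have hχm := mem_maximalAtlas_of_mem_atlas hχa
  have hx : x ∈ χ.source := mem_chart_source _ _
  have hform : ∀ y u v, inChart σ.form χ y ![u, v] = σ.form (χ.symm y)
      ![mfderiv 𝓘(ℝ, E m) 𝓘(ℝ, E m) χ.symm y u, mfderiv 𝓘(ℝ, E m) 𝓘(ℝ, E m) χ.symm y v] := by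
    intro y u v
    change σ.form (χ.symm y) _ = _
    congr 1
    ext i : 1
    fin_cases i <;> rfl
  have hnd : ∀ u : E m, (∀ v : E m, inChart σ.form χ (χ x) ![u, v] = 0) → u = 0 := by
    have hsurj : Function.Surjective (chartSymmDeriv χ (χ x)) := fun v =>
      ⟨_, chartSymmDeriv_chartDeriv hχm hx v⟩
    have hinj : Function.Injective (chartSymmDeriv χ (χ x)) :=
      (LinearMap.injective_iff_surjective
        (f := (chartSymmDeriv χ (χ x)).toLinearMap)).2 hsurj
    intro u hu
    refine hinj ((σ.nondegenerate (χ.symm (χ x)) (chartSymmDeriv χ (χ x) u) fun v => ?_).trans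
      (map_zero (chartSymmDeriv χ (χ x))).symm)
    obtain ⟨v, rfl⟩ := hsurj v
    exact (hform _ _ _).symm.trans (hu v)
  obtain ⟨Θ, hΘ0, hΘs, hΘ⟩ := exists_pullback_eq_stdForm_of_nondegenerate χ.open_target
    (χ.map_source hx) (σ.smooth χ hχa) (σ.closed χ hχa) hnd
  have hinj : ∀ z, (∀ u v, inChart σ.form χ (Θ z) ![fderiv ℝ Θ z u, fderiv ℝ Θ z v] =
      stdForm u v) → Function.Injective (fderiv ℝ Θ z) := fun z hz =>
    (injective_iff_map_eq_zero _).2 fun u hu => stdForm_nondegenerate fun v => by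
      rw [← hz, hu, ← toBilin_apply, map_zero]
      rfl
  obtain ⟨V, hV, hVo, hV0⟩ := eventually_nhds_iff.1 (hΘs.and hΘ)
  let D : ∀ z ∈ V, E m ≃L[ℝ] E m := fun z hz => (LinearEquiv.ofInjectiveEndo
    (fderiv ℝ Θ z).toLinearMap (hinj z (hV z hz).2)).toContinuousLinearEquiv
  have hD : ∀ z (hz : z ∈ V), HasFDerivAt Θ (D z hz : E m →L[ℝ] E m) z := fun z hz =>
    ((hV z hz).1.differentiableAt (by simp)).hasFDerivAt
  set T := ((hV 0 hV0).1.toOpenPartialHomeomorph Θ (hD 0 hV0) (by simp)).restrOpen V hVo with hT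
  have hTV : ∀ z ∈ T.source, z ∈ V := fun z hz => hz.2
  have hTe : ∀ z, T z = Θ z := fun z => rfl
  have h0T : (0 : E m) ∈ T.source :=
    ⟨(hV 0 hV0).1.mem_toOpenPartialHomeomorph_source (hD 0 hV0) (by simp), hV0⟩
  have hTs : ContDiffOn ℝ ∞ T T.source := fun z hz => (hV z (hTV z hz)).1.contDiffWithinAt
  have hTs' : ContDiffOn ℝ ∞ T.symm T.target := fun z hz =>
    (T.contDiffAt_symm hz (hD _ (hTV _ (T.map_target hz)))
      (hV _ (hTV _ (T.map_target hz))).1).contDiffWithinAt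
  refine ⟨χ.trans T.symm, ⟨trans_symm_mem_maximalAtlas hχa hTs hTs', fun y hy u v => ?_⟩, hx, ?_⟩
  · obtain ⟨hy1, hy2⟩ := hy
    have hyV : y ∈ V := hTV y hy1
    have hyt : Θ y ∈ χ.target := hy2
    have hd1 : MDifferentiableAt 𝓘(ℝ, E m) 𝓘(ℝ, E m) χ.symm (Θ y) :=
      (contMDiffAt_chart_symm hχm hyt).mdifferentiableAt (by simp)
    have hd2 : DifferentiableAt ℝ Θ y := (hV y hyV).1.differentiableAt (by simp)
    have h1 : mfderiv 𝓘(ℝ, E m) 𝓘(ℝ, E m) (χ.trans T.symm).symm y =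
        (mfderiv 𝓘(ℝ, E m) 𝓘(ℝ, E m) χ.symm (Θ y)).comp (fderiv ℝ Θ y) := by
      refine (mfderiv_comp y hd1 hd2.mdifferentiableAt).trans ?_
      rw [mfderiv_eq_fderiv]
      rfl
    rw [← (hV y hyV).2 u v, hform, h1]
    rfl
  · change χ x ∈ T.target
    rw [← hΘ0]
    exact T.map_source h0T

end SymplecticBalls
end

open SymplecticBalls in
theorem lemma2p2 (m n : ℕ) (hn : 1 ≤ n)
    (M : Type*) [TopologicalSpace M] [T2Space M] [CompactSpace M]
    [ChartedSpace (E m) M] [IsManifold 𝓘(ℝ, E m) ∞ M] (σ : SymplecticForm m M) :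
    (∃ c₀ : Cap n, ∀ c : Cap n, c ≤ c₀ →
      Function.Surjective (pi0Map (jc σ c)) ∧
      ∀ A : SpFr σ n, ∃ f : Emb σ c, jc σ c f = A ∧
        ∀ k : ℕ, 1 ≤ k → Function.Surjective (piMap k (jc σ c) f)) ∧
    IsWeakHomotopyEquiv (jInf σ n) := by
  have hD := exists_isDarboux σ
  exact ⟨exists_capacities hD n, isWeakHomotopyEquiv_jInf hD n⟩
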